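/- Let $D=6$ with signature $(t,6-t)$, $t\in\{1,3,5\}$, i.e. $(\eta_{ab})=\mathrm{diag}(-1,\dots,-1,+1,\dots,+1)$ with $t$ entries $-1$. Let $\gamma^1,\dots,\gamma^6$ be complex $8\times 8$ matrices with $\gamma^a\gamma^b+\gamma^b\gamma^a=2\eta^{ab}\,\mathbb{1}$, put $\gamma_a=\eta_{ab}\gamma^b$, let $\hat\gamma$ be a chirality matrix ($\hat\gamma^2=\mathbb{1}$, $\hat\gamma\gamma^a=-\gamma^a\hat\gamma$), and let $C$ be an invertible charge conjugation matrix with $\gamma_a^\top=-C\gamma_aC^{-1}$ and $C^\top=C$. Let $N_++N_-=4$, and let $\xi_1,\dots,\xi_4$ be commuting row spinors (supersymmetry ghosts) with components $\xi_i^\alpha$, $\alpha=1,\dots,8$, subject only to the chirality conditions $\xi_i\hat\gamma=\xi_i$ for $i\le N_+$ and $\xi_i\hat\gamma=-\xi_i$ for $i>N_+$. Let $c^1,\dots,c^6$ be anticommuting variables (translation ghosts), and let $\Omega$ be the algebra of polynomials with complex coefficients in the $c^a$ and the $\xi_i^\alpha$. On $\Omega$ consider the coboundary operator $$ b=-\tfrac12\,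 M^{ij}\,(\gamma^aC^{-1})_{\alpha\beta}\,\xi_i^\alpha\xi_j^\beta\,\frac{\partial}{\partial c^a},\qquad M=\mathbb{1}_{2\times2}\otimes\sigma_2,\quad \sigma_2=\begin{pmatrix}0&-\mathrm{i}\\ \mathrm{i}&0\end{pmatrix}, $$ with repeated indices summed; equivalently, $b$ is the antiderivation with $b\,\xi_i^\alpha=0$ and $b\,c^a=\mathrm{i}\,(\xi_1\gamma^aC^{-1}\xi_2^\top+\xi_3\gamma^aC^{-1}\xi_4^\top)$. Write $\omega\sim\omega'$ if $\omega-\omega'=b\,\eta$ for some $\eta\in\Omega$, and set $\Theta^{(1)}_{ij}=c^a\,\xi_i\gamma_aC^{-1}\xi_j^\top$. (i) If $(N_+,N_-)=(2,2)$, then for every $\omega\in\Omega$: $b\,\omega=0$ if and only if $$\omega\sim(\Theta^{(1)}_{12}-\Theta^{(1)}_{34})\,p_1(\xi)+p_0(\xi)$$ for some polynomials $p_0,p_1$ in the components of $\xi_1,\dots,\xi_4$. (ii) If $(N_+,N_-)=(4,0)$ or $(N_+,N_-)=(0,4)$, then for every $\omega\in\Omega$: $b\,\omega=0$ if and only if $$\omega\sim\Theta^{(1)}_{13}\,p_1^{13}(\xi)+\Theta^{(1)}_{14}\,p_1^{14}(\xi)+\Theta^{(1)}_{23}\,p_1^{23}(\xi)+\Theta^{(1)}_{24}\,p_1^{24}(\xi)+(\Theta^{(1)}_{12}-\Theta^{(1)}_{34})\,p_1(\xi)+p_0(\xi)$$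 for some polynomials $p_0,p_1,p_1^{13},p_1^{14},p_1^{23},p_1^{24}$ in the components of $\xi_1,\dots,\xi_4$. -/

import Mathlib

namespace SusyD6

/-- The flat metric of signature `(t, 6 - t)`: the first `t` diagonal entries are `-1`, the others
are `+1`. -/
def metric (t : ℕ) (a b : Fin 6) : ℂ :=
  if a = b then (if (a : ℕ) < t then -1 else 1) else 0

/-- A spinor representation in dimension 6 with signature `(t, 6 - t)`: gamma matrices `γ^a`
(with upper index) generating the Clifford algebra, the chirality matrix, and a charge conjugation
matrix with `γ_a^⊤ = -C γ_a C⁻¹` and `C^⊤ = C`. -/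
structure SpinorRep (t : ℕ) where
  /-- the gamma matrices `γ^a` -/
  gam : Fin 6 → Matrix (Fin 8) (Fin 8) ℂ
  clifford : ∀ a b, gam a * gam b + gam b * gam a =
    (2 * metric t a b) • (1 : Matrix (Fin 8) (Fin 8) ℂ)
  /-- the chirality matrix -/
  gamHat : Matrix (Fin 8) (Fin 8) ℂ
  gamHat_sq : gamHat * gamHat = 1
  gamHat_anticomm : ∀ a, gamHat * gam a + gam a * gamHat = 0
  /-- the charge conjugation matrix -/
  C : Matrix (Fin 8) (Fin 8) ℂ
  C_isUnit : IsUnit C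
  gam_transpose : ∀ a, (gam a).transpose = -(C * gam a * C⁻¹)
  C_transpose : C.transpose = C

/-- The gamma matrices `γ_a = η_{ab} γ^b` with lower index. -/
noncomputable def SpinorRep.gamLow {t : ℕ} (S : SpinorRep t) (a : Fin 6) :
    Matrix (Fin 8) (Fin 8) ℂ :=
  ∑ b, metric t a b • S.gam b

/-- The matrix `M = 1 ⊗ σ₂` (with `N / 2` diagonal blocks `σ₂`) that couples the supersymmetries;
in numbering from `0`, the blocks couple the indices `2k` and `2k + 1`. -/
noncomputable def couplingMatrix (N : ℕ) (i j : Fin N) : ℂ :=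
  if (i : ℕ) % 2 = 0 ∧ (j : ℕ) = i + 1 then -Complex.I
  else if (j : ℕ) % 2 = 0 ∧ (i : ℕ) = j + 1 then Complex.I
  else 0

/-- Chirality of the `i`-th supersymmetry ghost: the first `Np` ghosts are positive, the last `Nm`
are negative. -/
def chirality (Np Nm : ℕ) (i : Fin (Np + Nm)) : ℂ :=
  if (i : ℕ) < Np then 1 else -1

section

variable {t : ℕ} (S : SpinorRep t) (Np Nm : ℕ)

/-- The ideal of the chirality conditions `ξ_i γ̂ = ± ξ_i` (row spinors) in the polynomial ring in
the symbols `ξ_i^α`. -/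
noncomputable def chiralityIdeal : Ideal (MvPolynomial (Fin (Np + Nm) × Fin 8) ℂ) :=
  Ideal.span (Set.range fun x : Fin (Np + Nm) × Fin 8 =>
    ∑ β, MvPolynomial.C (S.gamHat β x.2) * MvPolynomial.X (x.1, β)
      - MvPolynomial.C (chirality Np Nm x.1) * MvPolynomial.X x)

/-- Complex polynomials in the components of the commuting supersymmetry ghosts `ξ_i`, which are
Weyl spinors: `ξ_i γ̂ = ξ_i` for the first `Np` and `ξ_i γ̂ = -ξ_i` for the last `Nm` ghosts. -/
abbrev SusyPoly : Type :=
  MvPolynomial (Fin (Np + Nm) × Fin 8) ℂ ⧸ chiralityIdeal S Np Nm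

/-- The component `ξ_i^α` of the `i`-th supersymmetry ghost. -/
noncomputable def xi (i : Fin (Np + Nm)) (α : Fin 8) : SusyPoly S Np Nm :=
  Ideal.Quotient.mk (chiralityIdeal S Np Nm) (MvPolynomial.X (i, α))

/-- The bilinear `ξ_i A ξ_j^⊤ = ξ_i^α A_{αβ} ξ_j^β`. -/
noncomputable def bilin (A : Matrix (Fin 8) (Fin 8) ℂ) (i j : Fin (Np + Nm)) :
    SusyPoly S Np Nm :=
  ∑ α, ∑ β, A α β • (xi S Np Nm i α * xi S Np Nm j β)

/-- The space of ghost polynomials: polynomials in the `ξ_i^α` and the anticommuting translation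
ghosts `c^1, …, c^6`. -/
abbrev Ghost : Type :=
  ExteriorAlgebra (SusyPoly S Np Nm) (Fin 6 → SusyPoly S Np Nm)

/-- The translation ghost `c^a`. -/
noncomputable def c (a : Fin 6) : Ghost S Np Nm :=
  ExteriorAlgebra.ι (SusyPoly S Np Nm) (Pi.single a 1)

/-- The value of the coboundary operator on `c^a`:
`-1/2 M^{ij} (γ^a C⁻¹)_{αβ} ξ_i^α ξ_j^β`. -/
noncomputable def bc (a : Fin 6) : SusyPoly S Np Nm :=
  ∑ i, ∑ j, (-(1 / 2 : ℂ) * couplingMatrix (Np + Nm) i j) •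
    bilin S Np Nm (S.gam a * S.C⁻¹) i j

/-- The coboundary operator
`b = -1/2 M^{ij} (γ^a C⁻¹)_{αβ} ξ_i^α ξ_j^β ∂/∂c^a`, i.e. the contraction of the exterior algebra
with the linear form `c^a ↦ bc a`. -/
noncomputable def b : Ghost S Np Nm →ₗ[SusyPoly S Np Nm] Ghost S Np Nm :=
  CliffordAlgebra.contractLeft (Q := (0 : QuadraticForm (SusyPoly S Np Nm)
      (Fin 6 → SusyPoly S Np Nm)))
    (∑ a, bc S Np Nm a • LinearMap.proj a)

/-- Equivalence `ω₁ ∼ ω₂` in the cohomology of `b`. -/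
def Equivalent (ω₁ ω₂ : Ghost S Np Nm) : Prop :=
  ∃ ω₃ : Ghost S Np Nm, ω₁ - ω₂ = b S Np Nm ω₃

/-- The ghost polynomial `Θ^{(1)}_{ij} = c^a ξ_i γ_a C⁻¹ ξ_j^⊤`. -/
noncomputable def Theta (i j : Fin (Np + Nm)) : Ghost S Np Nm :=
  ∑ a, bilin S Np Nm (S.gamLow a * S.C⁻¹) i j • c S Np Nm a

end

end SusyD6

/-! The operator `b` is a Koszul differential: it contracts the exterior algebra on six generators
with the linear form whose values are the six quadrics `bc a` in the ghost components. Its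
cohomology therefore reflects the relations among these quadrics.

A Fock basis of spinors (`SpinorRep.exists_frame`) makes the component ring a retract of a
polynomial ring in 16 variables, the entries of a 4 × 4 matrix with rows r₀, …, r₃. The bilinears of
two ghosts of equal chirality become the six 2 × 2 minors of their rows, since the vector of SO(6)
is Λ² of either half-spin representation; the opposite chirality uses the complementary columns. The
quadrics are thus the coefficients of r₀∧r₁ + r₂∧r₃ for equal chirality, and of r₀∧r₁ + *(r₂∧r₃) in
the mixed case. The listed combinations of Θ are closed because of repeated rows and Plücker
relations.

Conversely, five of the quadrics form a regular sequence, with ideal I say, so their Koszul complex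
is acyclic in positive degrees. Adding the sixth quadric q creates, up to coboundaries, only
constants and linear cocycles whose q-coefficient lies in the colon ideal I : q
(`Acyclic.exists_eq`). It remains to see that the q-coefficients of the closed Θ generate I : q
modulo I (`Chiral.mem_of_quad_mul_mem`, `Mixed.mem_of_last_mul_mem`).

To find colon ideals, eleven linear forms are adjoined to the five quadrics as parameters. What is
left is an Artinian complete intersection in five variables, where a colon ideal follows from
Gorenstein duality (`colon_le_of_duality`); a graded Nakayama argument lifts it back
(`colon_lift_list`). In the mixed case duality is applied to `minor 0 1 0 1` instead of q. It shows
that the parameters stay regular modulo I + (minor), and q is then found to be a nonzerodivisor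
there. -/

/-! ### Koszul complexes along a list of vectors -/

namespace KoszulList

open CliffordAlgebra (contractLeft)
open ExteriorAlgebra (ι)

variable {R M : Type*} [CommRing R] [AddCommGroup M] [Module R M]

/-- The contraction of the exterior algebra with a linear form. -/
noncomputable abbrev contr (d : Module.Dual R M) : ExteriorAlgebra R M →ₗ[R] ExteriorAlgebra R M :=
  contractLeft (Q := (0 : QuadraticForm R M)) d

theorem contr_ι_mul (d : Module.Dual R M) (v : M) (x : ExteriorAlgebra R M) :
    contr d (ι R v * x) = d v • x - ι R v * contr d x :=
  CliffordAlgebra.contractLeft_ι_mul d v x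

theorem contr_algebraMap (d : Module.Dual R M) (r : R) :
    contr d (algebraMap R (ExteriorAlgebra R M) r) = 0 :=
  CliffordAlgebra.contractLeft_algebraMap _ d r

theorem contr_ι (d : Module.Dual R M) (v : M) :
    contr d (ι R v) = algebraMap R (ExteriorAlgebra R M) (d v) :=
  CliffordAlgebra.contractLeft_ι _ d v

theorem contr_contr (d : Module.Dual R M) (x : ExteriorAlgebra R M) : contr d (contr d x) = 0 :=
  CliffordAlgebra.contractLeft_contractLeft d x

/-- The submodule of the exterior algebra spanned by the products of the vectors of a list. -/
noncomputable def prodSpan : List M → Submodule R (ExteriorAlgebra R M)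
  | [] => LinearMap.range (Algebra.linearMap R (ExteriorAlgebra R M))
  | v :: l => prodSpan l ⊔ (prodSpan l).map (LinearMap.mulLeft R (ι R v))

theorem mem_prodSpan_cons {v : M} {l : List M} {x : ExteriorAlgebra R M} :
    x ∈ prodSpan (v :: l) ↔ ∃ y ∈ prodSpan l, ∃ z ∈ prodSpan l, x = y + ι R v * z := by
  simp only [prodSpan, Submodule.mem_sup, Submodule.mem_map, LinearMap.mulLeft_apply]
  constructor
  · rintro ⟨y, hy, _, ⟨z, hz, rfl⟩, rfl⟩
    exact ⟨y, hy, z, hz, rfl⟩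
  · rintro ⟨y, hy, z, hz, rfl⟩
    exact ⟨y, hy, _, ⟨z, hz, rfl⟩, rfl⟩

theorem prodSpan_le_cons (v : M) (l : List M) : prodSpan (R := R) l ≤ prodSpan (v :: l) :=
  le_sup_left

theorem ι_mul_mem_cons (v : M) {l : List M} {x : ExteriorAlgebra R M} (hx : x ∈ prodSpan l) :
    ι R v * x ∈ prodSpan (v :: l) :=
  mem_prodSpan_cons.2 ⟨0, Submodule.zero_mem _, x, hx, by simp⟩

theorem algebraMap_mem (r : R) : ∀ l : List M, algebraMap R _ r ∈ prodSpan (R := R) l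
  | [] => ⟨r, rfl⟩
  | v :: l => prodSpan_le_cons v l (algebraMap_mem r l)

theorem contr_mem (d : Module.Dual R M) :
    ∀ (l : List M) {x : ExteriorAlgebra R M}, x ∈ prodSpan l → contr d x ∈ prodSpan l
  | [], x, hx => by
    obtain ⟨r, rfl⟩ := hx
    rw [Algebra.linearMap_apply, contr_algebraMap]
    exact Submodule.zero_mem _
  | v :: l, x, hx => by
    obtain ⟨y, hy, z, hz, rfl⟩ := mem_prodSpan_cons.1 hx
    rw [map_add, contr_ι_mul]
    refine Submodule.add_mem _ (prodSpan_le_cons v l (contr_mem d l hy)) (Submodule.sub_mem _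
      (Submodule.smul_mem _ _ (prodSpan_le_cons v l hz)) (ι_mul_mem_cons v (contr_mem d l hz)))

/-- With `δ` dual to `v`, contraction by `δ` reads off the factor of `v` in an element of `prodSpan
(v :: l)`; no basis of the exterior algebra is needed. -/
theorem contr_eq_zero (δ : Module.Dual R M) :
    ∀ (l : List M), (∀ v ∈ l, δ v = 0) → ∀ {x : ExteriorAlgebra R M}, x ∈ prodSpan l →
      contr δ x = 0
  | [], _, x, hx => by
    obtain ⟨r, rfl⟩ := hx
    rw [Algebra.linearMap_apply, contr_algebraMap]
  | v :: l, h, x, hx => by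
    obtain ⟨y, hy, z, hz, rfl⟩ := mem_prodSpan_cons.1 hx
    have h' : ∀ v ∈ l, δ v = 0 := fun u hu => h u (List.mem_cons_of_mem _ hu)
    rw [map_add, contr_ι_mul, contr_eq_zero δ l h' hy, contr_eq_zero δ l h' hz,
      h v List.mem_cons_self]
    simp

theorem ι_mul_ι_mul (u v : M) (x : ExteriorAlgebra R M) :
    ι R u * (ι R v * x) = -(ι R v * (ι R u * x)) := by
  rw [← mul_assoc, ← mul_assoc, ← neg_mul]
  congr 1
  exact eq_neg_of_add_eq_zero_left (ExteriorAlgebra.ι_add_mul_swap u v)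

theorem ι_mul_mem :
    ∀ (l : List M) {u : M} {x : ExteriorAlgebra R M}, u ∈ l → x ∈ prodSpan l →
      ι R u * x ∈ prodSpan l
  | v :: l, u, x, hu, hx => by
    obtain ⟨y, hy, z, hz, rfl⟩ := mem_prodSpan_cons.1 hx
    rcases List.mem_cons.1 hu with rfl | hu
    · rw [mul_add, ← mul_assoc, ExteriorAlgebra.ι_sq_zero, zero_mul, add_zero]
      exact ι_mul_mem_cons _ hy
    · rw [mul_add, ι_mul_ι_mul]
      exact Submodule.add_mem _ (prodSpan_le_cons v l (ι_mul_mem l hu hy))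
        (Submodule.neg_mem _ (ι_mul_mem_cons v (ι_mul_mem l hu hz)))

theorem prodSpan_eq_top (l : List M) (hl : Submodule.span R {v | v ∈ l} = ⊤) :
    prodSpan (R := R) l = ⊤ := by
  rw [eq_top_iff]
  intro x _
  refine CliffordAlgebra.left_induction (Q := (0 : QuadraticForm R M)) (P := (· ∈ prodSpan l))
    (fun r => algebraMap_mem r l) (fun x y hx hy => Submodule.add_mem _ hx hy) ?_ x
  intro x m hx
  have hm : m ∈ Submodule.span R {v | v ∈ l} := hl ▸ Submodule.mem_top
  change ι R m * x ∈ _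
  induction hm using Submodule.span_induction with
  | mem u hu => exact ι_mul_mem l hu hx
  | zero => simp
  | add u v _ _ hu hv => rw [map_add, add_mul]; exact Submodule.add_mem _ hu hv
  | smul r u _ hu => rw [map_smul, smul_mul_assoc]; exact Submodule.smul_mem _ _ hu

/-- The ideal generated by the values of a linear form on a list of vectors. -/
def valueIdeal (d : Module.Dual R M) (l : List M) : Ideal R := Ideal.span {r | ∃ v ∈ l, d v = r}

/-- Only the degree one part of `x`, a combination of vectors of `l`, contributes to the scalar part
of the contraction. -/
theorem algebraMapInv_contr_mem (d : Module.Dual R M) :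
    ∀ (l : List M) {x : ExteriorAlgebra R M}, x ∈ prodSpan l →
      ExteriorAlgebra.algebraMapInv (contr d x) ∈ valueIdeal d l
  | [], x, hx => by
    obtain ⟨r, rfl⟩ := hx
    rw [Algebra.linearMap_apply, contr_algebraMap, map_zero]
    exact Ideal.zero_mem _
  | v :: l, x, hx => by
    obtain ⟨y, hy, z, hz, rfl⟩ := mem_prodSpan_cons.1 hx
    have hle : valueIdeal d l ≤ valueIdeal d (v :: l) :=
      Ideal.span_mono fun r ⟨u, hu, h⟩ => ⟨u, List.mem_cons_of_mem _ hu, h⟩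
    have hι : ExteriorAlgebra.algebraMapInv (ι R v) = (0 : R) := by
      simp [ExteriorAlgebra.algebraMapInv]
    rw [map_add, map_add, contr_ι_mul, map_sub, map_smul, map_mul, hι, zero_mul, sub_zero,
      smul_eq_mul, mul_comm]
    exact Ideal.add_mem _ (hle (algebraMapInv_contr_mem d l hy))
      (Ideal.mul_mem_left _ _ (Ideal.subset_span ⟨v, List.mem_cons_self, rfl⟩))

theorem exists_contr_eq (d : Module.Dual R M) (l : List M) {r : R} (hr : r ∈ valueIdeal d l) :
    ∃ ζ ∈ prodSpan l, contr d ζ = algebraMap R _ r := by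
  induction hr using Submodule.span_induction with
  | mem r hr =>
    obtain ⟨v, hv, rfl⟩ := hr
    refine ⟨ι R v, ?_, contr_ι d v⟩
    simpa using ι_mul_mem l hv (algebraMap_mem (1 : R) l)
  | zero => exact ⟨0, Submodule.zero_mem _, by simp⟩
  | add r s _ _ hr hs =>
    obtain ⟨ζ, hζ, h⟩ := hr
    obtain ⟨ζ', hζ', h'⟩ := hs
    exact ⟨ζ + ζ', Submodule.add_mem _ hζ hζ', by rw [map_add, h, h', map_add]⟩
  | smul a r _ hr =>
    obtain ⟨ζ, hζ, h⟩ := hr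
    refine ⟨a • ζ, Submodule.smul_mem _ _ hζ, ?_⟩
    rw [map_smul, h, Algebra.smul_def, smul_eq_mul, map_mul]

/-- The Koszul complex of the values of `d` on the vectors of `l` is acyclic in positive degrees. -/
def Acyclic (d : Module.Dual R M) (l : List M) : Prop :=
  ∀ ω ∈ prodSpan l, contr d ω = 0 → ∃ r, ∃ η ∈ prodSpan l, ω = algebraMap R _ r + contr d η

theorem acyclic_nil (d : Module.Dual R M) : Acyclic d [] := by
  rintro _ ⟨r, rfl⟩ _
  exact ⟨r, 0, Submodule.zero_mem _, by simp⟩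

/-- Write ω = y + v z. Contracting dω = 0 with `δ` gives dz = 0, so z = r + dη by acyclicity, and v
dη = d(v) η - d(v η) moves η into `prodSpan l` up to a boundary. The scalar part of the remaining
cycle condition puts d(v) r into the ideal. -/
theorem Acyclic.exists_reduction {d : Module.Dual R M} {l : List M} (hl : Acyclic d l) {v : M}
    {δ : Module.Dual R M} (hδ : ∀ u ∈ l, δ u = 0) (hv : δ v = 1) {ω : ExteriorAlgebra R M}
    (hω : ω ∈ prodSpan (v :: l)) (h : contr d ω = 0) :
    ∃ r, d v * r ∈ valueIdeal d l ∧ ∃ ω₁ ∈ prodSpan l, ∃ η,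
      η ∈ prodSpan (v :: l) ∧ ω = ω₁ + r • ι R v + contr d η := by
  obtain ⟨y, hy, z, hz, rfl⟩ := mem_prodSpan_cons.1 hω
  rw [map_add, contr_ι_mul] at h
  have hz0 : contr d z = 0 := by
    have h2 := congrArg (contr δ) h
    rw [map_add, map_sub, map_smul, contr_ι_mul, map_zero,
      contr_eq_zero δ l hδ (contr_mem d l hy), contr_eq_zero δ l hδ hz,
      contr_eq_zero δ l hδ (contr_mem d l hz), hv] at h2
    simpa using h2
  rw [hz0, mul_zero, sub_zero] at h
  obtain ⟨r, η, hη, rfl⟩ := hl z hz hz0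
  refine ⟨r, ?_, y + d v • η, Submodule.add_mem _ hy (Submodule.smul_mem _ _ hη), -(ι R v * η),
    Submodule.neg_mem _ (ι_mul_mem_cons v hη), ?_⟩
  · have h3 := algebraMapInv_contr_mem d l (Submodule.add_mem _ hy
      (Submodule.smul_mem _ (d v) hη))
    have h4 : contr d (y + d v • η) = - algebraMap R _ (d v * r) := by
      rw [smul_add, ← add_assoc, Algebra.smul_def, ← map_mul] at h
      rw [map_add, map_smul]
      rw [add_right_comm] at h
      exact eq_neg_of_add_eq_zero_left h
    rw [h4, map_neg, Ideal.neg_mem_iff] at h3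
    rwa [ExteriorAlgebra.algebraMap_leftInverse M] at h3
  · rw [map_neg, contr_ι_mul, mul_add, ← Algebra.commutes, ← Algebra.smul_def]
    abel

/-- By regularity the leftover coefficient is r = dζ, and v dζ = d(v) ζ - d(v ζ) reduces r v to
`prodSpan l`. -/
theorem Acyclic.cons {d : Module.Dual R M} {l : List M} (hl : Acyclic d l) {v : M}
    {δ : Module.Dual R M} (hδ : ∀ u ∈ l, δ u = 0) (hv : δ v = 1)
    (hreg : ∀ r, d v * r ∈ valueIdeal d l → r ∈ valueIdeal d l) : Acyclic d (v :: l) := by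
  intro ω hω h
  obtain ⟨r, hr, ω₁, hω₁, η, hη, rfl⟩ := hl.exists_reduction hδ hv hω h
  obtain ⟨ζ, hζ, hζr⟩ := exists_contr_eq d l (hreg r hr)
  have key : r • ι R v = d v • ζ - contr d (ι R v * ζ) := by
    rw [contr_ι_mul, hζr, Algebra.smul_def, ← Algebra.commutes]; abel
  have hω₂ : ω₁ + d v • ζ ∈ prodSpan l := Submodule.add_mem _ hω₁ (Submodule.smul_mem _ _ hζ)
  obtain ⟨s, η', hη', h'⟩ := hl _ hω₂ (by
    rw [key] at h
    simp only [map_add, map_sub, contr_contr] at h ⊢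
    simpa using h)
  refine ⟨s, η' + (η - ι R v * ζ), Submodule.add_mem _ (prodSpan_le_cons v l hη')
    (Submodule.sub_mem _ hη (ι_mul_mem_cons v hζ)), ?_⟩
  rw [key, map_add, map_sub, ← add_assoc, ← h']
  abel

/-- If the Koszul complex of all values but one is acyclic, then the cocycles of the full complex
are generated up to coboundaries by `1` and by linear cocycles whose leading coefficients generate
the colon ideal. -/
theorem Acyclic.exists_eq {d : Module.Dual R M} {l : List M} (hl : Acyclic d l) {v : M}
    {δ : Module.Dual R M} (hδ : ∀ u ∈ l, δ u = 0) (hv : δ v = 1)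
    (htop : Submodule.span R {u | u ∈ v :: l} = ⊤)
    {J : Type*} [Fintype J] (θ : J → M) (hθ : ∀ j, d (θ j) = 0)
    (hreg : ∀ r, d v * r ∈ valueIdeal d l →
      r ∈ valueIdeal d l ⊔ Ideal.span (Set.range fun j => δ (θ j)))
    {ω : ExteriorAlgebra R M} (h : contr d ω = 0) :
    ∃ (p : J → R) (p₀ : R) (η : ExteriorAlgebra R M),
      ω = ∑ j, p j • ι R (θ j) + algebraMap R _ p₀ + contr d η := by
  have hall : ∀ x : ExteriorAlgebra R M, x ∈ prodSpan (v :: l) := fun x => by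
    rw [prodSpan_eq_top _ htop]; exact Submodule.mem_top
  -- As `v :: l` spans and `δ` is dual to `v`, the kernel of `δ` is the span of `l`.
  have hker : ∀ m : M, δ m = 0 → ι R m ∈ prodSpan l := fun m hm => by
    have : m ∈ Submodule.span R {u | u ∈ v :: l} := htop ▸ Submodule.mem_top
    have hset : {u | u ∈ v :: l} = insert v {u | u ∈ l} := by ext; simp
    rw [hset, Submodule.mem_span_insert] at this
    obtain ⟨a, z, hz, rfl⟩ := this
    have hz' : ι R z ∈ prodSpan l ∧ δ z = 0 := by
      clear hm
      induction hz using Submodule.span_induction with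
      | mem u hu => exact ⟨by simpa using ι_mul_mem l hu (algebraMap_mem (1 : R) l), hδ u hu⟩
      | zero => exact ⟨by simp, by simp⟩
      | add x y _ _ hx hy => exact ⟨by rw [map_add]; exact Submodule.add_mem _ hx.1 hy.1,
          by rw [map_add, hx.2, hy.2, add_zero]⟩
      | smul c x _ hx => exact ⟨by rw [map_smul]; exact Submodule.smul_mem _ _ hx.1,
          by rw [map_smul, hx.2, smul_zero]⟩
    have ha : a = 0 := by simpa [hv, hz'.2] using hm
    simpa [ha] using hz'.1
  obtain ⟨r, hr, ω₁, hω₁, η, -, rfl⟩ := hl.exists_reduction hδ hv (hall ω) h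
  obtain ⟨i, hi, s, hs, rfl⟩ := Submodule.mem_sup.1 (hreg r hr)
  obtain ⟨p, rfl⟩ := (Submodule.mem_span_range_iff_exists_fun R).1 hs
  obtain ⟨ζ, hζ, hζi⟩ := exists_contr_eq d l hi
  have key : i • ι R v = d v • ζ - contr d (ι R v * ζ) := by
    rw [contr_ι_mul, hζi, Algebra.smul_def, ← Algebra.commutes]; abel
  -- The combination of the θ with the same coefficient of `v`; the difference lies in the kernel of
  -- `δ`.
  set ψ : ExteriorAlgebra R M := ι R ((∑ j, p j • δ (θ j)) • v - ∑ j, p j • θ j) with hψ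
  have hψm : ψ ∈ prodSpan l := by
    apply hker
    simp [hv]
  have hψ' : (∑ j, p j • δ (θ j)) • ι R v = ψ + ∑ j, p j • ι R (θ j) := by
    simp [hψ]
  have hω₂ : ω₁ + d v • ζ + ψ ∈ prodSpan l :=
    Submodule.add_mem _ (Submodule.add_mem _ hω₁ (Submodule.smul_mem _ _ hζ)) hψm
  obtain ⟨p₀, η', -, h'⟩ := hl _ hω₂ (by
    rw [add_smul, key, hψ'] at h
    simp only [map_add, map_sub, contr_contr, map_sum, map_smul, contr_ι, hθ, map_zero,
      smul_zero, Finset.sum_const_zero] at h ⊢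
    simpa [add_assoc] using h)
  refine ⟨p, p₀, η' + (η - ι R v * ζ), ?_⟩
  have : ω₁ = algebraMap R _ p₀ + contr d η' - d v • ζ - ψ := by rw [← h']; abel
  rw [add_smul, key, hψ', this, map_add, map_sub]
  abel

end KoszulList

/-! ### Regular sequences and colon ideals in graded rings -/

namespace GradedReg

variable {A σ : Type*} [CommRing A] [SetLike σ A] [AddSubmonoidClass σ A]

/-- `x` is a nonzerodivisor modulo the ideal `I`. -/
def NZD (I : Ideal A) (x : A) : Prop := ∀ r, x * r ∈ I → r ∈ I

/-- `l` is a weakly regular sequence modulo the ideal `I`. -/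
def RegList : Ideal A → List A → Prop
  | _, [] => True
  | I, x :: l => NZD I x ∧ RegList (I ⊔ Ideal.span {x}) l

theorem regList_append {l l' : List A} :
    ∀ {I : Ideal A}, RegList I (l ++ l') ↔ RegList I l ∧ RegList (I ⊔ Ideal.ofList l) l' := by
  induction l with
  | nil => intro I; simp [RegList]
  | cons x l ih =>
    intro I
    rw [List.cons_append, RegList, RegList, ih, Ideal.ofList_cons, and_assoc, sup_assoc]

theorem NZD.of_mul_sub_mem {I : Ideal A} {x f g : A} (hx : NZD I x) (h : x - f * g ∈ I) :
    NZD I f := by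
  intro r hr
  apply hx
  have : x * r = r * (x - f * g) + g * (f * r) := by ring
  rw [this]
  exact Ideal.add_mem _ (Ideal.mul_mem_left _ _ h) (Ideal.mul_mem_left _ _ hr)

variable (𝒜 : ℕ → σ) [GradedRing 𝒜]

theorem mem_of_components {K : Ideal A} {r : A} (h : ∀ d, (DirectSum.decompose 𝒜 r d : A) ∈ K) :
    r ∈ K := by
  classical
  rw [← DirectSum.sum_support_decompose 𝒜 r]
  exact Ideal.sum_mem _ fun d _ => h d

/-- A colon ideal may be computed modulo a homogeneous nonzerodivisor of positive degree. -/
theorem colon_lift {I K : Ideal A} (hI : I.IsHomogeneous 𝒜) (hK : K.IsHomogeneous 𝒜) {q h : A}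
    {e m : ℕ} (hq : q ∈ 𝒜 e) (hh : h ∈ 𝒜 m) (hm : 0 < m) (hreg : NZD I h)
    (hqK : ∀ k ∈ K, q * k ∈ I) (H : ∀ r, q * r ∈ I → r ∈ K ⊔ Ideal.span {h}) :
    ∀ r, q * r ∈ I → r ∈ K := by
  -- Graded Nakayama: for homogeneous r the decomposition r = k + h t may be taken in degree d. Then
  -- q h t ∈ I gives q t ∈ I by regularity of h, and t has smaller degree.
  have key : ∀ d, ∀ r ∈ 𝒜 d, q * r ∈ I → r ∈ K := by
    intro d
    induction d using Nat.strong_induction_on with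
    | _ d ih =>
      intro r hr hqr
      obtain ⟨k, hk, s, hs, hrs⟩ := Submodule.mem_sup.1 (H r hqr)
      obtain ⟨t, rfl⟩ := Ideal.mem_span_singleton'.1 hs
      have hd : r = DirectSum.decompose 𝒜 k d + DirectSum.decompose 𝒜 (h * t) d := by
        conv_lhs => rw [← DirectSum.decompose_of_mem_same 𝒜 hr, ← hrs, mul_comm t h,
          DirectSum.decompose_add, DirectSum.add_apply]
        simp
      have hkd := hK d hk
      by_cases hdm : m ≤ d
      · rw [DirectSum.coe_decompose_mul_of_left_mem_of_le 𝒜 hh hdm] at hd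
        rw [hd]
        refine Ideal.add_mem _ hkd (Ideal.mul_mem_left _ _ (ih (d - m) (by omega) _
          (SetLike.coe_mem _) (hreg _ ?_)))
        rw [hd, mul_add] at hqr
        have := (Ideal.add_mem_iff_right _ (hqK _ hkd)).1 hqr
        rwa [mul_left_comm] at this
      · rw [DirectSum.coe_decompose_mul_of_left_mem_of_not_le 𝒜 hh hdm, add_zero] at hd
        rw [hd]; exact hkd
  intro r hr
  refine mem_of_components 𝒜 fun d => key d _ (SetLike.coe_mem _) ?_
  rw [← DirectSum.coe_decompose_mul_add_of_left_mem 𝒜 hq]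
  exact hI _ hr

/-- Positive degree is essential for the first half, which is `colon_lift` with K = I; the second
half cancels `y` and then `x` from a relation between them. -/
theorem swap {I : Ideal A} (hI : I.IsHomogeneous 𝒜) {x y : A} {e m : ℕ} (hy : y ∈ 𝒜 e)
    (hx : x ∈ 𝒜 m) (hm : 0 < m) (h : NZD I x) (h' : NZD (I ⊔ Ideal.span {x}) y) :
    NZD I y ∧ NZD (I ⊔ Ideal.span {y}) x := by
  have h1 : NZD I y := colon_lift 𝒜 hI hI hy hx hm h (fun k hk => Ideal.mul_mem_left _ _ hk)
    fun r hr => h' r (Ideal.mem_sup_left hr)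
  refine ⟨h1, fun r hr => ?_⟩
  obtain ⟨i, hi, s, hs, hrs⟩ := Submodule.mem_sup.1 hr
  obtain ⟨t, rfl⟩ := Ideal.mem_span_singleton'.1 hs
  have h2 : y * t ∈ I ⊔ Ideal.span {x} := by
    have : y * t = -i + r * x := by linear_combination hrs
    rw [this]
    exact Ideal.add_mem _ (Ideal.mem_sup_left (neg_mem hi))
      (Ideal.mem_sup_right (Ideal.mul_mem_left _ _ (Ideal.mem_span_singleton_self x)))
  obtain ⟨j, hj, s, hs, hts⟩ := Submodule.mem_sup.1 (h' _ h2)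
  obtain ⟨u, rfl⟩ := Ideal.mem_span_singleton'.1 hs
  have h3 : r - u * y ∈ I := by
    apply h
    have : x * (r - u * y) = i + y * j := by linear_combination -hrs - y * hts
    rw [this]
    exact Ideal.add_mem _ hi (Ideal.mul_mem_left _ _ hj)
  rw [← sub_add_cancel r (u * y)]
  exact Ideal.add_mem _ (Ideal.mem_sup_left h3)
    (Ideal.mem_sup_right (Ideal.mul_mem_left _ _ (Ideal.mem_span_singleton_self y)))

/-- The element is homogeneous of positive degree. -/
def PosHom (x : A) : Prop := ∃ n, 0 < n ∧ x ∈ 𝒜 n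

variable {𝒜}

theorem PosHom.sup {I : Ideal A} (hI : I.IsHomogeneous 𝒜) {x : A} (hx : PosHom 𝒜 x) :
    (I ⊔ Ideal.span {x}).IsHomogeneous 𝒜 := by
  refine hI.sup (Ideal.homogeneous_span 𝒜 _ ?_)
  rintro _ rfl
  exact ⟨_, hx.choose_spec.2⟩

theorem isHomogeneous_ofList {l : List A} (hl : ∀ x ∈ l, PosHom 𝒜 x) :
    (Ideal.ofList l).IsHomogeneous 𝒜 :=
  Ideal.homogeneous_span 𝒜 _ fun x hx => ⟨_, (hl x hx).choose_spec.2⟩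

theorem RegList.perm {l l' : List A} (h : l.Perm l') :
    ∀ {I : Ideal A}, I.IsHomogeneous 𝒜 → (∀ x ∈ l, PosHom 𝒜 x) → RegList I l → RegList I l' := by
  induction h with
  | nil => intro I _ _ h; exact h
  | cons x _ ih =>
    intro I hI hl h
    rw [List.forall_mem_cons] at hl
    exact ⟨h.1, ih (hl.1.sup hI) hl.2 h.2⟩
  | swap x y l =>
    intro I hI hl h
    obtain ⟨m, hm, hy⟩ := hl y (by simp)
    obtain ⟨n, hn, hx⟩ := hl x (by simp)
    obtain ⟨h1, h2⟩ := GradedReg.swap 𝒜 hI hx hy hm h.1 h.2.1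
    refine ⟨h1, h2, ?_⟩
    rw [sup_right_comm]
    exact h.2.2
  | trans h1 _ ih1 ih2 =>
    intro I hI hl h
    exact ih2 hI (fun x hx => hl x (h1.mem_iff.2 hx)) (ih1 hI hl h)

/-- In a regular sequence an element may be replaced by a factor modulo the ideal. -/
theorem RegList.replace_head {I : Ideal A} (hI : I.IsHomogeneous 𝒜) {p f g : A} {l : List A}
    (hl : ∀ x ∈ l, PosHom 𝒜 x) (hp : PosHom 𝒜 p) (hf : PosHom 𝒜 f) (h : RegList I (p :: l))
    (hfg : p - f * g ∈ I) : RegList I (f :: l) := by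
  -- At the end of the sequence no later element depends on `p`, so it can be replaced there and the
  -- factor moved back to the front.
  have h1 : RegList I (l ++ [p]) := h.perm (List.perm_append_singleton p l).symm hI
    (List.forall_mem_cons.2 ⟨hp, hl⟩)
  rw [regList_append] at h1
  have h2 : RegList I (l ++ [f]) := regList_append.2
    ⟨h1.1, h1.2.1.of_mul_sub_mem (Ideal.mem_sup_left hfg), trivial⟩
  refine h2.perm (List.perm_append_singleton f l) hI fun x hx => ?_
  rcases List.mem_append.1 hx with hx | hx
  · exact hl x hx
  · rw [List.mem_singleton.1 hx]; exact hf

/-- A colon ideal may be computed modulo a regular sequence. -/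
theorem colon_lift_list {J : Ideal A} (hJ : J.IsHomogeneous 𝒜) {q : A} {e : ℕ} (hq : q ∈ 𝒜 e)
    {l : List A} (hl : ∀ x ∈ l, PosHom 𝒜 x) :
    ∀ {I : Ideal A}, I.IsHomogeneous 𝒜 → RegList I l → (∀ j ∈ J, q * j ∈ I) →
      (∀ r, q * r ∈ I ⊔ Ideal.ofList l → r ∈ I ⊔ Ideal.ofList l ⊔ J) →
      ∀ r, q * r ∈ I → r ∈ I ⊔ J := by
  induction l with
  | nil => intro I _ _ _ H r hr; simpa using H r (by simpa using hr)
  | cons h l ih =>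
    intro I hI hreg hqJ H
    rw [List.forall_mem_cons] at hl
    rw [Ideal.ofList_cons, ← sup_assoc] at H
    obtain ⟨m, hm, hh⟩ := hl.1
    -- Induction gives the colon ideal modulo I + (h), and `colon_lift` removes h.
    refine colon_lift 𝒜 hI (hI.sup hJ) hq hh hm hreg.1 (fun k hk => ?_) fun r hr => ?_
    · obtain ⟨i, hi, j, hj, rfl⟩ := Submodule.mem_sup.1 hk
      rw [mul_add]
      exact Ideal.add_mem _ (Ideal.mul_mem_left _ _ hi) (hqJ j hj)
    · rw [sup_right_comm]
      exact ih hl.2 (hl.1.sup hI) hreg.2 (fun j hj => Ideal.mem_sup_left (hqJ j hj)) H r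
        (Ideal.mem_sup_left hr)

/-- A regular sequence modulo `I` stays regular modulo `I + (q)` if the colon ideal of `q` modulo
the whole sequence is the expected one. -/
theorem RegList.sup_span {J : Ideal A} (hJ : J.IsHomogeneous 𝒜) {q : A} {e : ℕ} (hq : q ∈ 𝒜 e)
    {l : List A} (hl : ∀ x ∈ l, PosHom 𝒜 x) :
    ∀ {I : Ideal A}, I.IsHomogeneous 𝒜 → RegList I l → (∀ j ∈ J, q * j ∈ I) →
      (∀ r, q * r ∈ I ⊔ Ideal.ofList l → r ∈ I ⊔ Ideal.ofList l ⊔ J) →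
      RegList (I ⊔ Ideal.span {q}) l := by
  induction l with
  | nil => intros; trivial
  | cons h l ih =>
    intro I hI hreg hqJ H
    rw [List.forall_mem_cons] at hl
    rw [Ideal.ofList_cons, ← sup_assoc] at H
    have hqJ' : ∀ j ∈ J, q * j ∈ I ⊔ Ideal.span {h} := fun j hj => Ideal.mem_sup_left (hqJ j hj)
    refine ⟨fun x hx => ?_, ?_⟩
    · obtain ⟨i, hi, s, hs, hxs⟩ := Submodule.mem_sup.1 hx
      obtain ⟨s, rfl⟩ := Ideal.mem_span_singleton'.1 hs
      have h1 : q * s ∈ I ⊔ Ideal.span {h} := by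
        have : q * s = -i + x * h := by linear_combination hxs
        rw [this]
        exact Ideal.add_mem _ (Ideal.mem_sup_left (neg_mem hi))
          (Ideal.mem_sup_right (Ideal.mul_mem_left _ _ (Ideal.mem_span_singleton_self h)))
      -- The relation h x = i + q s puts s into the colon ideal of q modulo I + (h), that is s ∈ I +
      -- (h) + J. As q kills J modulo I, x is a multiple of q up to an element that h multiplies
      -- into I.
      obtain ⟨k, hk, j, hj, hkj⟩ := Submodule.mem_sup.1
        (colon_lift_list hJ hq hl.2 (hl.1.sup hI) hreg.2 hqJ' H s h1)
      obtain ⟨i', hi', t, ht, hit⟩ := Submodule.mem_sup.1 hk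
      obtain ⟨t, rfl⟩ := Ideal.mem_span_singleton'.1 ht
      have h2 : x - t * q ∈ I := by
        apply hreg.1
        have : h * (x - t * q) = i + q * i' + q * j := by
          linear_combination -hxs - q * hkj - q * hit
        rw [this]
        exact Ideal.add_mem _ (Ideal.add_mem _ hi (Ideal.mul_mem_left _ _ hi')) (hqJ j hj)
      rw [← sub_add_cancel x (t * q)]
      exact Ideal.add_mem _ (Ideal.mem_sup_left h2)
        (Ideal.mem_sup_right (Ideal.mul_mem_left _ _ (Ideal.mem_span_singleton_self q)))
    · rw [sup_right_comm]
      exact ih hl.2 (hl.1.sup hI) hreg.2 hqJ' H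

end GradedReg

/-! ### Powers of variables, and colon ideals by Gorenstein duality -/

namespace GradedReg

open MvPolynomial

section Monomial

variable {σ k : Type*} [CommRing k]

/-- The ideal generated by the powers `X i ^ n i` with `i ∈ s`. -/
noncomputable def powIdeal (k : Type*) [CommRing k] (n : σ → ℕ) (s : Set σ) : Ideal (MvPolynomial σ k) :=
  Ideal.span ((fun i => X i ^ n i) '' s)

theorem mem_powIdeal {n : σ → ℕ} {s : Set σ} {x : MvPolynomial σ k} :
    x ∈ powIdeal k n s ↔ ∀ m ∈ x.support, ∃ i ∈ s, n i ≤ m i := by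
  have h : powIdeal k n s = Ideal.span ((fun m => monomial m (1 : k)) ''
      ((fun i => Finsupp.single i (n i)) '' s)) := by
    rw [powIdeal, Set.image_image]
    simp only [X_pow_eq_monomial]
  rw [h, mem_ideal_span_monomial_image]
  simp

theorem nzd_pow {n : σ → ℕ} {s : Set σ} {j : σ} (hj : j ∉ s) :
    NZD (powIdeal k n s) (X j ^ n j) := by
  classical
  intro r hr
  rw [mem_powIdeal] at hr ⊢
  intro m hm
  obtain ⟨i, hi, h⟩ := hr (Finsupp.single j (n j) + m) (by
    rw [mem_support_iff, X_pow_eq_monomial, coeff_monomial_mul, one_mul]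
    exact mem_support_iff.1 hm)
  have hij : j ≠ i := fun h => hj (h ▸ hi)
  exact ⟨i, hi, by simpa [Finsupp.single_apply, hij] using h⟩

theorem regList_pow (n : σ → ℕ) {l : List σ} (hl : l.Nodup) :
    ∀ {s : Set σ}, (∀ i ∈ l, i ∉ s) →
      RegList (powIdeal k n s) (l.map fun i => X i ^ n i) := by
  induction l with
  | nil => intro s _; trivial
  | cons j l ih =>
    intro s hs
    rw [List.nodup_cons] at hl
    refine ⟨nzd_pow (hs j List.mem_cons_self), ?_⟩
    have : powIdeal k n s ⊔ Ideal.span {X j ^ n j} = powIdeal k n (insert j s) := by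
      rw [powIdeal, powIdeal, Set.image_insert_eq, Ideal.span_insert, sup_comm]
    rw [this]
    refine ih hl.2 fun i hi h => ?_
    rcases Set.mem_insert_iff.1 h with rfl | h
    · exact hl.1 hi
    · exact hs i (List.mem_cons_of_mem _ hi) h

theorem regList_pow_bot (n : σ → ℕ) {l : List σ} (hl : l.Nodup) :
    RegList (⊥ : Ideal (MvPolynomial σ k)) (l.map fun i => X i ^ n i) := by
  have := regList_pow (k := k) n hl (s := ∅) (by simp)
  rwa [powIdeal, Set.image_empty, Ideal.span_empty] at this

theorem posHom_X_pow (i : σ) {n : ℕ} (hn : 0 < n) :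
    PosHom (homogeneousSubmodule σ k) (X i ^ n : MvPolynomial σ k) :=
  ⟨n, hn, by simpa using (isHomogeneous_X k i).pow n⟩

end Monomial

/-- A criterion for a colon ideal, by duality in a Gorenstein quotient: `m` spans the quotient by
`K`, and `w` is dual to `m` up to triangularity. -/
theorem colon_le_of_duality {σ ι : Type*} [Fintype ι] [LinearOrder ι]
    {I K : Ideal (MvPolynomial σ ℂ)} {q S : MvPolynomial σ ℂ} (hqK : ∀ k ∈ K, q * k ∈ I)
    (hS : ∀ c : ℂ, c • (q * S) ∈ I → c = 0) (m w : ι → MvPolynomial σ ℂ)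
    (h1 : 1 ∈ Submodule.span ℂ (Set.range fun i => Ideal.Quotient.mk K (m i)))
    (hmul : ∀ s i, Ideal.Quotient.mk K (X s * m i) ∈
      Submodule.span ℂ (Set.range fun i => Ideal.Quotient.mk K (m i)))
    (h0 : ∀ i j, i < j → w i * m j ∈ K) (hd : ∀ i, w i * m i - S ∈ K) :
    ∀ r, q * r ∈ I → r ∈ K := by
  set W := Submodule.span ℂ (Set.range fun i => Ideal.Quotient.mk K (m i)) with hW
  have hXW : ∀ s, ∀ b ∈ W, Ideal.Quotient.mk K (X s) * b ∈ W := fun s b hb => by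
    induction hb using Submodule.span_induction with
    | mem b hb => obtain ⟨i, rfl⟩ := hb; rw [← map_mul]; exact hmul s i
    | zero => simp
    | add a b _ _ ha hb => rw [mul_add]; exact W.add_mem ha hb
    | smul c b _ hb => rw [mul_smul_comm]; exact W.smul_mem c hb
  have hspan : ∀ r, Ideal.Quotient.mk K r ∈ W := fun r => by
    induction r using MvPolynomial.induction_on with
    | C c =>
      have : Ideal.Quotient.mk K (C c) = c • 1 := by
        rw [← map_one (Ideal.Quotient.mk K), ← Ideal.Quotient.mk_eq_mk, ← Ideal.Quotient.mk_eq_mk,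
          ← Submodule.Quotient.mk_smul, smul_eq_C_mul, mul_one]
      rw [this]; exact W.smul_mem c h1
    | add p r hp hr => rw [map_add]; exact W.add_mem hp hr
    | mul_X p s hp => rw [mul_comm, map_mul]; exact hXW s _ hp
  intro r hr
  obtain ⟨c, hc⟩ := (Submodule.mem_span_range_iff_exists_fun ℂ).1 (hspan r)
  have hc' : r - ∑ i, c i • m i ∈ K := by
    rw [← Ideal.Quotient.eq, ← hc, map_sum]
    rfl
  -- Multiplying r = Σ c_j m_j by `w i` leaves c_i S modulo K: the terms j < i vanish by induction,
  -- the terms j > i by `h0`. Since q K ⊆ I and q r ∈ I, it follows that c_i q S ∈ I.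
  have hc0 : ∀ i, c i = 0 := by
    intro i
    induction i using WellFoundedLT.induction with
    | _ i ih =>
      have h2 : w i * r - c i • S ∈ K := by
        have e : w i * r - c i • S = w i * (r - ∑ j, c j • m j) +
            (∑ j ∈ Finset.univ.erase i, c j • (w i * m j) + c i • (w i * m i - S)) := by
          have := Finset.sum_erase_add Finset.univ (fun j => c j • (w i * m j)) (Finset.mem_univ i)
          have h3 : w i * ∑ j, c j • m j = ∑ j, c j • (w i * m j) := by
            rw [Finset.mul_sum]; simp only [mul_smul_comm]
          rw [mul_sub, h3, ← this, smul_sub]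
          abel
        rw [e]
        refine K.add_mem (K.mul_mem_left _ hc') (K.add_mem (Ideal.sum_mem _ fun j hj => ?_)
          (Submodule.smul_of_tower_mem K _ (hd i)))
        rcases lt_or_gt_of_ne (Finset.ne_of_mem_erase hj) with h | h
        · rw [ih j h, zero_smul]; exact K.zero_mem
        · exact Submodule.smul_of_tower_mem K _ (h0 i j h)
      apply hS
      have e : c i • (q * S) = w i * (q * r) - q * (w i * r - c i • S) := by
        rw [mul_sub, mul_smul_comm]; ring
      rw [e]
      exact I.sub_mem (I.mul_mem_left _ hr) (hqK _ h2)
  simpa [hc0] using hc'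

end GradedReg

/-! ### Reduction to five variables modulo eleven parameters -/

namespace GradedReg

open MvPolynomial

section General

variable {A : Type*} [CommRing A]

/-- Turns ideal membership into an identity between ring elements subject to given relations. -/
theorem mem_of_hom {I : Ideal A} {x : A} (H : ∀ φ : A →+* A ⧸ I, I ≤ RingHom.ker φ → φ x = 0) :
    x ∈ I := by
  rw [← Ideal.Quotient.eq_zero_iff_mem]
  exact H _ (by rw [Ideal.mk_ker])

theorem ofList_le_iff {l : List A} {I : Ideal A} : Ideal.ofList l ≤ I ↔ ∀ x ∈ l, x ∈ I := by
  rw [Ideal.ofList, Ideal.span_le]; rfl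

/-- In a list of triples `(p, f, g)`, each `p` is `f * g` modulo the preceding `f`s. -/
def FactorChain : Ideal A → List (A × A × A) → Prop
  | _, [] => True
  | I, t :: L => t.1 - t.2.1 * t.2.2 ∈ I ∧ FactorChain (I ⊔ Ideal.span {t.2.1}) L

variable {σ : Type*} [SetLike σ A] [AddSubmonoidClass σ A] {𝒜 : ℕ → σ} [GradedRing 𝒜]

/-- Meant for powers `p` of variables, whose regularity is evident. Replacement proceeds from the
front, so each factorization is needed only modulo the factors already put in. -/
theorem RegList.replace {L : List (A × A × A)} (hL : ∀ t ∈ L, PosHom 𝒜 t.1 ∧ PosHom 𝒜 t.2.1) :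
    ∀ {I : Ideal A}, I.IsHomogeneous 𝒜 → RegList I (L.map fun t => t.1) → FactorChain I L →
      RegList I (L.map fun t => t.2.1) := by
  induction L with
  | nil => intros; trivial
  | cons t L ih =>
    intro I hI h hL'
    rw [List.forall_mem_cons] at hL
    have h' : RegList I (t.2.1 :: L.map fun t => t.1) := RegList.replace_head hI (fun x hx => by
      obtain ⟨u, hu, rfl⟩ := List.mem_map.1 hx
      exact (hL.2 u hu).1) hL.1.1 hL.1.2 h hL'.1
    exact ⟨h'.1, ih hL.2 (hL.1.2.sup hI) h'.2 hL'.2⟩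

end General

attribute [local instance] MvPolynomial.gradedAlgebra

/-- Polynomials in five variables and eleven further variables that serve as parameters. -/
abbrev Poly16 : Type := MvPolynomial (Fin 5 ⊕ Fin 11) ℂ

/-- The parameters. -/
noncomputable def params : List Poly16 := (List.finRange 11).map fun j => X (Sum.inr j)

theorem mem_params {x : Poly16} : x ∈ params ↔ ∃ j, X (Sum.inr j) = x := by
  simp [params]

theorem posHom_params : ∀ x ∈ params, PosHom (homogeneousSubmodule (Fin 5 ⊕ Fin 11) ℂ) x := by
  intro x hx
  obtain ⟨j, rfl⟩ := mem_params.1 hx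
  simpa using posHom_X_pow (k := ℂ) (Sum.inr j : Fin 5 ⊕ Fin 11) one_pos

theorem factorChain_map {A ι : Type*} [CommRing A] [LinearOrder ι] {p F G : ι → A} :
    ∀ {l : List ι} {I : Ideal A}, l.Pairwise (· < ·) →
      (∀ k ∈ l, ∀ I' ≥ I, (∀ j ∈ l, j < k → F j ∈ I') → p k - F k * G k ∈ I') →
      FactorChain I (l.map fun k => (p k, F k, G k))
  | [], _, _, _ => trivial
  | k :: l, I, hl, h => by
    rw [List.pairwise_cons] at hl
    refine ⟨h k List.mem_cons_self I le_rfl fun j hj hjk => ?_, factorChain_map hl.2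
      fun k' hk' I' hI' H => h k' (List.mem_cons_of_mem _ hk') I' (le_sup_left.trans hI')
        fun j hj hjk => ?_⟩
    · rcases List.mem_cons.1 hj with rfl | hj
      · exact absurd hjk (lt_irrefl _)
      · exact absurd (hl.1 j hj) (lt_asymm hjk)
    · rcases List.mem_cons.1 hj with rfl | hj
      · exact hI' (Ideal.mem_sup_right (Ideal.mem_span_singleton_self _))
      · exact H j hj hjk

/-- Sequences whose elements divide powers of the variables modulo the parameters and the preceding
elements are regular, together with the parameters. -/
theorem regList_params_append {n : Fin 5 → ℕ} (hn : ∀ k, 0 < n k) {F G : Fin 5 → Poly16}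
    (hF : ∀ k, PosHom (homogeneousSubmodule (Fin 5 ⊕ Fin 11) ℂ) (F k))
    (h : ∀ {B : Type} [CommRing B] (φ : Poly16 →+* B) (k : Fin 5), (∀ j, φ (X (.inr j)) = 0) →
      (∀ j < k, φ (F j) = 0) → φ (X (.inl k) ^ n k - F k * G k) = 0) :
    RegList ⊥ (params ++ (List.finRange 5).map F) := by
  have h1 := regList_pow_bot (k := ℂ) (Sum.elim n fun _ => 1 : Fin 5 ⊕ Fin 11 → ℕ)
    (l := (List.finRange 11).map Sum.inr ++ (List.finRange 5).map Sum.inl) (by decide)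
  have h2 : ((List.finRange 11).map Sum.inr ++ (List.finRange 5).map Sum.inl).map
      (fun i => X i ^ (Sum.elim n (fun _ => 1) i : ℕ)) =
      params ++ ((List.finRange 5).map fun k => (X (Sum.inl k) ^ n k : Poly16)) := by
    simp [params, Function.comp_def]
  rw [h2, regList_append] at h1
  rw [regList_append]
  refine ⟨h1.1, ?_⟩
  have h3 := RegList.replace (𝒜 := homogeneousSubmodule (Fin 5 ⊕ Fin 11) ℂ)
    (I := ⊥ ⊔ Ideal.ofList params)
    (L := (List.finRange 5).map fun k => (X (Sum.inl k) ^ n k, F k, G k)) (by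
      intro t ht
      obtain ⟨k, -, rfl⟩ := List.mem_map.1 ht
      exact ⟨posHom_X_pow _ (hn k), hF k⟩)
    ((Ideal.IsHomogeneous.bot _).sup (isHomogeneous_ofList posHom_params))
    (by simpa [Function.comp_def] using h1.2) (factorChain_map (by decide) fun k _ I' hI' H =>
      mem_of_hom fun φ hφ => h φ k
        (fun j => hφ (hI' (Ideal.mem_sup_right (Ideal.subset_span (mem_params.2 ⟨j, rfl⟩)))))
        fun j hj => hφ (H j (List.mem_finRange j) hj))
  simpa [Function.comp_def] using h3

/-- A nonzero multiple of a socle element is not in the ideal. -/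
theorem eq_zero_of_smul_mem {n : Fin 5 → ℕ} {I : Ideal Poly16} {Δ s t : Poly16}
    (hI : ∀ r ∈ I, Δ * r ∈ powIdeal ℂ (Sum.elim n fun _ => 1 : Fin 5 ⊕ Fin 11 → ℕ) Set.univ)
    {e : Fin 5 → ℕ} (he : ∀ k, e k < n k)
    (ht : t = ∏ k, X (Sum.inl k) ^ e k)
    (hs : Δ * s - t ∈ powIdeal ℂ (Sum.elim n fun _ => 1 : Fin 5 ⊕ Fin 11 → ℕ) Set.univ)
    (c : ℂ) (hc : c • s ∈ I) : c = 0 := by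
  by_contra hc0
  have h1 : c • t ∈ powIdeal ℂ (Sum.elim n fun _ => 1 : Fin 5 ⊕ Fin 11 → ℕ) Set.univ := by
    have : c • t = Δ * (c • s) - c • (Δ * s - t) := by rw [mul_smul_comm, smul_sub]; abel
    rw [this]
    exact Ideal.sub_mem _ (hI _ hc) (Submodule.smul_of_tower_mem _ _ hs)
  -- All exponents of `t` are below `n`, so no nonzero multiple of `t` lies in the monomial ideal.
  have ht' : t = monomial ((Finsupp.equivFunOnFinite.symm e).mapDomain Sum.inl) 1 := by
    rw [ht, monomial_eq, Finsupp.prod_mapDomain_index_inj Sum.inl_injective,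
      Finsupp.prod_fintype _ _ (by simp)]
    simp
  rw [ht', smul_monomial, mem_powIdeal] at h1
  obtain ⟨i, -, hi⟩ := h1 ((Finsupp.equivFunOnFinite.symm e).mapDomain Sum.inl) (by simp [hc0])
  rcases i with k | j
  · rw [Finsupp.mapDomain_apply Sum.inl_injective] at hi
    exact absurd (he k) (not_lt.2 hi)
  · rw [Finsupp.mapDomain_of_notMem_range _ _ (by simp)] at hi
    simp at hi

theorem mem_ofList_map {A : Type*} [CommRing A] {n : ℕ} (F : Fin n → A) (k : Fin n) :
    F k ∈ Ideal.ofList ((List.finRange n).map F) :=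
  Ideal.subset_span (by simp)

theorem ofList_map_le {A : Type*} [CommRing A] {n : ℕ} {F : Fin n → A} {I : Ideal A}
    (h : ∀ k, F k ∈ I) : Ideal.ofList ((List.finRange n).map F) ≤ I := by
  rw [ofList_le_iff]
  simpa using h

/-- The colon ideal of `q` modulo the `F k` and the parameters, from a multiplication table of the
quotient by the `F k`, the `g k` and the parameters. -/
theorem colon_mod_params {n : Fin 5 → ℕ} {F g : Fin 5 → Poly16} {q S Δ : Poly16}
    {N : ℕ} (m w : Fin N → Poly16)
    (hqg : ∀ k, q * g k ∈ Ideal.ofList ((List.finRange 5).map F))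
    {e : Fin 5 → ℕ} (he : ∀ k, e k < n k)
    (hΔ : ∀ {B : Type} [CommRing B] (φ : Poly16 →+* B), (∀ j, φ (X (.inr j)) = 0) →
      (∀ k, φ (X (.inl k)) ^ n k = 0) → (∀ k, φ Δ * φ (F k) = 0) ∧
        φ Δ * (φ q * φ S) = ∏ k, φ (X (.inl k)) ^ e k)
    (T : Fin 5 → Fin N → List (ℤ × Fin N)) {i₁ : Fin N} (h1 : m i₁ = 1)
    (hT : ∀ {B : Type} [CommRing B] (φ : Poly16 →+* B), (∀ j, φ (X (.inr j)) = 0) →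
      (∀ k, φ (F k) = 0) → (∀ k, φ (g k) = 0) →
        (∀ k i, φ (X (.inl k)) * φ (m i) = ((T k i).map fun t => t.1 • φ (m t.2)).sum) ∧
        (∀ i j, i < j → φ (w i) * φ (m j) = 0) ∧ ∀ i, φ (w i) * φ (m i) = φ S) :
    ∀ r, q * r ∈ Ideal.ofList ((List.finRange 5).map F) ⊔ Ideal.ofList params →
      r ∈ Ideal.ofList ((List.finRange 5).map F) ⊔ Ideal.ofList params ⊔
        Ideal.ofList ((List.finRange 5).map g) := by
  set I := Ideal.ofList ((List.finRange 5).map F) ⊔ Ideal.ofList params with hI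
  set K := I ⊔ Ideal.ofList ((List.finRange 5).map g) with hK
  have hp : ∀ j, (X (.inr j) : Poly16) ∈ I := fun j =>
    Ideal.mem_sup_right (Ideal.subset_span (mem_params.2 ⟨j, rfl⟩))
  have hφK := fun (φ : Poly16 →+* Poly16 ⧸ K) (hφ : K ≤ RingHom.ker φ) =>
    hT φ (fun j => hφ (Ideal.mem_sup_left (hp j)))
      (fun k => hφ (Ideal.mem_sup_left (Ideal.mem_sup_left (mem_ofList_map F k))))
      (fun k => hφ (Ideal.mem_sup_right (mem_ofList_map g k)))
  have hsm : ∀ i, Ideal.Quotient.mk K (m i) ∈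
      Submodule.span ℂ (Set.range fun i => Ideal.Quotient.mk K (m i)) := fun i =>
    Submodule.subset_span ⟨i, rfl⟩
  set P := powIdeal ℂ (Sum.elim n fun _ => 1 : Fin 5 ⊕ Fin 11 → ℕ) Set.univ with hP
  have hPr : ∀ j, (X (.inr j) : Poly16) ∈ P := fun j =>
    Ideal.subset_span ⟨.inr j, trivial, by simp⟩
  have hPl : ∀ k, (X (.inl k) : Poly16) ^ n k ∈ P := fun k =>
    Ideal.subset_span ⟨.inl k, trivial, by simp⟩
  have hφP := fun (φ : Poly16 →+* Poly16 ⧸ P) (hφ : P ≤ RingHom.ker φ) =>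
    hΔ φ (fun j => hφ (hPr j)) fun k => by rw [← map_pow]; exact hφ (hPl k)
  -- Multiplication by Δ carries the ideal I into P, but q S to a monomial outside P; hence q S is
  -- nonzero modulo I.
  refine colon_le_of_duality (S := S) (fun k hk => ?_) (eq_zero_of_smul_mem (Δ := Δ) (fun r hr => ?_)
    he rfl ?_) m w ?_ (fun s i => ?_) (fun i j hij => ?_) fun i => ?_
  · obtain ⟨x, hx, y, hy, rfl⟩ := Submodule.mem_sup.1 hk
    rw [mul_add]
    refine I.add_mem (I.mul_mem_left _ hx) (Ideal.mem_sup_left ?_)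
    have : Ideal.ofList ((List.finRange 5).map g) ≤
        Submodule.comap (LinearMap.mulLeft Poly16 q) (Ideal.ofList ((List.finRange 5).map F)) :=
      ofList_map_le hqg
    exact this hy
  · have : I ≤ Submodule.comap (LinearMap.mulLeft Poly16 Δ) P := by
      refine sup_le (ofList_map_le fun k => ?_) (ofList_le_iff.2 fun x hx => ?_)
      · change Δ * F k ∈ P
        exact mem_of_hom fun φ hφ => by simpa using (hφP φ hφ).1 k
      · obtain ⟨j, rfl⟩ := mem_params.1 hx
        change Δ * X (.inr j) ∈ P
        exact Ideal.mul_mem_left _ _ (hPr j)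
    exact this hr
  · refine mem_of_hom fun φ hφ => ?_
    rw [map_sub, map_mul, map_mul, (hφP φ hφ).2, map_prod]
    simp
  · rw [← map_one (Ideal.Quotient.mk K), ← h1]; exact hsm i₁
  · rcases s with k | j
    · rw [map_mul, (hφK (Ideal.Quotient.mk K) (by rw [Ideal.mk_ker])).1 k i]
      refine list_sum_mem fun x hx => ?_
      obtain ⟨t, -, rfl⟩ := List.mem_map.1 hx
      exact zsmul_mem (hsm _) _
    · have : Ideal.Quotient.mk K (X (.inr j) * m i) = 0 :=
        Ideal.Quotient.eq_zero_iff_mem.2 (K.mul_mem_right _ (Ideal.mem_sup_left (hp j)))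
      rw [this]
      exact Submodule.zero_mem _
  · refine mem_of_hom fun φ hφ => ?_
    rw [map_mul]
    exact (hφK φ hφ).2.1 i j hij
  · refine mem_of_hom fun φ hφ => ?_
    rw [map_sub, map_mul, (hφK φ hφ).2.2 i, sub_self]

theorem posHom_map {n : ℕ} {F : Fin n → Poly16}
    (hF : ∀ k, PosHom (homogeneousSubmodule (Fin 5 ⊕ Fin 11) ℂ) (F k)) :
    ∀ x ∈ (List.finRange n).map F, PosHom (homogeneousSubmodule (Fin 5 ⊕ Fin 11) ℂ) x := by
  simpa using hF

/-- The reduction to five variables yields regularity with the parameters in front, while lifting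
colon ideals needs them last. -/
theorem regList_of_params_append {n : ℕ} {F : Fin n → Poly16}
    (hF : ∀ k, PosHom (homogeneousSubmodule (Fin 5 ⊕ Fin 11) ℂ) (F k))
    (h : RegList ⊥ (params ++ (List.finRange n).map F)) :
    RegList ⊥ ((List.finRange n).map F) ∧
      RegList (Ideal.ofList ((List.finRange n).map F)) params := by
  have h := h.perm (𝒜 := homogeneousSubmodule (Fin 5 ⊕ Fin 11) ℂ)
    List.perm_append_comm (Ideal.IsHomogeneous.bot _) fun x hx => by
      rcases List.mem_append.1 hx with hx | hx
      exacts [posHom_params x hx, posHom_map hF x hx]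
  rwa [regList_append, bot_sup_eq] at h

theorem mul_mem_of_forall {n : ℕ} {g : Fin n → Poly16} {q : Poly16} {I : Ideal Poly16}
    (h : ∀ k, q * g k ∈ I) : ∀ j ∈ Ideal.ofList ((List.finRange n).map g), q * j ∈ I := by
  have : Ideal.ofList ((List.finRange n).map g) ≤
      Submodule.comap (LinearMap.mulLeft Poly16 q) I := ofList_map_le h
  exact fun j hj => this hj

/-- The inverse of 2 in ℂ is transported to `B` by `φ`. -/
theorem eq_zero_of_two_mul {B : Type*} [CommRing B] (φ : Poly16 →+* B) {x : B} (h : 2 * x = 0) :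
    x = 0 := by
  have h2 : φ (C (1 / 2)) * 2 = 1 := by
    rw [← map_ofNat φ 2, ← map_mul, ← map_ofNat C 2, ← map_mul]
    norm_num
  linear_combination φ (C (1 / 2)) * h - x * h2

/-- The `2 × 2` minors of a matrix. -/
def minor {A : Type*} [CommRing A] (L : Matrix (Fin 4) (Fin 4) A) (i j α β : Fin 4) : A :=
  L i α * L j β - L i β * L j α

end GradedReg

/-! ### The colon ideal for four ghosts of equal chirality -/

namespace GradedReg

open MvPolynomial

attribute [local instance] MvPolynomial.gradedAlgebra

namespace Chiral

/-- Coordinates on four spinors of the same chirality. -/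
def coord {A : Type*} [CommRing A] (y : Fin 5 → A) (h : Fin 11 → A) : Matrix (Fin 4) (Fin 4) A :=
  -- An invertible linear change of the 16 entries, chosen so that at h = 0 the five quadrics become
  -- a triangular system making every `y k` nilpotent (`seq_coord_zero`).
  !![-y 1 + h 0, h 1, y 4 + h 2, y 0;
    y 4, y 0 + h 3, h 4, y 1;
    y 2, y 3, h 5, h 6;
    h 7, -y 2 + h 8, y 3 + h 9, h 10]

/-- The quadrics that define the coboundary operator. -/
def quad {A : Type*} [CommRing A] (L : Matrix (Fin 4) (Fin 4) A) (α β : Fin 4) : A :=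
  minor L 0 1 α β + minor L 2 3 α β

/-- Five of the quadrics. -/
def seq {A : Type*} [CommRing A] (L : Matrix (Fin 4) (Fin 4) A) : Fin 5 → A :=
  ![quad L 3 1, quad L 0 3, quad L 0 1, quad L 1 2, quad L 0 2]

/-- Generators of the colon ideal. -/
def colonGen {A : Type*} [CommRing A] (L : Matrix (Fin 4) (Fin 4) A) : Fin 5 → A :=
  ![minor L 0 2 0 1, minor L 0 3 0 1, minor L 1 2 0 1, minor L 1 3 0 1,
    minor L 0 1 0 1 - minor L 2 3 0 1]

section map

variable {A B : Type*} [CommRing A] [CommRing B] (φ : A →+* B)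

theorem map_coord (y : Fin 5 → A) (h : Fin 11 → A) (i j : Fin 4) :
    φ (coord y h i j) = coord (fun k => φ (y k)) (fun k => φ (h k)) i j := by
  revert i j
  simp [Fin.forall_fin_succ, coord]

theorem map_quad (L : Matrix (Fin 4) (Fin 4) A) (α β : Fin 4) :
    φ (quad L α β) = quad (L.map φ) α β := by
  simp [quad, minor]

theorem map_seq (L : Matrix (Fin 4) (Fin 4) A) (k : Fin 5) :
    φ (seq L k) = seq (L.map φ) k := by
  revert k
  simp [Fin.forall_fin_succ, seq, map_quad]

theorem map_colonGen (L : Matrix (Fin 4) (Fin 4) A) (k : Fin 5) :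
    φ (colonGen L k) = colonGen (L.map φ) k := by
  revert k
  simp [Fin.forall_fin_succ, colonGen, minor]

end map

theorem seq_coord_zero {A : Type*} [CommRing A] (y : Fin 5 → A) :
    seq (coord y 0) = ![y 0 ^ 2, -(y 1 ^ 2 + y 0 * y 4), -(y 2 ^ 2 + y 0 * y 1),
      y 3 ^ 2 - y 0 * y 4, y 2 * y 3 - y 4 ^ 2] := by
  ext k
  revert k
  simp [Fin.forall_fin_succ, seq, quad, minor, coord]
  refine ⟨?_, ?_, ?_, ?_, ?_⟩ <;> ring

theorem colonGen_coord_zero {A : Type*} [CommRing A] (y : Fin 5 → A) :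
    colonGen (coord y 0) = ![-y 1 * y 3, y 1 * y 2, y 4 * y 3 - y 0 * y 2, -y 4 * y 2,
      -y 1 * y 0 + y 2 ^ 2] := by
  ext k
  revert k
  simp [Fin.forall_fin_succ, colonGen, minor, coord]
  ring

theorem coord_mem {A : Type*} [CommRing A] (S : AddSubgroup A) {y : Fin 5 → A} {h : Fin 11 → A}
    (hy : ∀ k, y k ∈ S) (hh : ∀ k, h k ∈ S) (i j : Fin 4) : coord y h i j ∈ S := by
  revert i j
  simp [Fin.forall_fin_succ, coord, hy, hh, S.add_mem]

/-- The coordinates as polynomials. -/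
noncomputable def polyCoord : Matrix (Fin 4) (Fin 4) Poly16 :=
  coord (fun k => X (.inl k)) fun j => X (.inr j)

theorem minor_isHomogeneous (i j α β : Fin 4) : (minor polyCoord i j α β).IsHomogeneous 2 := by
  have h : ∀ i j, (polyCoord i j).IsHomogeneous 1 := fun i j =>
    coord_mem (homogeneousSubmodule (Fin 5 ⊕ Fin 11) ℂ 1).toAddSubgroup
      (fun k => isHomogeneous_X ℂ _) (fun k => isHomogeneous_X ℂ _) i j
  exact ((h _ _).mul (h _ _)).sub ((h _ _).mul (h _ _))

theorem quad_isHomogeneous (α β : Fin 4) : (quad polyCoord α β).IsHomogeneous 2 :=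
  (minor_isHomogeneous _ _ _ _).add (minor_isHomogeneous _ _ _ _)

theorem seq_isHomogeneous (k : Fin 5) : (seq polyCoord k).IsHomogeneous 2 := by
  revert k
  simp [Fin.forall_fin_succ, seq, quad_isHomogeneous]

theorem colonGen_isHomogeneous (k : Fin 5) : (colonGen polyCoord k).IsHomogeneous 2 := by
  revert k
  simp [Fin.forall_fin_succ, colonGen, minor_isHomogeneous, IsHomogeneous.sub]

theorem map_polyCoord {B : Type*} [CommRing B] (φ : Poly16 →+* B) (hφ : ∀ j, φ (X (.inr j)) = 0) :
    polyCoord.map φ = coord (fun k => φ (X (.inl k))) 0 := by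
  ext i j
  rw [Matrix.map_apply, polyCoord, map_coord]
  simp only [hφ]
  rfl

/-- The complementary factors of powers of the variables. -/
def cofactor {A : Type*} [CommRing A] (y : Fin 5 → A) : Fin 5 → A :=
  ![1, -(y 1 ^ 2 - y 0 * y 4), -(y 2 ^ 2 - y 0 * y 1), y 3 ^ 2 + y 0 * y 4,
    -(y 4 ^ 2 + y 2 * y 3)]

/-- The exponents of the powers of the variables. -/
def expo : Fin 5 → ℕ := ![2, 4, 4, 4, 4]

theorem map_cofactor {A B : Type*} [CommRing A] [CommRing B] (φ : A →+* B) (y : Fin 5 → A)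
    (k : Fin 5) : φ (cofactor y k) = cofactor (fun k => φ (y k)) k := by
  revert k
  simp [Fin.forall_fin_succ, cofactor]

/-- For k > 0 the quadric and its cofactor are, up to sign, y_k² + z and y_k² - z, and z² vanishes
modulo the preceding quadrics. -/
theorem pow_sub_mul_cofactor {B : Type*} [CommRing B] (y : Fin 5 → B) (k : Fin 5)
    (h : ∀ j < k, seq (coord y 0) j = 0) :
    y k ^ expo k - seq (coord y 0) k * cofactor y k = 0 := by
  revert k
  simp [Fin.forall_fin_succ, seq_coord_zero, cofactor, expo]
  generalize y 0 = a at *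
  generalize y 1 = b at *
  generalize y 2 = c at *
  generalize y 3 = d at *
  generalize y 4 = e at *
  refine ⟨?_, ?_, ?_, ?_⟩ <;> intros <;> grind

theorem seq_posHom (k : Fin 5) :
    PosHom (homogeneousSubmodule (Fin 5 ⊕ Fin 11) ℂ) (seq polyCoord k) :=
  ⟨2, two_pos, seq_isHomogeneous k⟩

theorem regList_params_seq : RegList ⊥ (params ++ (List.finRange 5).map (seq polyCoord)) := by
  refine regList_params_append (n := expo) (G := cofactor fun k => X (.inl k))
    (by decide) seq_posHom fun φ k hφ h => ?_
  rw [map_sub, map_mul, map_pow, map_seq, map_polyCoord φ hφ, map_cofactor]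
  refine pow_sub_mul_cofactor (fun k => φ (X (.inl k))) k fun j hj => ?_
  rw [← map_polyCoord φ hφ, ← map_seq]
  exact h j hj

theorem regList_seq : RegList ⊥ ((List.finRange 5).map (seq polyCoord)) ∧
    RegList (Ideal.ofList ((List.finRange 5).map (seq polyCoord))) params :=
  regList_of_params_append seq_posHom regList_params_seq

/-- A basis of the quotient by the parameters, `seq` and `colonGen`. -/
def mono {A : Type*} [CommRing A] (y : Fin 5 → A) : Fin 12 → A :=
  -- Degrees 0, 1, 2, 3 occur 1, 5, 5, 1 times: five quadrics have their socle in degree 5, so the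
  -- quotient by the colon ideal of a further quadric is Gorenstein with socle in degree 3.
  ![1, y 0, y 1, y 2, y 3, y 4, y 0 * y 2, y 0 * y 3, y 0 * y 4, y 1 * y 4, y 2 * y 3,
    y 0 * y 2 * y 3]

/-- The dual basis of `mono`, up to triangularity. -/
def dual {A : Type*} [CommRing A] (y : Fin 5 → A) : Fin 12 → A :=
  ![y 0 * y 2 * y 3, y 2 * y 3, -(y 1 * y 4), y 0 * y 3, y 0 * y 2, y 0 * y 4, y 3, y 2, y 4,
    -y 1, y 0, 1]

/-- The multiplication table with respect to `mono`. -/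
def table : Fin 5 → Fin 12 → List (ℤ × Fin 12) :=
  ![![[(1, 1)], [], [], [(1, 6)], [(1, 7)], [(1, 8)], [], [], [], [], [(1, 11)], []],
    ![[(1, 2)], [], [(-1, 8)], [], [], [(1, 9)], [], [], [], [(-1, 11)], [], []],
    ![[(1, 3)], [(1, 6)], [], [], [(1, 10)], [], [], [(1, 11)], [], [], [], []],
    ![[(1, 4)], [(1, 7)], [], [(1, 10)], [(1, 8)], [(1, 6)], [(1, 11)], [], [], [], [], []],
    ![[(1, 5)], [(1, 8)], [(1, 9)], [], [(1, 6)], [(1, 10)], [], [], [(1, 11)], [], [], []]]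

section table

variable {A B : Type*} [CommRing A] [CommRing B]

theorem map_mono (φ : A →+* B) (y : Fin 5 → A) (i : Fin 12) :
    φ (mono y i) = mono (fun k => φ (y k)) i := by
  revert i
  simp [Fin.forall_fin_succ, mono]

theorem map_dual (φ : A →+* B) (y : Fin 5 → A) (i : Fin 12) :
    φ (dual y i) = dual (fun k => φ (y k)) i := by
  revert i
  simp [Fin.forall_fin_succ, dual]

/-- The relations that hold modulo the parameters, `seq` and `colonGen`. -/
def Rel (y : Fin 5 → B) : Prop :=
  (y 0 ^ 2 = 0 ∧ y 1 ^ 2 = -(y 0 * y 4) ∧ y 2 ^ 2 = 0 ∧ y 3 ^ 2 = y 0 * y 4 ∧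
    y 4 ^ 2 = y 2 * y 3) ∧ y 0 * y 1 = 0 ∧ y 1 * y 3 = 0 ∧ y 1 * y 2 = 0 ∧
    y 3 * y 4 = y 0 * y 2 ∧ y 2 * y 4 = 0

theorem rel_of_eq_zero {y : Fin 5 → B} (h2 : ∀ x : B, 2 * x = 0 → x = 0)
    (hF : ∀ k, seq (coord y 0) k = 0) (hg : ∀ k, colonGen (coord y 0) k = 0) : Rel y := by
  simp only [seq_coord_zero, colonGen_coord_zero, Fin.forall_fin_succ] at hF hg
  simp at hF hg
  -- A quadric gives y₂² = -y₀y₁ and a colon generator gives y₂² = y₀y₁.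
  have h := h2 (y 0 * y 1) (by linear_combination -hF.2.2.1 - hg.2.2.2.2)
  refine ⟨⟨?_, ?_, ?_, ?_, ?_⟩, h, ?_, ?_, ?_, ?_⟩ <;> grind

theorem mul_mono {y : Fin 5 → B} (h : Rel y) (k : Fin 5) (i : Fin 12) :
    y k * mono y i = ((table k i).map fun t => t.1 • mono y t.2).sum := by
  obtain ⟨⟨h1, h2, h3, h4, h5⟩, h6, h7, h8, h9, h10⟩ := h
  revert k i
  simp [Fin.forall_fin_succ, mono, table]
  generalize y 0 = a at *
  generalize y 1 = b at *
  generalize y 2 = c at *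
  generalize y 3 = d at *
  generalize y 4 = e at *
  repeat' apply And.intro
  all_goals grind

theorem dual_mul_mono {y : Fin 5 → B} (h : Rel y) :
    (∀ i j, i < j → dual y i * mono y j = 0) ∧
      ∀ i, dual y i * mono y i = y 0 * y 2 * y 3 := by
  obtain ⟨⟨h1, h2, h3, h4, h5⟩, h6, h7, h8, h9, h10⟩ := h
  simp [Fin.forall_fin_succ, mono, dual]
  generalize y 0 = a at *
  generalize y 1 = b at *
  generalize y 2 = c at *
  generalize y 3 = d at *
  generalize y 4 = e at *
  repeat' apply And.intro
  all_goals grind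

/-- The product of cofactors, up to sign. -/
def socleFactor (y : Fin 5 → B) : B :=
  (y 1 ^ 2 - y 0 * y 4) * (y 2 ^ 2 - y 0 * y 1) * (y 3 ^ 2 + y 0 * y 4) * (y 4 ^ 2 + y 2 * y 3)

theorem map_socleFactor (φ : A →+* B) (y : Fin 5 → A) :
    φ (socleFactor y) = socleFactor fun k => φ (y k) := by
  simp [socleFactor]

/-- Up to sign, `socleFactor` is the determinant of the triangular matrix expressing the powers of
the variables by the quadrics. By Cramer's rule it carries the quadrics into the ideal of the
powers, and the socle to the monomial with exponents `expo - 1`. -/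
theorem socle {y : Fin 5 → B} (hy : ∀ k, y k ^ expo k = 0) :
    (∀ k, socleFactor y * seq (coord y 0) k = 0) ∧
    socleFactor y * (quad (coord y 0) 2 3 * (y 0 * y 2 * y 3)) =
      y 0 * y 1 ^ 3 * y 2 ^ 3 * y 3 ^ 3 * y 4 ^ 3 := by
  simp [Fin.forall_fin_succ, expo] at hy
  rw [seq_coord_zero]
  simp [Fin.forall_fin_succ, quad, minor, coord, socleFactor]
  generalize y 0 = a at *
  generalize y 1 = b at *
  generalize y 2 = c at *
  generalize y 3 = d at *
  generalize y 4 = e at *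
  repeat' apply And.intro
  all_goals grind

end table

/-- Each generator is the 01-coefficient of a 2-form m with m ∧ (r₀∧r₁ + r₂∧r₃) = 0: either r_i∧r_j
with i ∈ {0, 1} and j ∈ {2, 3}, or r₀∧r₁ - r₂∧r₃. Modulo the five quadrics only the term m₀₁ `quad L
2 3` of this relation survives. -/
theorem quad_mul_colonGen_mem (L : Matrix (Fin 4) (Fin 4) Poly16) (k : Fin 5) :
    quad L 2 3 * colonGen L k ∈ Ideal.ofList ((List.finRange 5).map (seq L)) := by
  refine mem_of_hom fun φ hφ => ?_
  have h : ∀ k, seq (L.map φ) k = 0 := fun k => by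
    rw [← map_seq]; exact hφ (mem_ofList_map _ k)
  rw [map_mul, map_quad, map_colonGen]
  generalize L.map φ = L at *
  have h13 : quad L 1 3 = 0 := by
    have h0 : quad L 3 1 = 0 := h 0
    simp only [quad, minor] at h0 ⊢
    linear_combination -h0
  have h03 : quad L 0 3 = 0 := h 1
  have h01 : quad L 0 1 = 0 := h 2
  have h12 : quad L 1 2 = 0 := h 3
  have h02 : quad L 0 2 = 0 := h 4
  have key : ∀ m : Fin 4 → Fin 4 → Poly16 ⧸ _, m 0 1 * quad L 2 3 - m 0 2 * quad L 1 3 +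
      m 0 3 * quad L 1 2 + m 1 2 * quad L 0 3 - m 1 3 * quad L 0 2 + m 2 3 * quad L 0 1 = 0 →
      quad L 2 3 * m 0 1 = 0 := fun m hm => by
    linear_combination hm + m 0 2 * h13 - m 0 3 * h12 - m 1 2 * h03 + m 1 3 * h02 - m 2 3 * h01
  have h1 := key (minor L 0 2) (by simp only [quad, minor]; ring)
  have h2 := key (minor L 0 3) (by simp only [quad, minor]; ring)
  have h3 := key (minor L 1 2) (by simp only [quad, minor]; ring)
  have h4 := key (minor L 1 3) (by simp only [quad, minor]; ring)
  have h5 := key (fun α β => minor L 0 1 α β - minor L 2 3 α β) (by simp only [quad, minor]; ring)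
  fin_cases k
  exacts [h1, h2, h3, h4, h5]

/-- The colon ideal of the sixth quadric modulo the other ones. -/
theorem mem_of_quad_mul_mem (r : Poly16)
    (hr : quad polyCoord 2 3 * r ∈ Ideal.ofList ((List.finRange 5).map (seq polyCoord))) :
    r ∈ Ideal.ofList ((List.finRange 5).map (seq polyCoord)) ⊔
      Ideal.ofList ((List.finRange 5).map (colonGen polyCoord)) := by
  have key : ∀ r, quad polyCoord 2 3 * r ∈ Ideal.ofList ((List.finRange 5).map (seq polyCoord)) ⊔
      Ideal.ofList params → r ∈ Ideal.ofList ((List.finRange 5).map (seq polyCoord)) ⊔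
        Ideal.ofList params ⊔ Ideal.ofList ((List.finRange 5).map (colonGen polyCoord)) := by
    refine colon_mod_params (n := expo) (Δ := socleFactor fun k => X (.inl k))
      (mono fun k => X (.inl k)) (dual fun k => X (.inl k)) (quad_mul_colonGen_mem polyCoord)
      (S := mono (fun k => X (.inl k)) 11) (e := ![1, 3, 3, 3, 3]) (by decide) ?_
      table (i₁ := 0) rfl ?_
    · intro B _ φ h1 h2
      have h := socle h2
      rw [← map_polyCoord φ h1] at h
      simp only [map_seq, map_quad, map_socleFactor, map_mono, Fin.prod_univ_five]
      exact ⟨h.1, by simpa [mono] using h.2⟩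
    · intro B _ φ h1 h2 h3
      simp only [map_seq, map_colonGen, map_polyCoord φ h1] at h2 h3
      have h := rel_of_eq_zero (fun x => eq_zero_of_two_mul φ) h2 h3
      simp only [map_mono, map_dual]
      exact ⟨mul_mono h, dual_mul_mono h⟩
  exact colon_lift_list (𝒜 := homogeneousSubmodule (Fin 5 ⊕ Fin 11) ℂ)
    (isHomogeneous_ofList (posHom_map fun k => ⟨2, two_pos, colonGen_isHomogeneous k⟩))
    (quad_isHomogeneous 2 3) posHom_params (isHomogeneous_ofList (posHom_map seq_posHom))
    regList_seq.2 (mul_mem_of_forall (quad_mul_colonGen_mem polyCoord)) key r hr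

end Chiral

end GradedReg

/-! ### The colon ideal for two ghosts of each chirality -/

namespace GradedReg

open MvPolynomial

attribute [local instance] MvPolynomial.gradedAlgebra

namespace Mixed

/-- Coordinates on two pairs of spinors of opposite chiralities. -/
def coord {A : Type*} [CommRing A] (y : Fin 5 → A) (h : Fin 11 → A) : Matrix (Fin 4) (Fin 4) A :=
  -- Again an invertible linear change that makes the quadrics triangular at h = 0. The parameter `h
  -- 10` has a special role: when the other ten vanish, `last` is -h₁₀² modulo `seq` and `minor 0 1
  -- 0 1`.
  !![y 2, y 1, y 4, h 10;
    y 1 + h 0, y 4 + h 1, h 10 + h 2, -y 2 + h 3;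
    y 3, -y 1 + h 4, -y 2 + h 5, y 0;
    h 6, y 0 + h 7, -y 3 + h 8, y 4 + h 9]

/-- Five of the quadrics that define the coboundary operator. -/
def seq {A : Type*} [CommRing A] (L : Matrix (Fin 4) (Fin 4) A) : Fin 5 → A :=
  ![minor L 0 1 0 2 + minor L 2 3 3 1, minor L 0 1 0 1 + minor L 2 3 2 3,
    minor L 0 1 0 3 + minor L 2 3 1 2, minor L 0 1 3 1 + minor L 2 3 0 2,
    minor L 0 1 1 2 + minor L 2 3 0 3]

/-- The sixth quadric. -/
def last {A : Type*} [CommRing A] (L : Matrix (Fin 4) (Fin 4) A) : A :=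
  minor L 0 1 2 3 + minor L 2 3 0 1

/-- The pairings of spinors of opposite chiralities. -/
def pair {A : Type*} [CommRing A] (L : Matrix (Fin 4) (Fin 4) A) (i j : Fin 4) : A :=
  L i 0 * L j 0 + L i 1 * L j 1 + L i 2 * L j 2 + L i 3 * L j 3

/-- Generators of the colon ideal of the generator `minor L 0 1 0 1`. -/
def colonGen {A : Type*} [CommRing A] (L : Matrix (Fin 4) (Fin 4) A) : Fin 5 → A :=
  ![last L, pair L 0 2, pair L 0 3, pair L 1 2, pair L 1 3]

section map

variable {A B : Type*} [CommRing A] [CommRing B] (φ : A →+* B)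

theorem map_coord (y : Fin 5 → A) (h : Fin 11 → A) (i j : Fin 4) :
    φ (coord y h i j) = coord (fun k => φ (y k)) (fun k => φ (h k)) i j := by
  revert i j
  simp [Fin.forall_fin_succ, coord]

theorem map_minor (L : Matrix (Fin 4) (Fin 4) A) (i j α β : Fin 4) :
    φ (minor L i j α β) = minor (L.map φ) i j α β := by
  simp [minor]

theorem map_seq (L : Matrix (Fin 4) (Fin 4) A) (k : Fin 5) :
    φ (seq L k) = seq (L.map φ) k := by
  revert k
  simp [Fin.forall_fin_succ, seq, map_minor]

theorem map_last (L : Matrix (Fin 4) (Fin 4) A) : φ (last L) = last (L.map φ) := by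
  simp [last, map_minor]

theorem map_pair (L : Matrix (Fin 4) (Fin 4) A) (i j : Fin 4) :
    φ (pair L i j) = pair (L.map φ) i j := by
  simp [pair]

theorem map_colonGen (L : Matrix (Fin 4) (Fin 4) A) (k : Fin 5) :
    φ (colonGen L k) = colonGen (L.map φ) k := by
  revert k
  simp [Fin.forall_fin_succ, colonGen, map_last, map_pair]

end map

theorem seq_coord_zero {A : Type*} [CommRing A] (y : Fin 5 → A) :
    seq (coord y 0) = ![y 0 ^ 2, y 0 * y 3 - y 1 ^ 2, y 1 * y 3 + y 0 * y 2 - y 2 ^ 2,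
      y 1 * y 2 - y 3 ^ 2, y 3 * y 4 - y 4 ^ 2] := by
  ext k
  revert k
  simp [Fin.forall_fin_succ, seq, minor, coord]
  refine ⟨?_, ?_, ?_, ?_, ?_⟩ <;> ring

theorem colonGen_coord_zero {A : Type*} [CommRing A] (y : Fin 5 → A) :
    colonGen (coord y 0) = ![y 0 * y 3 - y 2 * y 4, y 2 * y 3 - y 1 ^ 2 - y 2 * y 4,
      y 0 * y 1 - y 3 * y 4, y 1 * y 3 - y 1 * y 4 - y 0 * y 2, y 0 * y 4 - y 2 * y 4] := by
  ext k
  revert k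
  simp [Fin.forall_fin_succ, colonGen, last, pair, minor, coord]
  refine ⟨?_, ?_, ?_, ?_, ?_⟩ <;> ring

theorem coord_mem {A : Type*} [CommRing A] (S : AddSubgroup A) {y : Fin 5 → A} {h : Fin 11 → A}
    (hy : ∀ k, y k ∈ S) (hh : ∀ k, h k ∈ S) (i j : Fin 4) : coord y h i j ∈ S := by
  revert i j
  simp [Fin.forall_fin_succ, coord, hy, hh, S.add_mem]

/-- The coordinates as polynomials. -/
noncomputable def polyCoord : Matrix (Fin 4) (Fin 4) Poly16 :=
  coord (fun k => X (.inl k)) fun j => X (.inr j)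

theorem polyCoord_isHomogeneous (i j : Fin 4) : (polyCoord i j).IsHomogeneous 1 :=
  coord_mem (homogeneousSubmodule (Fin 5 ⊕ Fin 11) ℂ 1).toAddSubgroup
    (fun _ => isHomogeneous_X ℂ _) (fun _ => isHomogeneous_X ℂ _) i j

theorem minor_isHomogeneous (i j α β : Fin 4) : (minor polyCoord i j α β).IsHomogeneous 2 :=
  ((polyCoord_isHomogeneous _ _).mul (polyCoord_isHomogeneous _ _)).sub
    ((polyCoord_isHomogeneous _ _).mul (polyCoord_isHomogeneous _ _))

theorem seq_posHom (k : Fin 5) :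
    PosHom (homogeneousSubmodule (Fin 5 ⊕ Fin 11) ℂ) (seq polyCoord k) := by
  refine ⟨2, two_pos, ?_⟩
  revert k
  simp [Fin.forall_fin_succ, seq, minor_isHomogeneous, IsHomogeneous.add]

theorem last_posHom : PosHom (homogeneousSubmodule (Fin 5 ⊕ Fin 11) ℂ) (last polyCoord) :=
  ⟨2, two_pos, (minor_isHomogeneous _ _ _ _).add (minor_isHomogeneous _ _ _ _)⟩

theorem pair_isHomogeneous (i j : Fin 4) : (pair polyCoord i j).IsHomogeneous 2 := by
  have h : ∀ β, (polyCoord i β * polyCoord j β).IsHomogeneous 2 := fun β =>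
    (polyCoord_isHomogeneous _ _).mul (polyCoord_isHomogeneous _ _)
  exact (((h 0).add (h 1)).add (h 2)).add (h 3)

theorem colonGen_posHom (k : Fin 5) :
    PosHom (homogeneousSubmodule (Fin 5 ⊕ Fin 11) ℂ) (colonGen polyCoord k) := by
  refine ⟨2, two_pos, ?_⟩
  revert k
  simp [Fin.forall_fin_succ, colonGen, pair_isHomogeneous, last, minor_isHomogeneous,
    IsHomogeneous.add]

theorem map_polyCoord {B : Type*} [CommRing B] (φ : Poly16 →+* B) (hφ : ∀ j, φ (X (.inr j)) = 0) :
    polyCoord.map φ = coord (fun k => φ (X (.inl k))) 0 := by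
  ext i j
  rw [Matrix.map_apply, polyCoord, map_coord]
  simp only [hφ]
  rfl

/-- The complementary factors of powers of the variables. -/
def cofactor {A : Type*} [CommRing A] (y : Fin 5 → A) : Fin 5 → A :=
  ![1, -(y 1 ^ 2 + y 0 * y 3), -((y 2 ^ 2 + (y 1 * y 3 + y 0 * y 2)) *
    (y 2 ^ 4 + (y 1 * y 3 + y 0 * y 2) ^ 2)), -(y 3 ^ 2 + y 1 * y 2 + y 0 * y 1),
    -(y 4 ^ 3 + y 4 ^ 2 * y 3 + y 4 * y 3 ^ 2 + y 3 ^ 3)]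

/-- The exponents of the powers of the variables. -/
def expo : Fin 5 → ℕ := ![2, 4, 8, 4, 5]

theorem map_cofactor {A B : Type*} [CommRing A] [CommRing B] (φ : A →+* B) (y : Fin 5 → A)
    (k : Fin 5) : φ (cofactor y k) = cofactor (fun k => φ (y k)) k := by
  revert k
  simp [Fin.forall_fin_succ, cofactor]

/-- The cofactors complete u - v to uⁿ - vⁿ, with vⁿ zero modulo the preceding quadrics. For k = 3
the additional y₀y₁ compensates y₁²y₂² = y₀y₁y₃²; for k = 4 the remainder is y₃⁴y₄. -/
theorem pow_sub_mul_cofactor {B : Type*} [CommRing B] (y : Fin 5 → B) (k : Fin 5)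
    (h : ∀ j < k, seq (coord y 0) j = 0) :
    y k ^ expo k - seq (coord y 0) k * cofactor y k = 0 := by
  revert k
  simp [Fin.forall_fin_succ, seq_coord_zero, cofactor, expo]
  generalize y 0 = a at *
  generalize y 1 = b at *
  generalize y 2 = c at *
  generalize y 3 = d at *
  generalize y 4 = e at *
  refine ⟨?_, ?_, ?_, ?_⟩ <;> intros <;> grind

theorem regList_params_seq : RegList ⊥ (params ++ (List.finRange 5).map (seq polyCoord)) := by
  refine regList_params_append (n := expo) (G := cofactor fun k => X (.inl k))
    (by decide) seq_posHom fun φ k hφ h => ?_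
  rw [map_sub, map_mul, map_pow, map_seq, map_polyCoord φ hφ, map_cofactor]
  refine pow_sub_mul_cofactor (fun k => φ (X (.inl k))) k fun j hj => ?_
  rw [← map_polyCoord φ hφ, ← map_seq]
  exact h j hj

theorem regList_seq : RegList ⊥ ((List.finRange 5).map (seq polyCoord)) ∧
    RegList (Ideal.ofList ((List.finRange 5).map (seq polyCoord))) params :=
  regList_of_params_append seq_posHom regList_params_seq

/-- A basis of the quotient by the parameters, `seq` and `colonGen`. -/
def mono {A : Type*} [CommRing A] (y : Fin 5 → A) : Fin 12 → A :=
  ![1, y 0, y 1, y 2, y 3, y 4, y 0 * y 1, y 0 * y 2, y 0 * y 3, y 1 * y 2, y 1 * y 3,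
    y 0 * y 1 * y 3]

/-- The dual basis of `mono`. -/
def dual {A : Type*} [CommRing A] (y : Fin 5 → A) : Fin 12 → A :=
  ![y 0 * y 1 * y 3, y 1 * y 3 - 2 * (y 0 * y 2), y 0 * y 3, y 0 * y 2, y 1 * y 2 - y 0 * y 1,
    2 * (y 0 * y 1) - y 1 * y 2, 2 * y 4 - y 3, y 2 - 2 * y 0, y 1, y 3 - y 4, y 0, 1]

/-- The multiplication table with respect to `mono`. -/
def table : Fin 5 → Fin 12 → List (ℤ × Fin 12) :=
  ![![[(1, 1)], [], [(1, 6)], [(1, 7)], [(1, 8)], [(1, 8)], [], [], [], [], [(1, 11)], []],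
    ![[(1, 2)], [(1, 6)], [(1, 8)], [(1, 9)], [(1, 10)], [(1, 10), (-1, 7)], [], [], [(1, 11)],
      [], [], []],
    ![[(1, 3)], [(1, 7)], [(1, 9)], [(1, 10), (1, 7)], [(2, 8)], [(1, 8)], [], [(1, 11)], [], [],
      [(2, 11)], []],
    ![[(1, 4)], [(1, 8)], [(1, 10)], [(2, 8)], [(1, 9)], [(1, 6)], [(1, 11)], [], [], [(2, 11)],
      [], []],
    ![[(1, 5)], [(1, 8)], [(1, 10), (-1, 7)], [(1, 8)], [(1, 6)], [(1, 6)], [(1, 11)], [], [],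
      [(1, 11)], [], []]]

section table

variable {A B : Type*} [CommRing A] [CommRing B]

theorem map_mono (φ : A →+* B) (y : Fin 5 → A) (i : Fin 12) :
    φ (mono y i) = mono (fun k => φ (y k)) i := by
  revert i
  simp [Fin.forall_fin_succ, mono]

theorem map_dual (φ : A →+* B) (y : Fin 5 → A) (i : Fin 12) :
    φ (dual y i) = dual (fun k => φ (y k)) i := by
  revert i
  simp [Fin.forall_fin_succ, dual, map_ofNat]

/-- The relations that hold modulo the parameters, `seq` and `colonGen`. -/
def Rel (y : Fin 5 → B) : Prop :=
  (y 0 ^ 2 = 0 ∧ y 1 ^ 2 = y 0 * y 3 ∧ y 2 ^ 2 = y 1 * y 3 + y 0 * y 2 ∧ y 3 ^ 2 = y 1 * y 2 ∧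
    y 4 ^ 2 = y 0 * y 1) ∧ y 2 * y 4 = y 0 * y 3 ∧ y 2 * y 3 = 2 * (y 0 * y 3) ∧
    y 3 * y 4 = y 0 * y 1 ∧ y 1 * y 4 = y 1 * y 3 - y 0 * y 2 ∧ y 0 * y 4 = y 0 * y 3

theorem rel_of_eq_zero {y : Fin 5 → B}
    (hF : ∀ k, seq (coord y 0) k = 0) (hg : ∀ k, colonGen (coord y 0) k = 0) : Rel y := by
  simp only [seq_coord_zero, colonGen_coord_zero, Fin.forall_fin_succ] at hF hg
  simp at hF hg
  refine ⟨⟨?_, ?_, ?_, ?_, ?_⟩, ?_, ?_, ?_, ?_, ?_⟩ <;> grind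

theorem mul_mono {y : Fin 5 → B} (h : Rel y) (k : Fin 5) (i : Fin 12) :
    y k * mono y i = ((table k i).map fun t => t.1 • mono y t.2).sum := by
  obtain ⟨⟨h1, h2, h3, h4, h5⟩, h6, h7, h8, h9, h10⟩ := h
  revert k i
  simp [Fin.forall_fin_succ, mono, table]
  generalize y 0 = a at *
  generalize y 1 = b at *
  generalize y 2 = c at *
  generalize y 3 = d at *
  generalize y 4 = e at *
  repeat' apply And.intro
  all_goals grind

theorem dual_mul_mono {y : Fin 5 → B} (h : Rel y) :
    (∀ i j, i < j → dual y i * mono y j = 0) ∧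
      ∀ i, dual y i * mono y i = y 0 * y 1 * y 3 := by
  obtain ⟨⟨h1, h2, h3, h4, h5⟩, h6, h7, h8, h9, h10⟩ := h
  simp [Fin.forall_fin_succ, mono, dual]
  generalize y 0 = a at *
  generalize y 1 = b at *
  generalize y 2 = c at *
  generalize y 3 = d at *
  generalize y 4 = e at *
  repeat' apply And.intro
  all_goals grind

/-- The product of the cofactors. -/
def socleFactor (y : Fin 5 → B) : B :=
  cofactor y 1 * cofactor y 2 * cofactor y 3 * cofactor y 4

theorem map_socleFactor (φ : A →+* B) (y : Fin 5 → A) :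
    φ (socleFactor y) = socleFactor fun k => φ (y k) := by
  simp [socleFactor, map_cofactor]

theorem socle {y : Fin 5 → B} (hy : ∀ k, y k ^ expo k = 0) :
    (∀ k, socleFactor y * seq (coord y 0) k = 0) ∧
    socleFactor y * (minor (coord y 0) 0 1 0 1 * (y 0 * y 1 * y 3)) =
      y 0 * y 1 ^ 3 * y 2 ^ 7 * y 3 ^ 3 * y 4 ^ 4 := by
  have hq : minor (coord y 0) 0 1 0 1 = y 2 * y 4 - y 1 ^ 2 := by
    simp [minor, coord]; ring
  have h1 : cofactor y 1 = -(y 1 ^ 2 + y 0 * y 3) := rfl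
  have h2 : cofactor y 2 = -((y 2 ^ 2 + (y 1 * y 3 + y 0 * y 2)) *
    (y 2 ^ 4 + (y 1 * y 3 + y 0 * y 2) ^ 2)) := rfl
  have h3 : cofactor y 3 = -(y 3 ^ 2 + y 1 * y 2 + y 0 * y 1) := rfl
  have h4 : cofactor y 4 = -(y 4 ^ 3 + y 4 ^ 2 * y 3 + y 4 * y 3 ^ 2 + y 3 ^ 3) := rfl
  rw [socleFactor, seq_coord_zero, hq]
  simp [Fin.forall_fin_succ, expo] at hy
  -- With opaque cofactors only a few partial products need to be computed. Here the powers vanish,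
  -- not the quadrics: the remainder of each product of a quadric with its own cofactor is killed
  -- with the help of the preceding ones.
  generalize cofactor y 1 = G1 at *
  generalize cofactor y 2 = G2 at *
  generalize cofactor y 3 = G3 at *
  generalize cofactor y 4 = G4 at *
  generalize y 0 = a at *
  generalize y 1 = b at *
  generalize y 2 = c at *
  generalize y 3 = d at *
  generalize y 4 = e at *
  obtain ⟨ha, hb, hc, hd, he⟩ := hy
  have e1 : G1 * (a * d - b ^ 2) = 0 := by rw [h1]; linear_combination hb - d ^ 2 * ha
  have e2 : G2 * (b * d + a * c - c ^ 2) = -(b * d + a * c) ^ 4 := by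
    rw [h2]; linear_combination hc
  have e2' : G1 * (b * d + a * c) ^ 4 = 0 := by rw [h1]; clear h1 h2 h3 h4 e1 e2 hc; grind
  have e3 : G1 * (G3 * (b * c - d ^ 2)) = a * b ^ 2 * d * (c ^ 2 - b * d) := by
    rw [h1, h3]; clear h1 h2 h3 h4 e1 e2 e2' hc; grind
  have e3' : G2 * (a * (c ^ 2 - b * d)) = a * (b * d) ^ 4 := by
    rw [h2]; clear h1 h2 h3 h4 e1 e2 e2' e3 hb hd he; grind
  have e4 : G4 * (d * e - e ^ 2) = 0 := by rw [h4]; linear_combination he - e * hd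
  have t1 : G1 * ((c * e - b ^ 2) * (a * b * d)) = -(a * b ^ 3 * c * d * e) := by
    rw [h1]; clear h1 h2 h3 h4 e1 e2 e2' e3 e3' e4; grind
  have t3 : G3 * (a * b ^ 3 * c * d * e) = -(a * b ^ 3 * c * d ^ 3 * e) := by
    rw [h3]; clear h1 h2 h3 h4 e1 e2 e2' e3 e3' e4; grind
  have t2 : G2 * (a * b ^ 3) = -(a * b ^ 3 * c ^ 6) := by
    rw [h2]; clear h1 h2 h3 h4 e1 e2 e2' e3 e3' e4 t1 t3 hc hd he; grind
  have t4 : G4 * (d ^ 3 * e) = -(d ^ 3 * e ^ 4) := by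
    rw [h4]; clear h1 h2 h3 h4 e1 e2 e2' e3 e3' e4 t1 t2 t3; grind
  have f0 : G1 * G2 * G3 * G4 * a ^ 2 = 0 := by rw [ha, mul_zero]
  have f1 : G1 * G2 * G3 * G4 * (a * d - b ^ 2) = 0 := by linear_combination G2 * G3 * G4 * e1
  have f2 : G1 * G2 * G3 * G4 * (b * d + a * c - c ^ 2) = 0 := by
    linear_combination G1 * G3 * G4 * e2 - G3 * G4 * e2'
  have f3 : G1 * G2 * G3 * G4 * (b * c - d ^ 2) = 0 := by
    linear_combination G2 * G4 * e3 + G4 * b ^ 2 * d * e3' + G4 * a * b ^ 2 * d ^ 5 * hb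
  have f4 : G1 * G2 * G3 * G4 * (d * e - e ^ 2) = 0 := by linear_combination G1 * G2 * G3 * e4
  refine ⟨fun k => ?_, ?_⟩
  · fin_cases k
    exacts [f0, f1, f2, f3, f4]
  · linear_combination G2 * G3 * G4 * t1 - G2 * G4 * t3 + G4 * c * d ^ 3 * e * t2 -
      a * b ^ 3 * c ^ 7 * t4

end table

/-- The quadrics say r₀∧r₁ = -*(r₂∧r₃). The Plücker relations of both row pairs then kill `last`,
and contracting r₀∧r₁ with r_j for j = 2, 3 gives r₂∧r₃∧r_j = 0, which kills the pairings. -/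
theorem minor_mul_colonGen_mem (L : Matrix (Fin 4) (Fin 4) Poly16) (k : Fin 5) :
    minor L 0 1 0 1 * colonGen L k ∈ Ideal.ofList ((List.finRange 5).map (seq L)) := by
  refine mem_of_hom fun φ hφ => ?_
  have h : ∀ k, seq (L.map φ) k = 0 := fun k => by
    rw [← map_seq]; exact hφ (mem_ofList_map _ k)
  rw [map_mul, map_minor, map_colonGen]
  generalize L.map φ = L at *
  have h1 : minor L 0 1 0 2 + minor L 2 3 3 1 = 0 := h 0
  have h2 : minor L 0 1 0 1 + minor L 2 3 2 3 = 0 := h 1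
  have h3 : minor L 0 1 0 3 + minor L 2 3 1 2 = 0 := h 2
  have h4 : minor L 0 1 3 1 + minor L 2 3 0 2 = 0 := h 3
  have h5 : minor L 0 1 1 2 + minor L 2 3 0 3 = 0 := h 4
  have hx : ∀ i j, minor L i j 0 1 * minor L i j 2 3 + minor L i j 0 2 * minor L i j 3 1 +
      minor L i j 0 3 * minor L i j 1 2 = 0 := fun i j => by simp only [minor]; ring
  have k1 : minor L 0 1 0 1 * last L = 0 := by
    have e1 := hx 0 1
    have e2 := hx 2 3
    rw [last]
    linear_combination e1 + e2 - minor L 0 1 0 2 * h4 - minor L 0 1 0 3 * h5 +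
      minor L 2 3 0 1 * h2 + minor L 2 3 0 2 * h1 + minor L 2 3 0 3 * h3 - 2 * e2
  have kp : ∀ i j, (i = 0 ∨ i = 1) → (j = 2 ∨ j = 3) → minor L 0 1 0 1 * pair L i j = 0 := by
    intro i j hi hj
    -- The contraction is used only in its components 0 and 1; they avoid `minor L 0 1 2 3`, which
    -- the five quadrics do not control.
    have e : minor L 0 1 0 1 * pair L i j =
        L i 1 * (minor L 0 1 0 1 * L j 1 + minor L 0 1 0 2 * L j 2 + minor L 0 1 0 3 * L j 3) -
        L i 0 * (minor L 0 1 1 0 * L j 0 + minor L 0 1 1 2 * L j 2 + minor L 0 1 1 3 * L j 3) := by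
      rcases hi with rfl | rfl <;> simp only [pair, minor] <;> ring
    rw [e]
    have e1 : L j 1 * minor L 2 3 2 3 + L j 2 * minor L 2 3 3 1 + L j 3 * minor L 2 3 1 2 = 0 := by
      rcases hj with rfl | rfl <;> simp only [minor] <;> ring
    have e2 : L j 0 * minor L 2 3 2 3 - L j 2 * minor L 2 3 0 3 + L j 3 * minor L 2 3 0 2 = 0 := by
      rcases hj with rfl | rfl <;> simp only [minor] <;> ring
    have a1 : minor L 0 1 1 0 = -minor L 0 1 0 1 := by simp only [minor]; ring
    have a2 : minor L 0 1 1 3 = -minor L 0 1 3 1 := by simp only [minor]; ring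
    rw [a1, a2]
    linear_combination L i 1 * (L j 1 * h2 + L j 2 * h1 + L j 3 * h3 - e1) +
      L i 0 * (L j 0 * h2 - L j 2 * h5 + L j 3 * h4 - e2)
  have k2 := kp 0 2 (by simp) (by simp)
  have k3 := kp 0 3 (by simp) (by simp)
  have k4 := kp 1 2 (by simp) (by simp)
  have k5 := kp 1 3 (by simp) (by simp)
  fin_cases k
  exacts [k1, k2, k3, k4, k5]

theorem mem_of_minor_mul_mem (r : Poly16)
    (hr : minor polyCoord 0 1 0 1 * r ∈ Ideal.ofList ((List.finRange 5).map (seq polyCoord)) ⊔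
      Ideal.ofList params) : r ∈ Ideal.ofList ((List.finRange 5).map (seq polyCoord)) ⊔
        Ideal.ofList params ⊔ Ideal.ofList ((List.finRange 5).map (colonGen polyCoord)) := by
  refine colon_mod_params (n := expo) (Δ := socleFactor fun k => X (.inl k))
    (mono fun k => X (.inl k)) (dual fun k => X (.inl k)) (minor_mul_colonGen_mem polyCoord)
    (S := mono (fun k => X (.inl k)) 11) (e := ![1, 3, 7, 3, 4]) (by decide) ?_
    table (i₁ := 0) rfl ?_ r hr
  · intro B _ φ h1 h2
    have h := socle h2
    rw [← map_polyCoord φ h1] at h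
    simp only [map_seq, map_minor, map_socleFactor, map_mono, Fin.prod_univ_five]
    exact ⟨h.1, by simpa [mono] using h.2⟩
  · intro B _ φ h1 h2 h3
    simp only [map_seq, map_colonGen, map_polyCoord φ h1] at h2 h3
    have h := rel_of_eq_zero h2 h3
    simp only [map_mono, map_dual]
    exact ⟨mul_mono h, dual_mul_mono h⟩

/-- The colon ideal of the minor does not grow unexpectedly modulo the parameters, which is the
hypothesis of `RegList.sup_span`. -/
theorem regList_sup_params : RegList (Ideal.ofList ((List.finRange 5).map (seq polyCoord)) ⊔
    Ideal.span {minor polyCoord 0 1 0 1}) params :=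
  RegList.sup_span (𝒜 := homogeneousSubmodule (Fin 5 ⊕ Fin 11) ℂ)
    (isHomogeneous_ofList (posHom_map colonGen_posHom)) (minor_isHomogeneous 0 1 0 1) posHom_params
    (isHomogeneous_ofList (posHom_map seq_posHom)) regList_seq.2
    (mul_mem_of_forall (minor_mul_colonGen_mem polyCoord)) mem_of_minor_mul_mem

/-- The colon ideal of the sixth quadric modulo the other ones. -/
theorem mem_of_last_mul_mem (r : Poly16)
    (hr : last polyCoord * r ∈ Ideal.ofList ((List.finRange 5).map (seq polyCoord))) :
    r ∈ Ideal.ofList ((List.finRange 5).map (seq polyCoord)) ⊔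
      Ideal.span {minor polyCoord 0 1 0 1} := by
  set K := Ideal.ofList ((List.finRange 5).map (seq polyCoord)) ⊔
      Ideal.span {minor polyCoord 0 1 0 1} with hK
  set l : List Poly16 := (List.finRange 10).map fun j => X (Sum.inr j.castSucc) with hl
  have hp : params = l ++ [X (Sum.inr (Fin.last 10))] := by
    simp [params, List.finRange_succ_last, hl]
  have hKh : K.IsHomogeneous (homogeneousSubmodule (Fin 5 ⊕ Fin 11) ℂ) :=
    PosHom.sup (isHomogeneous_ofList (posHom_map seq_posHom))
      ⟨2, two_pos, minor_isHomogeneous 0 1 0 1⟩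
  have h1 : RegList K (l ++ [X (Sum.inr (Fin.last 10))]) := hp ▸ regList_sup_params
  rw [regList_append] at h1
  -- Modulo K and the first ten parameters, `last` equals -h₁₀², and h₁₀ is a nonzerodivisor there.
  have h2 : NZD (K ⊔ Ideal.ofList l) (last polyCoord) := by
    refine NZD.of_mul_sub_mem (x := X (.inr (Fin.last 10)) * X (.inr (Fin.last 10))) (g := -1)
      (fun r hr => h1.2.1 _ (h1.2.1 _ (by rwa [← mul_assoc]))) (mem_of_hom fun φ hφ => ?_)
    have a1 : φ (seq polyCoord 1) = 0 :=
      hφ (Ideal.mem_sup_left (Ideal.mem_sup_left (mem_ofList_map _ 1)))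
    have a2 : φ (minor polyCoord 0 1 0 1) = 0 :=
      hφ (Ideal.mem_sup_left (Ideal.mem_sup_right (Ideal.mem_span_singleton_self _)))
    have a3 : ∀ j : Fin 10, φ (X (.inr j.castSucc)) = 0 := fun j =>
      hφ (Ideal.mem_sup_right (Ideal.subset_span (by simp [hl])))
    simp [Fin.forall_fin_succ] at a3
    simp [seq, minor, polyCoord, coord, a3] at a1 a2
    simp [last, minor, polyCoord, coord, a3]
    linear_combination a1 - a2
  -- Permuting the homogeneous sequence makes `last` a nonzerodivisor modulo K itself, and K
  -- contains the five quadrics.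
  have h3 : RegList K (last polyCoord :: l) := by
    have h : RegList K (l ++ [last polyCoord]) := regList_append.2 ⟨h1.1, h2, trivial⟩
    refine h.perm (𝒜 := homogeneousSubmodule (Fin 5 ⊕ Fin 11) ℂ) (List.perm_append_singleton _ _)
      hKh fun x hx => ?_
    rcases List.mem_append.1 hx with hx | hx
    · exact posHom_params x (hp ▸ List.mem_append_left _ hx)
    · rw [List.mem_singleton.1 hx]; exact last_posHom
  exact h3.1 r (Ideal.mem_sup_left hr)

end Mixed

end GradedReg

/-! ### Spinors as a Fock space -/

namespace Fock

open Complex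

variable {V : Type*} [AddCommGroup V] [Module ℂ V]

/-- Three pairs of creation and annihilation operators that are skew for a symmetric bilinear
form. -/
structure IsFock (N M : Fin 3 → V →ₗ[ℂ] V) (β : V →ₗ[ℂ] V →ₗ[ℂ] ℂ) : Prop where
  nn : ∀ i j x, N i (N j x) + N j (N i x) = 0
  mm : ∀ i j x, M i (M j x) + M j (M i x) = 0
  nm : ∀ i j x, M j (N i x) + N i (M j x) = if i = j then x else 0
  symm : ∀ x y, β x y = β y x
  skewN : ∀ k x y, β (N k x) y = -β x (N k y)
  skewM : ∀ k x y, β (M k x) y = -β x (M k y)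

/-- The spinors of the first chirality. -/
def pos (N : Fin 3 → V →ₗ[ℂ] V) (w : V) : Fin 4 → V :=
  ![w, N 2 (N 1 w), N 0 (N 2 w), N 1 (N 0 w)]

/-- The spinors of the second chirality. -/
def neg (N : Fin 3 → V →ₗ[ℂ] V) (w : V) : Fin 4 → V :=
  ![I • N 0 (N 1 (N 2 w)), I • N 0 w, I • N 1 w, I • N 2 w]

/-- The coefficients of a basic alternating form. -/
def alt (i j α γ : Fin 4) : ℂ :=
  if α = i ∧ γ = j then 1 else if α = j ∧ γ = i then -1 else 0

variable {N M : Fin 3 → V →ₗ[ℂ] V} {β : V →ₗ[ℂ] V →ₗ[ℂ] ℂ}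

namespace IsFock

theorem swap (h : IsFock N M β) : IsFock M N β :=
  ⟨h.mm, h.nn, fun i j x => by rw [add_comm, h.nm]; simp [eq_comm], h.symm, h.skewM, h.skewN⟩

theorem nsq (h : IsFock N M β) (i : Fin 3) (x : V) : N i (N i x) = 0 := by
  have h1 := h.nn i i x
  rw [← two_smul ℂ, smul_eq_zero] at h1
  simpa using h1

theorem mn_self (h : IsFock N M β) (i : Fin 3) (x : V) : M i (N i x) = x - N i (M i x) := by
  rw [eq_sub_iff_add_eq, h.nm, if_pos rfl]

theorem mn (h : IsFock N M β) {i j : Fin 3} (hij : i ≠ j) (x : V) :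
    M i (N j x) = -N j (M i x) := by
  rw [eq_neg_iff_add_eq_zero, h.nm, if_neg hij.symm]

theorem ncomm (h : IsFock N M β) (i j : Fin 3) (x : V) : N i (N j x) = -N j (N i x) := by
  rw [eq_neg_iff_add_eq_zero, h.nn]

/-- Here y = M_j N_j y, and skewness moves M_j onto the vacuum. So the vacuum is orthogonal to every
state in which some mode is empty. -/
theorem apply_eq_zero (h : IsFock N M β) {w : V} (hw : ∀ k, M k w = 0) {y : V} (j : Fin 3)
    (hy : M j y = 0) : β w y = 0 := by
  have h1 : y = M j (N j y) := by rw [h.mn_self, hy, map_zero, sub_zero]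
  have h2 := h.skewM j w (N j y)
  rw [hw j, map_zero, LinearMap.zero_apply] at h2
  rw [h1, ← neg_eq_zero]
  exact h2.symm

set_option maxHeartbeats 1000000 in
-- Moving all operators to one side reduces each pairing to the vacuum against the filled state, or
-- to zero. The factors `I` in `neg` give the alternating forms the same sign for both chiralities.
theorem forms (h : IsFock N M β) {w : V} (hw : ∀ k, M k w = 0)
    (hκ : β w (N 0 (N 1 (N 2 w))) = 1) :
    ((∀ k α γ, β (N k (pos N w α)) (pos N w γ) = alt 0 k.succ α γ) ∧
    (∀ k α γ, β (N k (neg N w α)) (neg N w γ) = alt (k + 1).succ (k + 2).succ α γ) ∧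
    (∀ k α γ, β (M k (pos N w α)) (pos N w γ) = alt (k + 1).succ (k + 2).succ α γ) ∧
    (∀ k α γ, β (M k (neg N w α)) (neg N w γ) = alt 0 k.succ α γ)) ∧
    (∀ α γ, β (pos N w α) (neg N w γ) = if α = γ then I else 0) ∧
    (∀ α γ, β (pos N w α) (pos N w γ) = 0) ∧ ∀ α γ, β (neg N w α) (neg N w γ) = 0 := by
  have n10 := h.ncomm 1 0
  have n20 := h.ncomm 2 0
  have n21 := h.ncomm 2 1
  have m01 : ∀ x, M 0 (N 1 x) = -N 1 (M 0 x) := h.mn (by decide)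
  have m02 : ∀ x, M 0 (N 2 x) = -N 2 (M 0 x) := h.mn (by decide)
  have m12 : ∀ x, M 1 (N 2 x) = -N 2 (M 1 x) := h.mn (by decide)
  have m10 : ∀ x, M 1 (N 0 x) = -N 0 (M 1 x) := h.mn (by decide)
  have m20 : ∀ x, M 2 (N 0 x) = -N 0 (M 2 x) := h.mn (by decide)
  have m21 : ∀ x, M 2 (N 1 x) = -N 1 (M 2 x) := h.mn (by decide)
  have z : β w w = 0 := h.apply_eq_zero hw 0 (hw 0)
  have z0 : β w (N 0 w) = 0 := h.apply_eq_zero hw 1 (by simp [m10, hw])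
  have z1 : β w (N 1 w) = 0 := h.apply_eq_zero hw 0 (by simp [m01, hw])
  have z2 : β w (N 2 w) = 0 := h.apply_eq_zero hw 0 (by simp [m02, hw])
  have z01 : β w (N 0 (N 1 w)) = 0 := h.apply_eq_zero hw 2 (by simp [m20, m21, hw])
  have z02 : β w (N 0 (N 2 w)) = 0 := h.apply_eq_zero hw 1 (by simp [m10, m12, hw])
  have z12 : β w (N 1 (N 2 w)) = 0 := h.apply_eq_zero hw 0 (by simp [m01, m02, hw])
  refine ⟨⟨?_, ?_, ?_, ?_⟩, ?_, ?_, ?_⟩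
  case refine_5 | refine_6 | refine_7 =>
    intro α γ
    fin_cases α <;> fin_cases γ <;>
      simp [pos, neg, h.skewN, n10, n20, n21, h.nsq, hκ, z, z0, z1, z2, z01, z02, z12]
  all_goals
    intro k α γ
    fin_cases k <;> fin_cases α <;> fin_cases γ <;>
      simp [pos, neg, alt, h.skewN, n10, n20, n21, h.nsq, hκ, z0, z1, z2, h.mn_self,
        m01, m02, m12, m10, m20, m21, hw]

end IsFock

end Fock

namespace Fock

open Complex

variable {V : Type*} [AddCommGroup V] [Module ℂ V]
variable {N M : Fin 3 → V →ₗ[ℂ] V} {β : V →ₗ[ℂ] V →ₗ[ℂ] ℂ}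

namespace IsFock

theorem exists_ne_zero_annihilated (h : IsFock N M β) [Nontrivial V] :
    ∃ w : V, w ≠ 0 ∧ ∀ k, M k w = 0 := by
  have step : ∀ (k : Fin 3) (x : V), x ≠ 0 →
      ∃ y, y ≠ 0 ∧ M k y = 0 ∧ ∀ j, M j x = 0 → M j y = 0 := by
    intro k x hx
    by_cases hk : M k x = 0
    · exact ⟨x, hx, hk, fun _ hj => hj⟩
    · exact ⟨M k x, hk, h.swap.nsq k x, fun j hj => by rw [h.swap.ncomm, hj, map_zero, neg_zero]⟩
  obtain ⟨x, hx⟩ := exists_ne (0 : V)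
  obtain ⟨x0, h0, k0, -⟩ := step 0 x hx
  obtain ⟨x1, h1, k1, j1⟩ := step 1 x0 h0
  obtain ⟨x2, h2, k2, j2⟩ := step 2 x1 h1
  refine ⟨x2, h2, fun k => ?_⟩
  fin_cases k
  exacts [j2 0 (j1 0 k0), j2 1 k1, k2]

/-- Inserting N_k M_k next to a vacuum w does not change β w x, so some vacuum u pairs with w under
(a, b) ↦ β(a, N₀N₁N₂ b). This form is symmetric, so one of w, u, w + u has nonzero square; a square
root in ℂ normalizes it. -/
theorem exists_vacuum (h : IsFock N M β) [Nontrivial V]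
    (hβ : ∀ x, (∀ y, β x y = 0) → x = 0) :
    ∃ w : V, (∀ k, M k w = 0) ∧ β w (N 0 (N 1 (N 2 w))) = 1 := by
  obtain ⟨w, hw0, hw⟩ := h.exists_ne_zero_annihilated
  obtain ⟨x, hx⟩ : ∃ x, β w x ≠ 0 := by
    by_contra! H
    exact hw0 (hβ w H)
  have h1 : ∀ k y, β w (N k (M k y)) = β w y := fun k y => by
    have h2 := h.skewM k w (N k y)
    rw [hw k, map_zero, LinearMap.zero_apply, h.mn_self, map_sub] at h2
    linear_combination -h2
  have hsymm : ∀ a b, β a (N 0 (N 1 (N 2 b))) = β b (N 0 (N 1 (N 2 a))) := fun a b => by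
    rw [h.symm b, h.skewN, h.skewN, h.skewN]
    simp [h.ncomm 2 1, h.ncomm 2 0, h.ncomm 1 0]
  set u := M 0 (M 1 (M 2 x)) with hu
  have hwu : β w (N 0 (N 1 (N 2 u))) ≠ 0 := by
    have e : β w x = -β w (N 0 (N 1 (N 2 u))) := by
      rw [← h1 2 x, ← h1 1 (N 2 _), ← h1 0 (N 1 _), h.mn (by decide : (1 : Fin 3) ≠ 2), map_neg,
        map_neg, map_neg, h.mn (by decide : (0 : Fin 3) ≠ 1), h.mn (by decide : (0 : Fin 3) ≠ 2)]
      simp [hu]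
    rw [e] at hx
    simpa using hx
  have huM : ∀ k, M k u = 0 := by
    intro k
    have c := h.swap.ncomm
    have s := h.swap.nsq
    fin_cases k <;> simp [hu, s, c 1 0, c 2 0, c 2 1]
  obtain ⟨v, hv, hκ⟩ : ∃ v, (∀ k, M k v = 0) ∧ β v (N 0 (N 1 (N 2 v))) ≠ 0 := by
    by_cases c1 : β w (N 0 (N 1 (N 2 w))) = 0
    · by_cases c2 : β u (N 0 (N 1 (N 2 u))) = 0
      · refine ⟨w + u, fun k => by rw [map_add, hw, huM, add_zero], ?_⟩
        simp only [map_add, LinearMap.add_apply, c1, c2, hsymm u w]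
        simpa [← two_mul] using hwu
      · exact ⟨u, huM, c2⟩
    · exact ⟨w, hw, c1⟩
  obtain ⟨z, hz⟩ := IsAlgClosed.exists_pow_nat_eq (β v (N 0 (N 1 (N 2 v))))⁻¹ two_pos
  refine ⟨z • v, fun k => by rw [map_smul, hv, smul_zero], ?_⟩
  simp only [map_smul, LinearMap.smul_apply, smul_eq_mul]
  rw [← mul_assoc, ← sq, hz, inv_mul_cancel₀ hκ]

/-- The expansion of a vector with respect to the frame. -/
theorem expansion (h : IsFock N M β) (hdim : Module.finrank ℂ V = 8)
    (hβ : ∀ x, (∀ y, β x y = 0) → x = 0) {w : V} (hw : ∀ k, M k w = 0)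
    (hκ : β w (N 0 (N 1 (N 2 w))) = 1) (x : V) :
    x = ∑ α, ((-I * β x (neg N w α)) • pos N w α + (-I * β x (pos N w α)) • neg N w α) := by
  obtain ⟨-, hpn, hpp, hnn⟩ := h.forms hw hκ
  have hnp : ∀ α γ, β (neg N w α) (pos N w γ) = if γ = α then I else 0 := fun α γ => by
    rw [h.symm, hpn]
  have hli : LinearIndependent ℂ (Sum.elim (pos N w) (neg N w)) := by
    rw [Fintype.linearIndependent_iff]
    intro g hg
    simp only [Fintype.sum_sum_type, Sum.elim_inl, Sum.elim_inr] at hg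
    rintro (α | α)
    · have := congrArg (fun v => β v (neg N w α)) hg
      simpa [hpn, hnn, map_add, map_sum] using this
    · have := congrArg (fun v => β v (pos N w α)) hg
      simpa [hnp, hpp, map_add, map_sum] using this
  have : FiniteDimensional ℂ V := Module.finite_of_finrank_pos (by omega)
  have hspan := hli.span_eq_top_of_card_eq_finrank' (by simp [hdim])
  rw [← sub_eq_zero]
  set y := x - _ with hy
  have hp : ∀ α, β y (pos N w α) = 0 := fun α => by
    simp [hy, Finset.sum_add_distrib, hnp, hpp, map_sum, map_sub]
    linear_combination (β x (pos N w α)) * I_mul_I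
  have hn : ∀ α, β y (neg N w α) = 0 := fun α => by
    simp [hy, Finset.sum_add_distrib, hnn, hpn, map_sum, map_sub]
    linear_combination (β x (neg N w α)) * I_mul_I
  refine hβ y fun v => ?_
  have hv : v ∈ Submodule.span ℂ (Set.range (Sum.elim (pos N w) (neg N w))) :=
    hspan ▸ Submodule.mem_top
  induction hv using Submodule.span_induction with
  | mem v hv =>
    obtain ⟨α | α, rfl⟩ := hv
    exacts [hp α, hn α]
  | zero => simp
  | add a b _ _ ha hb => rw [map_add, ha, hb, add_zero]
  | smul c a _ ha => rw [map_smul, ha, smul_zero]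

/-- `G w` is again a vacuum, so its expansion in the frame has only a `w` term; its coefficient
squares to 1. -/
theorem eq_or_eq_neg (h : IsFock N M β) (hdim : Module.finrank ℂ V = 8)
    (hβ : ∀ x, (∀ y, β x y = 0) → x = 0) {w : V} (hw : ∀ k, M k w = 0)
    (hκ : β w (N 0 (N 1 (N 2 w))) = 1) {G : V →ₗ[ℂ] V} (hG : ∀ x, G (G x) = x)
    (hM : ∀ k x, G (M k x) = -M k (G x)) : G w = w ∨ G w = -w := by
  have hy : ∀ k, M k (G w) = 0 := fun k => by
    rw [← neg_eq_zero, ← hM, hw, map_zero]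
  have h1 := h.expansion hdim hβ hw hκ (G w)
  have m01 : ∀ x, M 0 (N 1 x) = -N 1 (M 0 x) := h.mn (by decide)
  have m02 : ∀ x, M 0 (N 2 x) = -N 2 (M 0 x) := h.mn (by decide)
  have m12 : ∀ x, M 1 (N 2 x) = -N 2 (M 1 x) := h.mn (by decide)
  have m10 : ∀ x, M 1 (N 0 x) = -N 0 (M 1 x) := h.mn (by decide)
  have m20 : ∀ x, M 2 (N 0 x) = -N 0 (M 2 x) := h.mn (by decide)
  have m21 : ∀ x, M 2 (N 1 x) = -N 1 (M 2 x) := h.mn (by decide)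
  have z := h.apply_eq_zero hy 0 (hw 0)
  have z0 : β (G w) (N 0 w) = 0 := h.apply_eq_zero hy 1 (by simp [m10, hw])
  have z1 : β (G w) (N 1 w) = 0 := h.apply_eq_zero hy 0 (by simp [m01, hw])
  have z2 : β (G w) (N 2 w) = 0 := h.apply_eq_zero hy 0 (by simp [m02, hw])
  have z10 : β (G w) (N 1 (N 0 w)) = 0 := h.apply_eq_zero hy 2 (by simp [m20, m21, hw])
  have z02 : β (G w) (N 0 (N 2 w)) = 0 := h.apply_eq_zero hy 1 (by simp [m10, m12, hw])
  have z21 : β (G w) (N 2 (N 1 w)) = 0 := h.apply_eq_zero hy 0 (by simp [m01, m02, hw])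
  simp only [Fin.sum_univ_four, pos, neg, Matrix.cons_val] at h1
  simp only [map_smul, z, z0, z1, z2, z10, z02, z21, smul_zero, mul_zero, zero_smul,
    add_zero] at h1
  set c := -I * I • β (G w) (N 0 (N 1 (N 2 w)))
  have h2 : (c * c) • w = w := by
    conv_rhs => rw [← hG w, h1, map_smul, h1]
    rw [smul_smul]
  have hw0 : w ≠ 0 := by
    rintro rfl
    simp at hκ
  have h3 : c * c = 1 := by
    have : (c * c - 1) • w = 0 := by rw [sub_smul, h2, one_smul, sub_self]
    rcases smul_eq_zero.1 this with h | h
    · linear_combination h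
    · exact absurd h hw0
  rcases mul_self_eq_one_iff.1 h3 with h | h
  · left; rw [h1, h, one_smul]
  · right; rw [h1, h, neg_one_smul]

/-- A vacuum of positive chirality exists, possibly after an exchange of the creation and
annihilation operators. -/
theorem exists_chiral_vacuum (h : IsFock N M β) (hdim : Module.finrank ℂ V = 8)
    (hβ : ∀ x, (∀ y, β x y = 0) → x = 0) {G : V →ₗ[ℂ] V} (hG : ∀ x, G (G x) = x)
    (hN : ∀ k x, G (N k x) = -N k (G x)) (hM : ∀ k x, G (M k x) = -M k (G x)) :
    (∃ w, (∀ k, M k w = 0) ∧ β w (N 0 (N 1 (N 2 w))) = 1 ∧ G w = w) ∨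
      ∃ w, (∀ k, N k w = 0) ∧ β w (M 0 (M 1 (M 2 w))) = 1 ∧ G w = w := by
  have : Nontrivial V := Module.nontrivial_of_finrank_pos (R := ℂ) (by omega)
  obtain ⟨w, hw, hκ⟩ := h.exists_vacuum hβ
  rcases h.eq_or_eq_neg hdim hβ hw hκ hG hM with h1 | h1
  · exact Or.inl ⟨w, hw, hκ, h1⟩
  -- The filled state has the opposite chirality, three sign changes away, and is a vacuum for the
  -- exchanged operators. The factor `I` compensates the sign of M₀M₁M₂N₀N₁N₂ w = -w.
  · refine Or.inr ⟨I • N 0 (N 1 (N 2 w)), fun k => ?_, ?_, ?_⟩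
    · fin_cases k <;> simp [h.nsq, h.ncomm 1 0, h.ncomm 2 0, h.ncomm 2 1]
    · have m10 : ∀ x, M 1 (N 0 x) = -N 0 (M 1 x) := h.mn (by decide)
      have m20 : ∀ x, M 2 (N 0 x) = -N 0 (M 2 x) := h.mn (by decide)
      have m21 : ∀ x, M 2 (N 1 x) = -N 1 (M 2 x) := h.mn (by decide)
      simp [h.mn_self, m10, m20, m21, hw, h.symm _ w, hκ]
    · simp [hN, h1]

end IsFock

theorem chirality_pos {G : V →ₗ[ℂ] V} (hN : ∀ k x, G (N k x) = -N k (G x))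
    {w : V} (hGw : G w = w) (α : Fin 4) : G (pos N w α) = pos N w α := by
  fin_cases α <;> simp [pos, hN, hGw]

theorem chirality_neg {G : V →ₗ[ℂ] V} (hN : ∀ k x, G (N k x) = -N k (G x))
    {w : V} (hGw : G w = w) (α : Fin 4) : G (neg N w α) = -neg N w α := by
  fin_cases α <;> simp [neg, hN, hGw]

end Fock

namespace Fock

open Complex

/-- `β` pairs only opposite chiralities, which makes the dual basis consist of eigenvectors of the
chirality matrix. -/
theorem IsFock.apply_chirality {V : Type*} [AddCommGroup V] [Module ℂ V]
    {N M : Fin 3 → V →ₗ[ℂ] V} {β : V →ₗ[ℂ] V →ₗ[ℂ] ℂ} (h : IsFock N M β)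
    (hdim : Module.finrank ℂ V = 8) (hβ : ∀ x, (∀ y, β x y = 0) → x = 0) {w : V}
    (hw : ∀ k, M k w = 0) (hκ : β w (N 0 (N 1 (N 2 w))) = 1) {G : V →ₗ[ℂ] V}
    (hN : ∀ k x, G (N k x) = -N k (G x)) (hGw : G w = w) (x : V) (α : Fin 4) :
    β (G x) (neg N w α) = β x (neg N w α) ∧ β (G x) (pos N w α) = -β x (pos N w α) := by
  obtain ⟨-, hpn, hpp, hnn⟩ := h.forms hw hκ
  have hnp : ∀ α γ, β (neg N w α) (pos N w γ) = if γ = α then I else 0 := fun α γ => by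
    rw [h.symm, hpn]
  have hx := h.expansion hdim hβ hw hκ x
  have hGx := congrArg G hx
  simp only [map_sum, map_add, map_smul, chirality_pos hN hGw, chirality_neg hN hGw] at hGx
  constructor
  · conv_lhs => rw [hGx]
    conv_rhs => rw [hx]
    simp [Finset.sum_add_distrib, hnn, hpn, map_sum]
  · conv_lhs => rw [hGx]
    conv_rhs => rw [hx]
    simp [Finset.sum_add_distrib, hnp, hpp, map_sum]

end Fock

/-! ### The Fock frame of a spinor representation -/

namespace SusyD6

open Complex Matrix

variable {t : ℕ} (S : SpinorRep t)

/-- The linear combinations of the gamma matrices. -/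
def SpinorRep.lin (c : Fin 6 → ℂ) : Matrix (Fin 8) (Fin 8) ℂ := ∑ a, c a • S.gam a

theorem metric_self_mul_self (t : ℕ) (a : Fin 6) : metric t a a * metric t a a = 1 := by
  by_cases h : (a : ℕ) < t <;> simp [metric, h]

theorem SpinorRep.lin_anticomm (c c' : Fin 6 → ℂ) :
    S.lin c * S.lin c' + S.lin c' * S.lin c =
      (2 * ∑ a, metric t a a * (c a * c' a)) • (1 : Matrix (Fin 8) (Fin 8) ℂ) := by
  have h1 : S.lin c' * S.lin c = ∑ a, ∑ b, (c a * c' b) • (S.gam b * S.gam a) := by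
    rw [SpinorRep.lin, SpinorRep.lin, Finset.sum_mul, Finset.sum_comm]
    simp only [Finset.mul_sum, smul_mul_smul_comm, mul_comm]
  have h2 : S.lin c * S.lin c' = ∑ a, ∑ b, (c a * c' b) • (S.gam a * S.gam b) := by
    rw [SpinorRep.lin, SpinorRep.lin, Finset.sum_mul]
    simp only [Finset.mul_sum, smul_mul_smul_comm]
  rw [h1, h2, ← Finset.sum_add_distrib]
  simp only [← Finset.sum_add_distrib, ← smul_add, S.clifford, Finset.mul_sum, Finset.sum_smul]
  refine Finset.sum_congr rfl fun a _ => ?_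
  rw [Finset.sum_eq_single a]
  · rw [smul_smul]; congr 1; ring
  · intro b _ hb
    simp [metric, hb.symm]
  · simp

theorem SpinorRep.inv_C_transpose : (S.C⁻¹)ᵀ = S.C⁻¹ := by
  rw [transpose_nonsing_inv, S.C_transpose]

theorem SpinorRep.inv_C_mul_C : S.C⁻¹ * S.C = 1 :=
  nonsing_inv_mul _ ((isUnit_iff_isUnit_det _).1 S.C_isUnit)

theorem SpinorRep.inv_C_mul_lin_transpose (c : Fin 6 → ℂ) :
    S.C⁻¹ * (S.lin c)ᵀ = -(S.lin c * S.C⁻¹) := by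
  have h : ∀ a, S.C⁻¹ * (S.gam a)ᵀ = -(S.gam a * S.C⁻¹) := fun a => by
    rw [S.gam_transpose, mul_neg, ← Matrix.mul_assoc, ← Matrix.mul_assoc, S.inv_C_mul_C,
      Matrix.one_mul]
  simp [SpinorRep.lin, transpose_sum, transpose_smul, Finset.mul_sum, Finset.sum_mul, h]

/-- Coefficients of creation and annihilation operators. -/
noncomputable def coef (t : ℕ) (x : Bool) (k : Fin 3) (a : Fin 6) : ℂ :=
  -- The factor `I` makes the timelike gamma matrices square to +1; then half of γ^{2k} ± iγ^{2k+1}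
  -- are null vectors with anticommutator 1.
  (if (a : ℕ) < t then I else 1) *
    (if (a : ℕ) = 2 * k then 1 / 2
      else if (a : ℕ) = 2 * k + 1 then (if x then I else -I) / 2 else 0)

theorem coef_gram (t : ℕ) (x x' : Bool) (k k' : Fin 3) :
    ∑ a, metric t a a * (coef t x k a * coef t x' k' a) =
      if x = !x' ∧ k = k' then 1 / 2 else 0 := by
  have h : ∀ a : Fin 6, metric t a a * ((if (a : ℕ) < t then I else 1) *
      (if (a : ℕ) < t then I else 1)) = 1 := fun a => by
    by_cases h : (a : ℕ) < t <;> simp [metric, h]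
  have h2 : ∀ a, metric t a a * (coef t x k a * coef t x' k' a) =
      (if (a : ℕ) = 2 * k then 1 / 2
        else if (a : ℕ) = 2 * k + 1 then (if x then I else -I) / 2 else 0) *
      (if (a : ℕ) = 2 * k' then 1 / 2
        else if (a : ℕ) = 2 * k' + 1 then (if x' then I else -I) / 2 else 0) := fun a => by
    rw [coef, coef, mul_mul_mul_comm, ← mul_assoc, h, one_mul]
  simp only [h2]
  have hI : I / 2 * (I / 2) = -(1 / 4) := by linear_combination I_mul_I / 4
  have hI' : -I / 2 * (I / 2) = 1 / 4 := by linear_combination -I_mul_I / 4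
  have hI2 : I / 2 * (-I / 2) = 1 / 4 := by linear_combination -I_mul_I / 4
  have hI3 : -I / 2 * (-I / 2) = -(1 / 4) := by linear_combination I_mul_I / 4
  cases x <;> cases x' <;> fin_cases k <;> fin_cases k' <;>
    simp [Fin.sum_univ_six, hI, hI', hI2, hI3] <;> norm_num

/-- The bilinear form of the charge conjugation matrix. -/
noncomputable def SpinorRep.form : (Fin 8 → ℂ) →ₗ[ℂ] (Fin 8 → ℂ) →ₗ[ℂ] ℂ :=
  Matrix.toLinearMap₂' ℂ S.C⁻¹

theorem SpinorRep.form_apply (x y : Fin 8 → ℂ) : S.form x y = x ⬝ᵥ (S.C⁻¹ *ᵥ y) :=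
  Matrix.toLinearMap₂'_apply' _ _ _

theorem SpinorRep.form_nondegenerate (x : Fin 8 → ℂ) (h : ∀ y, S.form x y = 0) : x = 0 := by
  have h1 : x ᵥ* S.C⁻¹ = 0 := by
    rw [← dotProduct_eq_zero_iff]
    intro y
    rw [← dotProduct_mulVec, ← S.form_apply, h]
  have h2 := congrArg (· ᵥ* S.C) h1
  simpa [vecMul_vecMul, S.inv_C_mul_C] using h2

/-- The right action of linear combinations of the gamma matrices. -/
noncomputable def SpinorRep.op (x : Bool) (k : Fin 3) : (Fin 8 → ℂ) →ₗ[ℂ] (Fin 8 → ℂ) :=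
  Matrix.vecMulLinear (S.lin (coef t x k))

theorem SpinorRep.op_apply (x : Bool) (k : Fin 3) (v : Fin 8 → ℂ) :
    S.op x k v = v ᵥ* S.lin (coef t x k) := rfl

/-- Matrices acting on row spinors from the right compose in reversed order, which anticommutators
do not see. Skewness is the transposition rule of the gamma matrices. -/
theorem SpinorRep.isFock (x : Bool) : Fock.IsFock (S.op x) (S.op !x) S.form := by
  have h : ∀ x y i j (v : Fin 8 → ℂ), S.op x i (S.op y j v) + S.op y j (S.op x i v) =
      if x = !y ∧ i = j then v else 0 := by
    intro x y i j v
    rw [op_apply, op_apply, op_apply, op_apply, vecMul_vecMul, vecMul_vecMul, ← vecMul_add,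
      S.lin_anticomm, coef_gram]
    have : (y = !x ∧ j = i) ↔ (x = !y ∧ i = j) := by
      rw [eq_comm (a := j)]; cases x <;> cases y <;> simp
    simp only [this]
    split_ifs <;> simp
  have hs : ∀ x k (u v : Fin 8 → ℂ), S.form (S.op x k u) v = -S.form u (S.op x k v) := by
    intro x k u v
    rw [S.form_apply, S.form_apply, op_apply, op_apply, ← dotProduct_mulVec, mulVec_mulVec,
      ← mulVec_transpose, mulVec_mulVec, S.inv_C_mul_lin_transpose, neg_mulVec, dotProduct_neg,
      neg_neg]
  refine ⟨fun i j v => ?_, fun i j v => ?_, fun i j v => ?_, fun u v => ?_, hs x, hs _⟩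
  · rw [h]; simp
  · rw [h]; simp
  · rw [h]; simp [eq_comm]
  · rw [S.form_apply, S.form_apply, dotProduct_mulVec, dotProduct_comm, ← mulVec_transpose,
      S.inv_C_transpose]

/-- The sign of a chirality. -/
def sign (s : Bool) : ℂ := if s then 1 else -1

/-- A basis of spinors in which the gamma matrices have a standard form. -/
theorem SpinorRep.exists_frame : ∃ (y : Bool) (u D : Bool → Fin 4 → Fin 8 → ℂ),
    (∀ s α, u s α ᵥ* S.gamHat = sign s • u s α) ∧ (∀ s α, S.gamHat *ᵥ D s α = sign s • D s α) ∧
    (∀ i j, ∑ s, ∑ α, D s α i * u s α j = if i = j then 1 else 0) ∧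
    ∀ x s k α γ, u s α ⬝ᵥ ((S.lin (coef t (x == y) k) * S.C⁻¹) *ᵥ u s γ) =
      if x = s then Fock.alt 0 k.succ α γ else Fock.alt (k + 1).succ (k + 2).succ α γ := by
  set G : (Fin 8 → ℂ) →ₗ[ℂ] (Fin 8 → ℂ) := Matrix.vecMulLinear S.gamHat with hGdef
  have hGa : ∀ v, G v = v ᵥ* S.gamHat := fun v => rfl
  have hG : ∀ v, G (G v) = v := fun v => by
    rw [hGa, hGa, vecMul_vecMul, S.gamHat_sq, vecMul_one]
  have hlin : ∀ c, S.lin c * S.gamHat = -(S.gamHat * S.lin c) := fun c => by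
    rw [SpinorRep.lin, Finset.sum_mul, Finset.mul_sum, ← Finset.sum_neg_distrib]
    refine Finset.sum_congr rfl fun a _ => ?_
    rw [smul_mul_assoc, mul_smul_comm, ← smul_neg, eq_neg_of_add_eq_zero_right
      (S.gamHat_anticomm a)]
  have hN : ∀ x k v, G (S.op x k v) = -S.op x k (G v) := fun x k v => by
    rw [hGa, hGa, op_apply, op_apply, vecMul_vecMul, vecMul_vecMul, hlin, vecMul_neg]
  -- `y` records which of the two families of operators creates from the vacuum of positive
  -- chirality.
  obtain ⟨y, w, hw, hκ, hGw⟩ : ∃ y w, (∀ k, S.op (!y) k w = 0) ∧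
      S.form w (S.op y 0 (S.op y 1 (S.op y 2 w))) = 1 ∧ G w = w := by
    rcases (S.isFock true).exists_chiral_vacuum (by simp) S.form_nondegenerate hG (hN _) (hN _)
      with ⟨w, h⟩ | ⟨w, h⟩
    exacts [⟨true, w, h⟩, ⟨false, w, h⟩]
  have hF := S.isFock y
  obtain ⟨⟨f1, f2, f3, f4⟩, -⟩ := hF.forms hw hκ
  have hD := hF.apply_chirality (by simp) S.form_nondegenerate hw hκ (hN _) hGw
  have hb : ∀ x k (v v' : Fin 8 → ℂ), v ⬝ᵥ ((S.lin (coef t x k) * S.C⁻¹) *ᵥ v') =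
      S.form (S.op x k v) v' := fun x k v v' => by
    rw [S.form_apply, op_apply, ← dotProduct_mulVec, mulVec_mulVec]
  refine ⟨y, fun s => if s then Fock.pos (S.op y) w else Fock.neg (S.op y) w,
    -- The dual basis vectors come from the opposite chirality; `-I` inverts the pairing of `pos`
    -- with `neg`.
    fun s α => -I • S.C⁻¹ *ᵥ (if s then Fock.neg (S.op y) w α else Fock.pos (S.op y) w α),
    ?_, ?_, ?_, ?_⟩
  · rintro (_ | _) α
    · have h := Fock.chirality_neg (hN y) hGw α
      rw [hGa] at h
      simpa [sign] using h
    · have h := Fock.chirality_pos (hN y) hGw α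
      rw [hGa] at h
      simpa [sign] using h
  · have : ∀ (v : Fin 8 → ℂ) (c : ℂ), (∀ x, S.form (G x) v = c * S.form x v) →
        S.gamHat *ᵥ (S.C⁻¹ *ᵥ v) = c • S.C⁻¹ *ᵥ v := fun v c hv => by
      refine dotProduct_eq _ _ fun x => ?_
      have := hv x
      rw [S.form_apply, S.form_apply, hGa, ← dotProduct_mulVec] at this
      rw [dotProduct_comm, this, dotProduct_comm _ x, dotProduct_smul, smul_eq_mul]
    rintro (_ | _) α
    · simp only [mulVec_smul]
      rw [this _ (-1) (fun x => by simpa using (hD x α).2), smul_comm]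
      simp [sign]
    · simp only [mulVec_smul]
      rw [this _ 1 (fun x => by simpa using (hD x α).1), smul_comm]
      simp [sign]
  · intro i j
    have h := congrFun (hF.expansion (by simp) S.form_nondegenerate hw hκ (Pi.single i 1)) j
    simp only [S.form_apply, single_one_dotProduct, Finset.sum_apply, Pi.add_apply, Pi.smul_apply,
      Finset.sum_add_distrib] at h
    simp only [Fintype.sum_bool, Pi.smul_apply]
    simp only [Pi.single_apply, eq_comm (a := j)] at h
    simpa [Finset.sum_add_distrib] using h.symm
  · intro x s k α γ
    rw [hb]
    have hy : ∀ y : Bool, (false == y) = !y := by decide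
    rcases x with _ | _ <;> rcases s with _ | _ <;> simp [f1, f2, f3, f4, hy]

end SusyD6

/-! ### Transfer of the Koszul argument to a retract -/

namespace KoszulList

open GradedReg

variable {R P M : Type*} [CommRing R] [CommRing P] [AddCommGroup M] [Module R M]

theorem valueIdeal_eq_ofList (d : Module.Dual R M) (l : List M) :
    valueIdeal d l = Ideal.ofList (l.map d) := by
  simp [valueIdeal, Ideal.ofList]

/-- A regular sequence is consumed from its head while the acyclic list grows at its head, hence the
reversal. -/
theorem acyclic_reverseAux {ι : Type*} [DecidableEq ι] {d : Module.Dual R M} {v : ι → M}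
    {δ : ι → Module.Dual R M} (hδ : ∀ i j, δ i (v j) = if i = j then 1 else 0) :
    ∀ l l' : List ι, (l ++ l').Nodup → Acyclic d (l'.map v) →
      RegList (Ideal.ofList (l'.map fun i => d (v i))) (l.map fun i => d (v i)) →
      Acyclic d ((l.reverseAux l').map v)
  | [], _, _, h, _ => h
  | i :: l, l', hl, h, hreg => by
    have hl2 : (l ++ i :: l').Nodup := (List.perm_middle.nodup_iff).2 hl
    rw [List.cons_append, List.nodup_cons, List.mem_append, not_or] at hl
    have hv : valueIdeal d (l'.map v) = Ideal.ofList (l'.map fun i => d (v i)) := by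
      rw [valueIdeal_eq_ofList, List.map_map]; rfl
    refine acyclic_reverseAux hδ l (i :: l') hl2 (h.cons (δ := δ i) (fun u hu => ?_)
      (by rw [hδ, if_pos rfl]) (by rw [hv]; exact hreg.1)) ?_
    · obtain ⟨j, hj, rfl⟩ := List.mem_map.1 hu
      rw [hδ, if_neg]
      rintro rfl
      exact hl.1.2 hj
    · rw [List.map_cons, Ideal.ofList_cons, sup_comm]
      exact hreg.2

/-- Only a left inverse of `Φ` is used, so the ghost ring need not be shown isomorphic to the
polynomial ring. -/
theorem RegList.of_retract {Φ : R →+* P} {Ψ : P →+* R} (hΨ : ∀ r, Ψ (Φ r) = r) :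
    ∀ {l : List R} {I : Ideal R} {I' : Ideal P}, I ≤ I'.comap Φ → I' ≤ I.comap Ψ →
      RegList I' (l.map Φ) → RegList I l
  | [], _, _, _, _, _ => trivial
  | x :: l, I, I', h, h', hreg => by
    refine ⟨fun r hr => ?_, RegList.of_retract hΨ (sup_le
      (h.trans (Ideal.comap_mono le_sup_left)) ?_)
      (sup_le (h'.trans (Ideal.comap_mono le_sup_left)) ?_) hreg.2⟩
    · have h1 := hreg.1 (Φ r) (by rw [← map_mul]; exact h hr)
      have h2 := h' h1
      rwa [Ideal.mem_comap, hΨ] at h2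
    · rw [Ideal.span_singleton_le_iff_mem]
      exact Ideal.mem_sup_right (Ideal.mem_span_singleton_self _)
    · rw [Ideal.span_singleton_le_iff_mem, Ideal.mem_comap, hΨ]
      exact Ideal.mem_sup_right (Ideal.mem_span_singleton_self _)

/-- The cycles of a Koszul complex of a regular sequence and a further element. -/
theorem exists_eq_of_retract {ι J : Type*} [DecidableEq ι] [Fintype J] {n : ℕ} {Φ : R →+* P}
    {Ψ : P →+* R} (hΨ : ∀ r, Ψ (Φ r) = r) {d : Module.Dual R M} {v : ι → M}
    {δ : ι → Module.Dual R M} (hδ : ∀ i j, δ i (v j) = if i = j then 1 else 0)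
    (hspan : Submodule.span R (Set.range v) = ⊤) {τ : Fin n → ι} {i₀ : ι}
    (hτ : (i₀ :: (List.finRange n).map τ).Nodup) (hall : ∀ i, i ∈ i₀ :: (List.finRange n).map τ)
    {F : Fin n → P} (hF : ∀ k, Φ (d (v (τ k))) = F k) (hreg : RegList ⊥ ((List.finRange n).map F))
    {θ : J → M} (hθ : ∀ j, d (θ j) = 0)
    (hcolon : ∀ r, Φ (d (v i₀)) * r ∈ Ideal.ofList ((List.finRange n).map F) →
      r ∈ Ideal.ofList ((List.finRange n).map F) ⊔
        Ideal.span (Set.range fun j => Φ (δ i₀ (θ j))))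
    {ω : ExteriorAlgebra R M} (h : contr d ω = 0) :
    ∃ (p : J → R) (p₀ : R) (η : ExteriorAlgebra R M),
      ω = ∑ j, p j • ExteriorAlgebra.ι R (θ j) + algebraMap R _ p₀ + contr d η := by
  have hm : ((List.finRange n).map fun k => d (v (τ k))).map Φ = (List.finRange n).map F := by
    rw [List.map_map]
    exact List.map_congr_left fun k _ => hF k
  rw [List.nodup_cons] at hτ
  have hA : Acyclic d (((List.finRange n).map τ).reverse.map v) := by
    refine acyclic_reverseAux hδ ((List.finRange n).map τ) [] (by simpa using hτ.2)
      (acyclic_nil d) ?_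
    refine RegList.of_retract hΨ (I' := ⊥) (by simp) bot_le ?_
    rw [List.map_map (g := fun i => d (v i))]
    rwa [← hm] at hreg
  have hval : valueIdeal d (((List.finRange n).map τ).reverse.map v) =
      Ideal.ofList ((List.finRange n).map fun k => d (v (τ k))) := by
    rw [valueIdeal, Ideal.ofList]
    congr 1
    ext r
    simp
  refine hA.exists_eq (v := v i₀) (δ := δ i₀) (fun u hu => ?_) (by rw [hδ, if_pos rfl]) ?_ θ hθ
    (fun r hr => ?_) h
  · obtain ⟨j, hj, rfl⟩ := List.mem_map.1 hu
    rw [hδ, if_neg]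
    rintro rfl
    exact hτ.1 (List.mem_reverse.1 hj)
  · rw [← hspan]
    congr 1
    ext u
    constructor
    · intro hu
      rcases List.mem_cons.1 hu with rfl | hu
      · exact ⟨_, rfl⟩
      · obtain ⟨j, -, rfl⟩ := List.mem_map.1 hu
        exact ⟨_, rfl⟩
    · rintro ⟨i, rfl⟩
      rcases List.mem_cons.1 (hall i) with rfl | hi
      · exact List.mem_cons_self
      · exact List.mem_cons_of_mem _ (List.mem_map.2 ⟨i, List.mem_reverse.2 hi, rfl⟩)
  · rw [hval] at hr ⊢
    have h1 : Ideal.ofList ((List.finRange n).map fun k => d (v (τ k))) ≤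
        (Ideal.ofList ((List.finRange n).map F)).comap Φ :=
      ofList_map_le fun k => by rw [Ideal.mem_comap, hF]; exact mem_ofList_map F k
    have h2 := hcolon (Φ r) (by rw [← map_mul]; exact h1 hr)
    have h3 : Ideal.ofList ((List.finRange n).map F) ⊔
        Ideal.span (Set.range fun j => Φ (δ i₀ (θ j))) ≤
        (Ideal.ofList ((List.finRange n).map fun k => d (v (τ k))) ⊔
          Ideal.span (Set.range fun j => δ i₀ (θ j))).comap Ψ := by
      refine sup_le (ofList_map_le fun k => ?_) (Ideal.span_le.2 ?_)
      · rw [Ideal.mem_comap, ← hF, hΨ]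
        exact Ideal.mem_sup_left (mem_ofList_map (fun k => d (v (τ k))) k)
      · rintro _ ⟨j, rfl⟩
        rw [SetLike.mem_coe, Ideal.mem_comap, hΨ]
        exact Ideal.mem_sup_right (Ideal.subset_span ⟨j, rfl⟩)
    have h4 := h3 h2
    rwa [Ideal.mem_comap, hΨ] at h4

end KoszulList

namespace GradedReg

theorem Chiral.exists_lift {A : Type*} [CommRing A] [Algebra ℂ A] (L : Matrix (Fin 4) (Fin 4) A) :
    ∃ Ψ : Poly16 →ₐ[ℂ] A, ∀ i j, Ψ (Chiral.polyCoord i j) = L i j := by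
  -- These are the equations of `Chiral.coord` solved for `y` and `h`.
  refine ⟨MvPolynomial.aeval (Sum.elim ![L 0 3, L 1 3, L 2 0, L 2 1, L 1 0]
    ![L 0 0 + L 1 3, L 0 1, L 0 2 - L 1 0, L 1 1 - L 0 3, L 1 2, L 2 2, L 2 3, L 3 0,
      L 3 1 + L 2 0, L 3 2 - L 2 1, L 3 3]), fun i j => ?_⟩
  fin_cases i <;> fin_cases j <;> simp [Chiral.polyCoord, Chiral.coord]

theorem Mixed.exists_lift {A : Type*} [CommRing A] [Algebra ℂ A] (L : Matrix (Fin 4) (Fin 4) A) :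
    ∃ Ψ : Poly16 →ₐ[ℂ] A, ∀ i j, Ψ (Mixed.polyCoord i j) = L i j := by
  refine ⟨MvPolynomial.aeval (Sum.elim ![L 2 3, L 0 1, L 0 0, L 2 0, L 0 2]
    ![L 1 0 - L 0 1, L 1 1 - L 0 2, L 1 2 - L 0 3, L 1 3 + L 0 0, L 2 1 + L 0 1, L 2 2 + L 0 0,
      L 3 0, L 3 1 - L 2 3, L 3 2 + L 2 0, L 3 3 - L 0 2, L 0 3]), fun i j => ?_⟩
  fin_cases i <;> fin_cases j <;> simp [Mixed.polyCoord, Mixed.coord]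

end GradedReg

/-! ### Ghost components and the coboundary operator in the frame -/

namespace SusyD6

open Complex Matrix GradedReg

variable {t : ℕ} (S : SpinorRep t) (Np Nm : ℕ)

/-- The chirality of a supersymmetry ghost as a truth value. -/
def chir (i : Fin (Np + Nm)) : Bool := decide ((i : ℕ) < Np)

theorem chirality_eq (i : Fin (Np + Nm)) : chirality Np Nm i = sign (chir Np Nm i) := by
  simp [chirality, sign, chir]

/-- A basis of spinors, and the dual basis, in which the gamma matrices have a standard form. -/
structure SpinorRep.Frame where
  /-- the type of the creation operators -/
  y : Bool
  /-- the basis -/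
  u : Bool → Fin 4 → Fin 8 → ℂ
  /-- the dual basis -/
  D : Bool → Fin 4 → Fin 8 → ℂ
  u_gamHat : ∀ s α, u s α ᵥ* S.gamHat = sign s • u s α
  gamHat_D : ∀ s α, S.gamHat *ᵥ D s α = sign s • D s α
  sum_D_mul_u : ∀ i j, ∑ s, ∑ α, D s α i * u s α j = if i = j then 1 else 0
  form_eq : ∀ x s k α γ, u s α ⬝ᵥ ((S.lin (coef t (x == y) k) * S.C⁻¹) *ᵥ u s γ) =
      if x = s then Fock.alt 0 k.succ α γ else Fock.alt (k + 1).succ (k + 2).succ α γ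

theorem SpinorRep.nonempty_frame : Nonempty S.Frame := by
  obtain ⟨y, u, D, h1, h2, h3, h4⟩ := S.exists_frame
  exact ⟨⟨y, u, D, h1, h2, h3, h4⟩⟩

variable {S Np Nm} (f : S.Frame)

namespace SpinorRep.Frame

/-- The components of a supersymmetry ghost with respect to the frame. -/
noncomputable def comp (i : Fin (Np + Nm)) (α : Fin 4) : SusyPoly S Np Nm :=
  ∑ a, f.D (chir Np Nm i) α a • xi S Np Nm i a

theorem sum_gamHat_smul_xi (i : Fin (Np + Nm)) (a : Fin 8) :
    ∑ b, S.gamHat b a • xi S Np Nm i b = sign (chir Np Nm i) • xi S Np Nm i a := by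
  have h : ∑ b, MvPolynomial.C (S.gamHat b a) * MvPolynomial.X (i, b)
      - MvPolynomial.C (chirality Np Nm i) * MvPolynomial.X (i, a) ∈ chiralityIdeal S Np Nm :=
    Ideal.subset_span ⟨(i, a), rfl⟩
  have h2 := Ideal.Quotient.eq_zero_iff_mem.2 h
  rw [map_sub, sub_eq_zero, map_sum] at h2
  simp only [← MvPolynomial.smul_eq_C_mul] at h2
  rw [← chirality_eq]
  exact h2

/-- Evaluating the chirality matrix on the ghost and on the dual vector gives opposite eigenvalues.
-/
theorem sum_D_smul_xi (i : Fin (Np + Nm)) {s : Bool} (hs : s ≠ chir Np Nm i) (α : Fin 4) :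
    ∑ a, f.D s α a • xi S Np Nm i a = 0 := by
  have h1 : ∑ a, (S.gamHat *ᵥ f.D s α) a • xi S Np Nm i a =
      sign (chir Np Nm i) • ∑ a, f.D s α a • xi S Np Nm i a := by
    simp only [mulVec, dotProduct, Finset.sum_smul]
    rw [Finset.sum_comm, Finset.smul_sum]
    refine Finset.sum_congr rfl fun b _ => ?_
    rw [smul_comm, ← sum_gamHat_smul_xi, Finset.smul_sum]
    refine Finset.sum_congr rfl fun a _ => ?_
    rw [smul_smul, mul_comm]
  rw [f.gamHat_D] at h1
  simp only [Pi.smul_apply, smul_assoc, ← Finset.smul_sum] at h1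
  rw [← sub_eq_zero, ← sub_smul, smul_eq_zero] at h1
  refine h1.resolve_left ?_
  revert hs
  generalize chir Np Nm i = s'
  cases s <;> cases s' <;> simp [sign] <;> norm_num

theorem xi_eq (i : Fin (Np + Nm)) (b : Fin 8) :
    xi S Np Nm i b = ∑ α, f.u (chir Np Nm i) α b • f.comp i α := by
  have h1 : xi S Np Nm i b = ∑ a, (if a = b then (1 : ℂ) else 0) • xi S Np Nm i a := by simp
  simp only [← f.sum_D_mul_u] at h1
  have h2 : ∀ s, ∑ a, ∑ α, (f.D s α a * f.u s α b) • xi S Np Nm i a =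
      if s = chir Np Nm i then ∑ α, f.u (chir Np Nm i) α b • f.comp i α else 0 := by
    intro s
    have h3 : ∑ a, ∑ α, (f.D s α a * f.u s α b) • xi S Np Nm i a =
        ∑ α, f.u s α b • ∑ a, f.D s α a • xi S Np Nm i a := by
      rw [Finset.sum_comm]
      simp only [Finset.smul_sum, smul_smul, mul_comm]
    rw [h3]
    split_ifs with hs
    · rw [hs]; rfl
    · simp only [f.sum_D_smul_xi i hs, smul_zero, Finset.sum_const_zero]
  rw [h1]
  simp only [Finset.sum_smul]
  rw [Finset.sum_comm]
  simp only [h2]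
  simp

/-- The homomorphism that prescribes the components of the supersymmetry ghosts. -/
theorem exists_hom {P : Type*} [CommRing P] [Algebra ℂ P] (L : Fin (Np + Nm) → Fin 4 → P) :
    ∃ Φ : SusyPoly S Np Nm →ₐ[ℂ] P, ∀ i b, Φ (xi S Np Nm i b) =
      ∑ α, f.u (chir Np Nm i) α b • L i α := by
  set φ : MvPolynomial (Fin (Np + Nm) × Fin 8) ℂ →ₐ[ℂ] P :=
    MvPolynomial.aeval fun x => ∑ α, f.u (chir Np Nm x.1) α x.2 • L x.1 α with hφ
  refine ⟨Ideal.Quotient.liftₐ _ φ fun p hp => ?_, fun i b => ?_⟩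
  · have : chiralityIdeal S Np Nm ≤ RingHom.ker φ := by
      refine Ideal.span_le.2 ?_
      rintro _ ⟨⟨i, a⟩, rfl⟩
      rw [SetLike.mem_coe, RingHom.mem_ker, map_sub, map_sum]
      simp only [← MvPolynomial.smul_eq_C_mul, map_smul, hφ, MvPolynomial.aeval_X, Finset.smul_sum,
        smul_smul, chirality_eq]
      rw [Finset.sum_comm, ← Finset.sum_sub_distrib]
      refine Finset.sum_eq_zero fun α _ => ?_
      have h := congrFun (f.u_gamHat (chir Np Nm i) α) a
      simp only [vecMul, dotProduct, Pi.smul_apply, smul_eq_mul] at h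
      rw [← Finset.sum_smul, ← sub_smul, ← h]
      simp only [mul_comm (S.gamHat _ _), sub_self, zero_smul]
    exact this hp
  · exact (Ideal.Quotient.liftₐ_apply _ _ _ _).trans (by
      rw [xi]
      simp [hφ])

theorem sum_alt_smul {P : Type*} [CommRing P] [Algebra ℂ P] (x y : Fin 4 → P) {a b : Fin 4}
    (hab : a ≠ b) : ∑ α, ∑ γ, Fock.alt a b α γ • (x α * y γ) = x a * y b - x b * y a := by
  have h : ∀ α γ, Fock.alt a b α γ • (x α * y γ) =
      (if α = a then (if γ = b then x α * y γ else 0) else 0) -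
        (if α = b then (if γ = a then x α * y γ else 0) else 0) := by
    intro α γ
    by_cases h1 : α = a <;> by_cases h2 : γ = b <;> by_cases h3 : α = b <;> by_cases h4 : γ = a <;>
      simp_all [Fock.alt]
  simp [h, Finset.sum_sub_distrib]

/-- The bilinears in terms of components. -/
theorem bilin_components {P : Type*} [CommRing P] [Algebra ℂ P] {s : Bool} {X Y : Fin 8 → P}
    {x y : Fin 4 → P} (hX : ∀ b, X b = ∑ α, f.u s α b • x α)
    (hY : ∀ b, Y b = ∑ α, f.u s α b • y α) (z : Bool) (k : Fin 3) :
    ∑ a, ∑ b, (S.lin (coef t (z == f.y) k) * S.C⁻¹) a b • (X a * Y b) =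
      if z = s then x 0 * y k.succ - x k.succ * y 0
      else x (k + 1).succ * y (k + 2).succ - x (k + 2).succ * y (k + 1).succ := by
  set A := S.lin (coef t (z == f.y) k) * S.C⁻¹ with hA
  have h1 : ∑ a, ∑ b, A a b • (X a * Y b) =
      ∑ α, ∑ γ, (f.u s α ⬝ᵥ (A *ᵥ f.u s γ)) • (x α * y γ) := by
    have h2 : ∀ a b, A a b • (X a * Y b) =
        ∑ α, ∑ γ, (f.u s α a * (A a b * f.u s γ b)) • (x α * y γ) := fun a b => by
      rw [hX, hY, Finset.sum_mul, Finset.smul_sum]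
      refine Finset.sum_congr rfl fun α _ => ?_
      rw [Finset.mul_sum, Finset.smul_sum]
      refine Finset.sum_congr rfl fun γ _ => ?_
      rw [smul_mul_smul_comm, smul_smul]
      congr 1; ring
    simp only [h2, dotProduct, mulVec, Finset.mul_sum, Finset.sum_smul]
    have h3 : ∀ a, ∑ b, ∑ α, ∑ γ, (f.u s α a * (A a b * f.u s γ b)) • (x α * y γ) =
        ∑ α, ∑ γ, ∑ b, (f.u s α a * (A a b * f.u s γ b)) • (x α * y γ) := fun a => by
      rw [Finset.sum_comm]
      exact Finset.sum_congr rfl fun α _ => Finset.sum_comm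
    simp only [h3]
    rw [Finset.sum_comm]
    exact Finset.sum_congr rfl fun α _ => Finset.sum_comm
  rw [h1]
  simp only [hA, f.form_eq]
  have h0 : (0 : Fin 4) ≠ k.succ := (Fin.succ_ne_zero k).symm
  have h12 : ∀ k : Fin 3, (k + 1).succ ≠ (k + 2).succ := by decide
  split_ifs with h
  · exact sum_alt_smul x y h0
  · exact sum_alt_smul x y (h12 k)

end SpinorRep.Frame

end SusyD6

namespace SusyD6

open Complex Matrix GradedReg

variable {t : ℕ} (S : SpinorRep t) (Np Nm : ℕ)

theorem bilin_lin (c : Fin 6 → ℂ) (i j : Fin (Np + Nm)) :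
    bilin S Np Nm (S.lin c * S.C⁻¹) i j = ∑ a, c a • bilin S Np Nm (S.gam a * S.C⁻¹) i j := by
  have h : ∀ α β, (S.lin c * S.C⁻¹) α β = ∑ a, c a * (S.gam a * S.C⁻¹) α β := fun α β => by
    rw [SpinorRep.lin, Finset.sum_mul, Matrix.sum_apply]
    simp
  simp only [bilin, h, Finset.sum_smul, Finset.smul_sum, smul_smul]
  have h2 : ∀ α, ∑ β, ∑ a, (c a * (S.gam a * S.C⁻¹) α β) • (xi S Np Nm i α * xi S Np Nm j β) =
      ∑ a, ∑ β, (c a * (S.gam a * S.C⁻¹) α β) • (xi S Np Nm i α * xi S Np Nm j β) :=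
    fun α => Finset.sum_comm
  simp only [h2]
  rw [Finset.sum_comm]

/-- The matrices `γ^a C⁻¹` are antisymmetric, by the transposition rules for `γ` and `C`, while the
ghosts commute. -/
theorem bilin_gam_swap (a : Fin 6) (i j : Fin (Np + Nm)) :
    bilin S Np Nm (S.gam a * S.C⁻¹) j i = -bilin S Np Nm (S.gam a * S.C⁻¹) i j := by
  have h1 : S.lin (Pi.single a 1) = S.gam a := by
    simp [SpinorRep.lin, Pi.single_apply]
  have h : ∀ α β, (S.gam a * S.C⁻¹) β α = -(S.gam a * S.C⁻¹) α β := fun α β => by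
    have h2 := S.inv_C_mul_lin_transpose (Pi.single a 1)
    rw [h1, ← S.inv_C_transpose, ← transpose_mul, S.inv_C_transpose] at h2
    exact congrFun (congrFun h2 α) β
  rw [bilin, bilin, Finset.sum_comm, ← Finset.sum_neg_distrib]
  refine Finset.sum_congr rfl fun α _ => ?_
  rw [← Finset.sum_neg_distrib]
  refine Finset.sum_congr rfl fun β _ => ?_
  rw [h, neg_smul, mul_comm]

theorem sum_couplingMatrix {A : Type*} [AddCommGroup A] [Module ℂ A] {N : ℕ} (hN : N = 4)
    (g : Fin N → Fin N → A) (hg : ∀ i j, g j i = -g i j) :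
    ∑ i, ∑ j, (-(1 / 2 : ℂ) * couplingMatrix N i j) • g i j =
      I • (g (Fin.cast hN.symm 0) (Fin.cast hN.symm 1) +
        g (Fin.cast hN.symm 2) (Fin.cast hN.symm 3)) := by
  subst hN
  simp only [Fin.sum_univ_four, couplingMatrix, hg 0 1, hg 2 3]
  simp
  rw [← sub_eq_zero]
  module

variable {Np Nm}

/-- The supersymmetry ghosts in numbering by `Fin 4`. -/
def ghostIdx (hN : Np + Nm = 4) (i : Fin 4) : Fin (Np + Nm) := Fin.cast hN.symm i

theorem bc_eq (hN : Np + Nm = 4) (a : Fin 6) : bc S Np Nm a =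
    I • (bilin S Np Nm (S.gam a * S.C⁻¹) (ghostIdx hN 0) (ghostIdx hN 1) +
      bilin S Np Nm (S.gam a * S.C⁻¹) (ghostIdx hN 2) (ghostIdx hN 3)) :=
  sum_couplingMatrix hN _ fun i j => bilin_gam_swap S Np Nm a i j

variable (Np Nm)

/-- The linear form that defines the coboundary operator. -/
noncomputable def diff : Module.Dual (SusyPoly S Np Nm) (Fin 6 → SusyPoly S Np Nm) :=
  ∑ a, bc S Np Nm a • LinearMap.proj a

theorem b_eq_contr (ω : Ghost S Np Nm) : b S Np Nm ω = KoszulList.contr (diff S Np Nm) ω := rfl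

/-- The coefficients of `Theta`. -/
noncomputable def thetaVec (i j : Fin (Np + Nm)) (a : Fin 6) : SusyPoly S Np Nm :=
  bilin S Np Nm (S.gamLow a * S.C⁻¹) i j

theorem Theta_eq (i j : Fin (Np + Nm)) :
    Theta S Np Nm i j = ExteriorAlgebra.ι _ (thetaVec S Np Nm i j) := by
  have h : thetaVec S Np Nm i j = ∑ a, thetaVec S Np Nm i j a • Pi.single a 1 := by
    ext b
    simp [Finset.sum_apply, Pi.single_apply]
  rw [h, map_sum]
  simp only [map_smul]
  rfl

theorem thetaVec_apply (i j : Fin (Np + Nm)) (a : Fin 6) : thetaVec S Np Nm i j a =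
    metric t a a • bilin S Np Nm (S.gam a * S.C⁻¹) i j := by
  have h : S.gamLow a = metric t a a • S.gam a := by
    rw [SpinorRep.gamLow, Finset.sum_eq_single a]
    · intro b _ hb
      simp [metric, hb.symm]
    · simp
  simp only [thetaVec, h, bilin, Matrix.smul_mul, Matrix.smul_apply, smul_eq_mul, Finset.smul_sum,
    smul_smul]

/-- The minors that represent the bilinears of supersymmetry ghosts of chirality `s`. -/
def wedge {A : Type*} [CommRing A] (L : Matrix (Fin 4) (Fin 4) A) (s : Bool) (i j : Fin 4)
    (x : Bool × Fin 3) : A :=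
  if x.1 = s then minor L i j 0 x.2.succ else minor L i j (x.2 + 1).succ (x.2 + 2).succ

variable {S} (f : S.Frame)

namespace SpinorRep.Frame

/-- The vectors of ghosts that correspond to creation and annihilation operators. -/
noncomputable def vec (x : Bool × Fin 3) (a : Fin 6) : SusyPoly S Np Nm :=
  -- The factor `-I` cancels the `I` in `bc_eq`.
  algebraMap ℂ _ (-I * coef t (x.1 == f.y) x.2 a)

/-- The dual basis of `vec`. -/
noncomputable def dualVec (x : Bool × Fin 3) :
    Module.Dual (SusyPoly S Np Nm) (Fin 6 → SusyPoly S Np Nm) :=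
  -- Each null vector pairs only with its conjugate, to 1/2, whence the negated flag and the factor
  -- 2.
  ∑ a, algebraMap ℂ (SusyPoly S Np Nm) (2 * I * (metric t a a * coef t ((!x.1) == f.y) x.2 a)) •
    LinearMap.proj a

theorem dualVec_apply (x : Bool × Fin 3) (m : Fin 6 → SusyPoly S Np Nm) :
    f.dualVec Np Nm x m =
      ∑ a, (2 * I * (metric t a a * coef t ((!x.1) == f.y) x.2 a)) • m a := by
  rw [dualVec, LinearMap.sum_apply]
  refine Finset.sum_congr rfl fun a _ => ?_
  rw [LinearMap.smul_apply, LinearMap.proj_apply, smul_eq_mul, ← Algebra.smul_def]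

theorem sum_coef (x x' : Bool × Fin 3) :
    ∑ a, -I * coef t (x'.1 == f.y) x'.2 a *
      (2 * I * (metric t a a * coef t ((!x.1) == f.y) x.2 a)) = if x = x' then 1 else 0 := by
  have h := coef_gram t ((!x.1) == f.y) (x'.1 == f.y) x.2 x'.2
  have h2 : ((!x.1) == f.y) = !(x'.1 == f.y) ↔ x.1 = x'.1 := by
    cases x.1 <;> cases x'.1 <;> cases f.y <;> decide
  have h4 : (x.1 = x'.1 ∧ x.2 = x'.2) ↔ x = x' := Prod.ext_iff.symm
  simp only [h2, h4] at h
  have h3 : ∑ a, -I * coef t (x'.1 == f.y) x'.2 a *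
      (2 * I * (metric t a a * coef t ((!x.1) == f.y) x.2 a)) =
      -I * I * 2 * ∑ a, metric t a a *
        (coef t ((!x.1) == f.y) x.2 a * coef t (x'.1 == f.y) x'.2 a) := by
    rw [Finset.mul_sum]
    exact Finset.sum_congr rfl fun a _ => by ring
  rw [h3, h]
  split_ifs <;> simp

theorem dualVec_vec (x x' : Bool × Fin 3) :
    f.dualVec Np Nm x (f.vec Np Nm x') = if x = x' then 1 else 0 := by
  rw [dualVec_apply]
  have h : ∀ a, (2 * I * (metric t a a * coef t ((!x.1) == f.y) x.2 a)) • f.vec Np Nm x' a =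
      algebraMap ℂ (SusyPoly S Np Nm) (-I * coef t (x'.1 == f.y) x'.2 a *
        (2 * I * (metric t a a * coef t ((!x.1) == f.y) x.2 a))) := fun a => by
    rw [Algebra.smul_def (2 * I * _) (f.vec Np Nm x' a), vec, ← map_mul, mul_comm]
  simp only [h]
  rw [← map_sum, f.sum_coef]
  split_ifs <;> simp

theorem sum_dualVec_smul_vec (m : Fin 6 → SusyPoly S Np Nm) :
    m = ∑ x, f.dualVec Np Nm x m • f.vec Np Nm x := by
  set P : Matrix (Bool × Fin 3) (Fin 6) ℂ := fun x a => -I * coef t (x.1 == f.y) x.2 a with hP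
  set Q : Matrix (Fin 6) (Bool × Fin 3) ℂ := fun a x =>
    2 * I * (metric t a a * coef t ((!x.1) == f.y) x.2 a) with hQ
  have h1 : P * Q = 1 := by
    ext x' x
    rw [Matrix.mul_apply, Matrix.one_apply]
    rw [f.sum_coef x x']
    simp only [eq_comm]
  have h2 : Q * P = 1 := (Matrix.mul_eq_one_comm_of_card_eq _ _ _ (by simp)).1 h1
  ext a'
  have h3 : ∀ a, ∑ x, Q a x * P x a' = if a = a' then 1 else 0 := fun a => by
    rw [← Matrix.mul_apply, h2, Matrix.one_apply]
  simp only [dualVec_apply, Finset.sum_apply, Pi.smul_apply, smul_eq_mul, Finset.sum_mul]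
  rw [Finset.sum_comm]
  have h4 : ∀ a, ∑ x, (2 * I * (metric t a a * coef t ((!x.1) == f.y) x.2 a)) • m a *
      f.vec Np Nm x a' = (∑ x, Q a x * P x a') • m a := fun a => by
    rw [Finset.sum_smul]
    refine Finset.sum_congr rfl fun x _ => ?_
    rw [vec, mul_comm, ← Algebra.smul_def, smul_smul, mul_comm]
  simp only [h4, h3]
  simp

theorem span_vec : Submodule.span (SusyPoly S Np Nm) (Set.range (f.vec Np Nm)) = ⊤ := by
  rw [eq_top_iff]
  intro m _
  rw [f.sum_dualVec_smul_vec Np Nm m]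
  exact Submodule.sum_mem _ fun x _ => Submodule.smul_mem _ _ (Submodule.subset_span ⟨x, rfl⟩)

theorem diff_eq_sum (m : Fin 6 → SusyPoly S Np Nm) : diff S Np Nm m =
    ∑ x, f.dualVec Np Nm x m * diff S Np Nm (f.vec Np Nm x) := by
  conv_lhs => rw [f.sum_dualVec_smul_vec Np Nm m]
  simp [map_sum]

/-- The metric in the dual basis cancels against the lowered index in Θ, so the coefficient at `x`
involves the conjugate operator, that is, the complementary minor. -/
theorem dualVec_thetaVec (x : Bool × Fin 3) (i j : Fin (Np + Nm)) :
    f.dualVec Np Nm x (thetaVec S Np Nm i j) =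
      (2 * I) • bilin S Np Nm (S.lin (coef t ((!x.1) == f.y) x.2) * S.C⁻¹) i j := by
  rw [dualVec_apply, bilin_lin, Finset.smul_sum]
  refine Finset.sum_congr rfl fun a _ => ?_
  rw [thetaVec_apply, smul_smul, smul_smul]
  congr 1
  linear_combination 2 * I * coef t ((!x.1) == f.y) x.2 a * metric_self_mul_self t a

variable {Np Nm}

theorem diff_vec (hN : Np + Nm = 4) (x : Bool × Fin 3) : diff S Np Nm (f.vec Np Nm x) =
    bilin S Np Nm (S.lin (coef t (x.1 == f.y) x.2) * S.C⁻¹) (ghostIdx hN 0) (ghostIdx hN 1) +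
      bilin S Np Nm (S.lin (coef t (x.1 == f.y) x.2) * S.C⁻¹) (ghostIdx hN 2) (ghostIdx hN 3) := by
  rw [bilin_lin, bilin_lin, ← Finset.sum_add_distrib, diff, LinearMap.sum_apply]
  refine Finset.sum_congr rfl fun a _ => ?_
  rw [LinearMap.smul_apply, LinearMap.proj_apply, vec, smul_eq_mul, mul_comm, ← Algebra.smul_def,
    bc_eq S hN, smul_smul, ← smul_add]
  congr 1
  linear_combination -coef t (x.1 == f.y) x.2 a * I_mul_I

theorem map_bilin (hN : Np + Nm = 4) {P : Type*} [CommRing P] [Algebra ℂ P]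
    (Φ : SusyPoly S Np Nm →ₐ[ℂ] P) {L : Matrix (Fin 4) (Fin 4) P}
    (hΦ : ∀ i b, Φ (xi S Np Nm (ghostIdx hN i) b) =
      ∑ α, f.u (chir Np Nm (ghostIdx hN i)) α b • L i α) {s : Bool} {i j : Fin 4}
    (hi : chir Np Nm (ghostIdx hN i) = s) (hj : chir Np Nm (ghostIdx hN j) = s)
    (x : Bool × Fin 3) :
    Φ (bilin S Np Nm (S.lin (coef t (x.1 == f.y) x.2) * S.C⁻¹) (ghostIdx hN i) (ghostIdx hN j)) =
      wedge L s i j x := by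
  have h1 := hΦ i
  have h2 := hΦ j
  rw [hi] at h1
  rw [hj] at h2
  rw [wedge, minor, minor, ← f.bilin_components h1 h2 x.1 x.2]
  simp [bilin, map_sum]

/-- The matrix of components of the supersymmetry ghosts. -/
noncomputable def compMatrix (hN : Np + Nm = 4) : Matrix (Fin 4) (Fin 4) (SusyPoly S Np Nm) :=
  fun i α => f.comp (ghostIdx hN i) α

theorem bilin_eq (hN : Np + Nm = 4) {s : Bool} {i j : Fin 4}
    (hi : chir Np Nm (ghostIdx hN i) = s) (hj : chir Np Nm (ghostIdx hN j) = s)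
    (x : Bool × Fin 3) :
    bilin S Np Nm (S.lin (coef t (x.1 == f.y) x.2) * S.C⁻¹) (ghostIdx hN i) (ghostIdx hN j) =
      wedge (f.compMatrix hN) s i j x :=
  f.map_bilin hN (AlgHom.id ℂ _) (fun i b => f.xi_eq (ghostIdx hN i) b) hi hj x

/-- The cycles of the coboundary operator, from a regular sequence and a colon ideal. -/
theorem exists_eq (hN : Np + Nm = 4) {s s' : Bool} (h0 : chir Np Nm (ghostIdx hN 0) = s)
    (h1 : chir Np Nm (ghostIdx hN 1) = s) (h2 : chir Np Nm (ghostIdx hN 2) = s')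
    (h3 : chir Np Nm (ghostIdx hN 3) = s') {L : Matrix (Fin 4) (Fin 4) Poly16}
    (hL : ∀ L' : Matrix (Fin 4) (Fin 4) (SusyPoly S Np Nm),
      ∃ Ψ : Poly16 →ₐ[ℂ] SusyPoly S Np Nm, ∀ i j, Ψ (L i j) = L' i j)
    {τ : Fin 5 → Bool × Fin 3} {x₀ : Bool × Fin 3}
    (hτ : (x₀ :: (List.finRange 5).map τ).Nodup) (hall : ∀ x, x ∈ x₀ :: (List.finRange 5).map τ)
    {F : Fin 5 → Poly16} (hF : ∀ k, wedge L s 0 1 (τ k) + wedge L s' 2 3 (τ k) = F k)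
    (hreg : RegList ⊥ ((List.finRange 5).map F)) {J : Type*} [Fintype J]
    {θ : J → Fin 6 → SusyPoly S Np Nm} (hθ : ∀ j, diff S Np Nm (θ j) = 0)
    (hcolon : ∀ Φ : SusyPoly S Np Nm →ₐ[ℂ] Poly16,
      (∀ {s : Bool} {i j : Fin 4}, chir Np Nm (ghostIdx hN i) = s →
        chir Np Nm (ghostIdx hN j) = s → ∀ x, Φ (f.dualVec Np Nm x
          (thetaVec S Np Nm (ghostIdx hN i) (ghostIdx hN j))) =
            (2 * I) • wedge L s i j (!x.1, x.2)) →
      ∀ r, (wedge L s 0 1 x₀ + wedge L s' 2 3 x₀) * r ∈ Ideal.ofList ((List.finRange 5).map F) →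
        r ∈ Ideal.ofList ((List.finRange 5).map F) ⊔
          Ideal.span (Set.range fun j => Φ (f.dualVec Np Nm x₀ (θ j))))
    {ω : Ghost S Np Nm} (h : b S Np Nm ω = 0) :
    ∃ (p : J → SusyPoly S Np Nm) (p₀ : SusyPoly S Np Nm) (η : Ghost S Np Nm),
      ω = ∑ j, p j • ExteriorAlgebra.ι _ (θ j) + algebraMap _ _ p₀ + b S Np Nm η := by
  obtain ⟨Φ, hΦ⟩ := f.exists_hom (fun i α => L (Fin.cast hN i) α)
  have hΦ' : ∀ i b, Φ (xi S Np Nm (ghostIdx hN i) b) =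
      ∑ α, f.u (chir Np Nm (ghostIdx hN i)) α b • L i α := fun i b => hΦ _ b
  obtain ⟨Ψ, hΨ⟩ := hL (f.compMatrix hN)
  have hΨΦ : Ψ.comp Φ = AlgHom.id ℂ _ := by
    refine Ideal.Quotient.algHom_ext _ (MvPolynomial.algHom_ext fun x => ?_)
    have e : Ψ (Φ (xi S Np Nm x.1 x.2)) = xi S Np Nm x.1 x.2 := by
      rw [hΦ, map_sum, f.xi_eq]
      simp only [map_smul, hΨ]
      rfl
    exact e
  have hd : ∀ x, Φ (diff S Np Nm (f.vec Np Nm x)) = wedge L s 0 1 x + wedge L s' 2 3 x := by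
    intro x
    rw [f.diff_vec hN, map_add, f.map_bilin hN Φ hΦ' h0 h1, f.map_bilin hN Φ hΦ' h2 h3]
  refine KoszulList.exists_eq_of_retract (Φ := (Φ : SusyPoly S Np Nm →+* Poly16))
    (Ψ := (Ψ : Poly16 →+* SusyPoly S Np Nm)) (fun r => DFunLike.congr_fun hΨΦ r)
    (f.dualVec_vec Np Nm) (f.span_vec Np Nm) hτ hall (fun k => (hd _).trans (hF k)) hreg hθ
    (fun r hr => hcolon Φ (fun hi hj x => ?_) r ?_) h
  · rw [dualVec_thetaVec, map_smul, ← f.map_bilin hN Φ hΦ' hi hj]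
  · rw [← hd]
    exact hr

end SpinorRep.Frame

end SusyD6

/-! ### Closed combinations of Θ and the two cohomology theorems -/

namespace SusyD6

open Complex Matrix GradedReg

section

variable {A : Type*} [CommRing A] (L : Matrix (Fin 4) (Fin 4) A)

/-- The sum is the coefficient of r_i∧r_j∧(r₀∧r₁ + r₂∧r₃), where every term repeats a row. -/
theorem sum_wedge_mul_chiral (s : Bool) {i j : Fin 4} (hi : i = 0 ∨ i = 1) (hj : j = 2 ∨ j = 3) :
    ∑ x : Bool × Fin 3, wedge L s i j (!x.1, x.2) * (wedge L s 0 1 x + wedge L s 2 3 x) = 0 := by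
  rw [Fintype.sum_prod_type, Fintype.sum_bool, Fin.sum_univ_three, Fin.sum_univ_three]
  rcases hi with rfl | rfl <;> rcases hj with rfl | rfl <;> cases s <;>
    simp [wedge, minor] <;> ring

/-- The pairing is symmetric, so the sum is a difference of two squares, each zero by a Plücker
relation. -/
theorem sum_wedge_mul_diff (s s' : Bool) :
    ∑ x : Bool × Fin 3, (wedge L s 0 1 (!x.1, x.2) - wedge L s' 2 3 (!x.1, x.2)) *
      (wedge L s 0 1 x + wedge L s' 2 3 x) = 0 := by
  rw [Fintype.sum_prod_type, Fintype.sum_bool, Fin.sum_univ_three, Fin.sum_univ_three]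
  cases s <;> cases s' <;> simp [wedge, minor] <;> ring

end

variable {t : ℕ} {S : SpinorRep t} {Np Nm : ℕ}

/-- The coefficients of the five combinations of `Theta` that are closed for equal chirality. -/
noncomputable def chiralTheta (S : SpinorRep t) (hN : Np + Nm = 4) :
    Fin 5 → Fin 6 → SusyPoly S Np Nm :=
  ![thetaVec S Np Nm (ghostIdx hN 0) (ghostIdx hN 2),
    thetaVec S Np Nm (ghostIdx hN 0) (ghostIdx hN 3),
    thetaVec S Np Nm (ghostIdx hN 1) (ghostIdx hN 2),
    thetaVec S Np Nm (ghostIdx hN 1) (ghostIdx hN 3),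
    thetaVec S Np Nm (ghostIdx hN 0) (ghostIdx hN 1) -
      thetaVec S Np Nm (ghostIdx hN 2) (ghostIdx hN 3)]

namespace SpinorRep.Frame

variable (f : S.Frame)

theorem diff_thetaVec (hN : Np + Nm = 4) {s s' : Bool} (h0 : chir Np Nm (ghostIdx hN 0) = s)
    (h1 : chir Np Nm (ghostIdx hN 1) = s) (h2 : chir Np Nm (ghostIdx hN 2) = s')
    (h3 : chir Np Nm (ghostIdx hN 3) = s') {s₁ : Bool} {i j : Fin 4}
    (hi : chir Np Nm (ghostIdx hN i) = s₁) (hj : chir Np Nm (ghostIdx hN j) = s₁) :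
    diff S Np Nm (thetaVec S Np Nm (ghostIdx hN i) (ghostIdx hN j)) =
      (2 * I) • ∑ x : Bool × Fin 3, wedge (f.compMatrix hN) s₁ i j (!x.1, x.2) *
        (wedge (f.compMatrix hN) s 0 1 x + wedge (f.compMatrix hN) s' 2 3 x) := by
  rw [f.diff_eq_sum, Finset.smul_sum]
  refine Finset.sum_congr rfl fun x _ => ?_
  rw [f.dualVec_thetaVec, f.diff_vec hN, f.bilin_eq hN h0 h1, f.bilin_eq hN h2 h3,
    f.bilin_eq hN hi hj (!x.1, x.2), smul_mul_assoc]

theorem diff_sub_thetaVec (f : S.Frame) (hN : Np + Nm = 4) {s s' : Bool} (h0 : chir Np Nm (ghostIdx hN 0) = s)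
    (h1 : chir Np Nm (ghostIdx hN 1) = s) (h2 : chir Np Nm (ghostIdx hN 2) = s')
    (h3 : chir Np Nm (ghostIdx hN 3) = s') :
    diff S Np Nm (thetaVec S Np Nm (ghostIdx hN 0) (ghostIdx hN 1) -
      thetaVec S Np Nm (ghostIdx hN 2) (ghostIdx hN 3)) = 0 := by
  rw [map_sub, f.diff_thetaVec hN h0 h1 h2 h3 h0 h1, f.diff_thetaVec hN h0 h1 h2 h3 h2 h3,
    ← smul_sub, ← Finset.sum_sub_distrib]
  simp only [← sub_mul]
  rw [sum_wedge_mul_diff, smul_zero]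

theorem diff_chiralTheta (f : S.Frame) (hN : Np + Nm = 4) {s : Bool}
    (hs : ∀ i, chir Np Nm (ghostIdx hN i) = s) (k : Fin 5) :
    diff S Np Nm (chiralTheta S hN k) = 0 := by
  have h : ∀ {i j : Fin 4}, i = 0 ∨ i = 1 → j = 2 ∨ j = 3 →
      diff S Np Nm (thetaVec S Np Nm (ghostIdx hN i) (ghostIdx hN j)) = 0 := fun hi hj => by
    rw [f.diff_thetaVec hN (hs 0) (hs 1) (hs 2) (hs 3) (hs _) (hs _),
      sum_wedge_mul_chiral _ s hi hj, smul_zero]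
  fin_cases k
  · exact h (.inl rfl) (.inl rfl)
  · exact h (.inl rfl) (.inr rfl)
  · exact h (.inr rfl) (.inl rfl)
  · exact h (.inr rfl) (.inr rfl)
  · exact f.diff_sub_thetaVec hN (hs 0) (hs 1) (hs 2) (hs 3)

theorem exists_eq_chiral (f : S.Frame) (hN : Np + Nm = 4) {s : Bool}
    (hs : ∀ i, chir Np Nm (ghostIdx hN i) = s) {ω : Ghost S Np Nm} (h : b S Np Nm ω = 0) :
    ∃ (p : Fin 5 → SusyPoly S Np Nm) (p₀ : SusyPoly S Np Nm) (η : Ghost S Np Nm),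
      ω = ∑ k, p k • ExteriorAlgebra.ι _ (chiralTheta S hN k) + algebraMap _ _ p₀ +
        b S Np Nm η := by
  refine f.exists_eq hN (hs 0) (hs 1) (hs 2) (hs 3) (L := Chiral.polyCoord)
    (Chiral.exists_lift)
    -- This order reproduces `Chiral.seq`; the omitted `x₀` corresponds to `quad 2 3`, and the
    -- coefficient of Θ at `x₀` to the complementary columns 0 and 1.
    (τ := ![(!s, 1), (s, 2), (s, 0), (!s, 2), (s, 1)]) (x₀ := (!s, 0)) ?_ ?_
    (F := Chiral.seq Chiral.polyCoord) ?_ Chiral.regList_seq.1 (f.diff_chiralTheta hN hs) ?_ h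
  · cases s <;> decide
  · cases s <;> decide
  · intro k
    cases s <;> fin_cases k <;> rfl
  · intro Φ hΦ r hr
    have hr' : Chiral.quad Chiral.polyCoord 2 3 * r ∈
        Ideal.ofList ((List.finRange 5).map (Chiral.seq Chiral.polyCoord)) := by
      cases s <;> exact hr
    refine SetLike.le_def.1 (sup_le le_sup_left (le_sup_of_le_right ?_))
      (Chiral.mem_of_quad_mul_mem r hr')
    refine ofList_map_le fun k => ?_
    have hk : Φ (f.dualVec Np Nm (!s, 0) (chiralTheta S hN k)) =
        (2 * I) • Chiral.colonGen Chiral.polyCoord k := by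
      have e : ∀ i j, Φ (f.dualVec Np Nm (!s, 0) (thetaVec S Np Nm (ghostIdx hN i)
          (ghostIdx hN j))) = (2 * I) • minor Chiral.polyCoord i j 0 1 := fun i j => by
        rw [hΦ (hs i) (hs j)]
        simp [wedge]
      fin_cases k
      · exact e 0 2
      · exact e 0 3
      · exact e 1 2
      · exact e 1 3
      · refine (congrArg Φ (map_sub _ _ _)).trans ?_
        rw [map_sub, e, e, ← smul_sub]
        rfl
    have hk' : Chiral.colonGen Chiral.polyCoord k =
        MvPolynomial.C (2 * I)⁻¹ * Φ (f.dualVec Np Nm (!s, 0) (chiralTheta S hN k)) := by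
      rw [hk, ← MvPolynomial.smul_eq_C_mul, inv_smul_smul₀ (by simp)]
    rw [hk']
    exact Ideal.mul_mem_left _ _ (Ideal.subset_span ⟨k, rfl⟩)

theorem exists_eq_mixed (f : S.Frame) (hN : Np + Nm = 4) (h0 : chir Np Nm (ghostIdx hN 0) = true)
    (h1 : chir Np Nm (ghostIdx hN 1) = true) (h2 : chir Np Nm (ghostIdx hN 2) = false)
    (h3 : chir Np Nm (ghostIdx hN 3) = false) {ω : Ghost S Np Nm} (h : b S Np Nm ω = 0) :
    ∃ (p p₀ : SusyPoly S Np Nm) (η : Ghost S Np Nm),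
      ω = p • ExteriorAlgebra.ι _ (thetaVec S Np Nm (ghostIdx hN 0) (ghostIdx hN 1) -
        thetaVec S Np Nm (ghostIdx hN 2) (ghostIdx hN 3)) + algebraMap _ _ p₀ +
          b S Np Nm η := by
  refine Exists.elim (f.exists_eq hN h0 h1 h2 h3 (L := Mixed.polyCoord) Mixed.exists_lift
    (τ := ![(true, 1), (true, 0), (true, 2), (false, 1), (false, 2)]) (x₀ := (false, 0))
    (by decide) (by decide) (F := Mixed.seq Mixed.polyCoord) (fun k => by fin_cases k <;> rfl)
    Mixed.regList_seq.1 (J := Unit)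
    (θ := fun _ => thetaVec S Np Nm (ghostIdx hN 0) (ghostIdx hN 1) -
        thetaVec S Np Nm (ghostIdx hN 2) (ghostIdx hN 3))
    (fun _ => f.diff_sub_thetaVec hN h0 h1 h2 h3) (fun Φ hΦ r hr => ?_) h) ?_
  swap
  · rintro p ⟨p₀, η, e⟩
    exact ⟨p (), p₀, η, by simpa using e⟩
  · have hr' := Mixed.mem_of_last_mul_mem r hr
    refine SetLike.le_def.1 (sup_le le_sup_left ?_) hr'
    rw [Ideal.span_singleton_le_iff_mem]
    -- The coefficient is `minor 0 1 0 1 - minor 2 3 2 3`; since the sum of these minors is the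
    -- quadric `seq 1`, it is twice the first minor modulo the quadrics.
    have e1 : Φ (f.dualVec Np Nm (false, 0) (thetaVec S Np Nm (ghostIdx hN 0) (ghostIdx hN 1) -
        thetaVec S Np Nm (ghostIdx hN 2) (ghostIdx hN 3))) =
        (2 * I) • (2 * minor Mixed.polyCoord 0 1 0 1 - Mixed.seq Mixed.polyCoord 1) := by
      rw [map_sub, map_sub, hΦ h0 h1, hΦ h2 h3, ← smul_sub]
      congr 1
      simp [wedge, Mixed.seq]
      ring
    have e2 : minor Mixed.polyCoord 0 1 0 1 = MvPolynomial.C (1 / 2) * Mixed.seq Mixed.polyCoord 1 +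
        MvPolynomial.C (4 * I)⁻¹ * Φ (f.dualVec Np Nm (false, 0)
          (thetaVec S Np Nm (ghostIdx hN 0) (ghostIdx hN 1) -
            thetaVec S Np Nm (ghostIdx hN 2) (ghostIdx hN 3))) := by
      rw [e1]
      have h4 : (4 * I)⁻¹ * (2 * I) = (1 / 2 : ℂ) := by
        field_simp
        norm_num
      have h5 : (MvPolynomial.C (1 / 2) * 2 : Poly16) = 1 := by
        rw [show (2 : Poly16) = MvPolynomial.C 2 from (map_ofNat _ 2).symm, ← MvPolynomial.C_mul]
        norm_num
      rw [MvPolynomial.smul_eq_C_mul, ← mul_assoc, ← MvPolynomial.C_mul, h4]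
      linear_combination (-minor Mixed.polyCoord 0 1 0 1) * h5
    rw [e2]
    exact Ideal.add_mem _ (Ideal.mul_mem_left _ _ (Ideal.mem_sup_left (mem_ofList_map _ 1)))
      (Ideal.mul_mem_left _ _ (Ideal.mem_sup_right (Ideal.subset_span ⟨(), rfl⟩)))

end SpinorRep.Frame

theorem b_b (η : Ghost S Np Nm) : b S Np Nm (b S Np Nm η) = 0 :=
  KoszulList.contr_contr _ _

theorem b_algebraMap (p : SusyPoly S Np Nm) : b S Np Nm (algebraMap _ _ p) = 0 :=
  KoszulList.contr_algebraMap _ _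

theorem b_ι {m : Fin 6 → SusyPoly S Np Nm} (hm : diff S Np Nm m = 0) :
    b S Np Nm (ExteriorAlgebra.ι _ m) = 0 := by
  rw [b_eq_contr, KoszulList.contr_ι, hm, map_zero]

theorem Equivalent.b_eq_zero {ω ω' : Ghost S Np Nm} (h : Equivalent S Np Nm ω ω')
    (h' : b S Np Nm ω' = 0) : b S Np Nm ω = 0 := by
  obtain ⟨η, h⟩ := h
  rw [sub_eq_iff_eq_add.1 h, map_add, b_b, h', add_zero]

theorem b_eq_zero_iff_chiral (hN : Np + Nm = 4) {s : Bool}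
    (hs : ∀ i, chir Np Nm (ghostIdx hN i) = s) (ω : Ghost S Np Nm) :
    b S Np Nm ω = 0 ↔ ∃ p₁₃ p₁₄ p₂₃ p₂₄ p₁ p₀ : SusyPoly S Np Nm, Equivalent S Np Nm ω
      (p₁₃ • Theta S Np Nm (ghostIdx hN 0) (ghostIdx hN 2)
        + p₁₄ • Theta S Np Nm (ghostIdx hN 0) (ghostIdx hN 3)
        + p₂₃ • Theta S Np Nm (ghostIdx hN 1) (ghostIdx hN 2)
        + p₂₄ • Theta S Np Nm (ghostIdx hN 1) (ghostIdx hN 3)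
        + p₁ • (Theta S Np Nm (ghostIdx hN 0) (ghostIdx hN 1) -
          Theta S Np Nm (ghostIdx hN 2) (ghostIdx hN 3))
        + algebraMap (SusyPoly S Np Nm) (Ghost S Np Nm) p₀) := by
  obtain ⟨f⟩ := S.nonempty_frame
  simp only [Theta_eq, ← map_sub]
  constructor
  · intro h
    obtain ⟨p, p₀, η, e⟩ := f.exists_eq_chiral hN hs h
    rw [Fin.sum_univ_five] at e
    exact ⟨p 0, p 1, p 2, p 3, p 4, p₀, η, sub_eq_iff_eq_add'.2 e⟩
  · rintro ⟨p₁₃, p₁₄, p₂₃, p₂₄, p₁, p₀, h⟩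
    refine h.b_eq_zero ?_
    have hb : ∀ k, b S Np Nm (ExteriorAlgebra.ι _ (chiralTheta S hN k)) = 0 := fun k =>
      b_ι (f.diff_chiralTheta hN hs k)
    simp only [map_add, map_smul]
    rw [b_algebraMap]
    have e0 := hb 0
    have e1 := hb 1
    have e2 := hb 2
    have e3 := hb 3
    have e4 := hb 4
    simp only [chiralTheta, Matrix.cons_val] at e0 e1 e2 e3 e4
    simp only [e0, e1, e2, e3, e4, smul_zero, add_zero]

theorem b_eq_zero_iff_mixed (hN : Np + Nm = 4) (h0 : chir Np Nm (ghostIdx hN 0) = true)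
    (h1 : chir Np Nm (ghostIdx hN 1) = true) (h2 : chir Np Nm (ghostIdx hN 2) = false)
    (h3 : chir Np Nm (ghostIdx hN 3) = false) (ω : Ghost S Np Nm) :
    b S Np Nm ω = 0 ↔ ∃ p₁ p₀ : SusyPoly S Np Nm, Equivalent S Np Nm ω
      (p₁ • (Theta S Np Nm (ghostIdx hN 0) (ghostIdx hN 1) -
          Theta S Np Nm (ghostIdx hN 2) (ghostIdx hN 3))
        + algebraMap (SusyPoly S Np Nm) (Ghost S Np Nm) p₀) := by
  obtain ⟨f⟩ := S.nonempty_frame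
  simp only [Theta_eq, ← map_sub]
  constructor
  · intro h
    obtain ⟨p, p₀, η, e⟩ := f.exists_eq_mixed hN h0 h1 h2 h3 h
    exact ⟨p, p₀, η, sub_eq_iff_eq_add'.2 e⟩
  · rintro ⟨p, p₀, h⟩
    refine h.b_eq_zero ?_
    rw [map_add, map_smul, b_algebraMap, b_ι (f.diff_sub_thetaVec hN h0 h1 h2 h3), smul_zero,
      add_zero]

end SusyD6

theorem mainTheorem7 (t : ℕ) (ht : t = 1 ∨ t = 3 ∨ t = 5) (S : SusyD6.SpinorRep t) :
    (∀ ω : SusyD6.Ghost S 2 2,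
      SusyD6.b S 2 2 ω = 0 ↔
        ∃ p₁ p₀ : SusyD6.SusyPoly S 2 2,
          SusyD6.Equivalent S 2 2 ω
            (p₁ • (SusyD6.Theta S 2 2 0 1 - SusyD6.Theta S 2 2 2 3)
              + algebraMap (SusyD6.SusyPoly S 2 2) (SusyD6.Ghost S 2 2) p₀)) ∧
    (∀ ω : SusyD6.Ghost S 4 0,
      SusyD6.b S 4 0 ω = 0 ↔
        ∃ p₁₃ p₁₄ p₂₃ p₂₄ p₁ p₀ : SusyD6.SusyPoly S 4 0,
          SusyD6.Equivalent S 4 0 ω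
            (p₁₃ • SusyD6.Theta S 4 0 0 2 + p₁₄ • SusyD6.Theta S 4 0 0 3
              + p₂₃ • SusyD6.Theta S 4 0 1 2 + p₂₄ • SusyD6.Theta S 4 0 1 3
              + p₁ • (SusyD6.Theta S 4 0 0 1 - SusyD6.Theta S 4 0 2 3)
              + algebraMap (SusyD6.SusyPoly S 4 0) (SusyD6.Ghost S 4 0) p₀)) ∧
    (∀ ω : SusyD6.Ghost S 0 4,
      SusyD6.b S 0 4 ω = 0 ↔
        ∃ p₁₃ p₁₄ p₂₃ p₂₄ p₁ p₀ : SusyD6.SusyPoly S 0 4,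
          SusyD6.Equivalent S 0 4 ω
            (p₁₃ • SusyD6.Theta S 0 4 0 2 + p₁₄ • SusyD6.Theta S 0 4 0 3
              + p₂₃ • SusyD6.Theta S 0 4 1 2 + p₂₄ • SusyD6.Theta S 0 4 1 3
              + p₁ • (SusyD6.Theta S 0 4 0 1 - SusyD6.Theta S 0 4 2 3)
              + algebraMap (SusyD6.SusyPoly S 0 4) (SusyD6.Ghost S 0 4) p₀)) := by
  refine ⟨fun ω => ?_, fun ω => ?_, fun ω => ?_⟩
  · exact SusyD6.b_eq_zero_iff_mixed (Np := 2) (Nm := 2) rfl rfl rfl rfl rfl ω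
  · exact SusyD6.b_eq_zero_iff_chiral (Np := 4) (Nm := 0) rfl (s := true) (by decide) ω
  · exact SusyD6.b_eq_zero_iff_chiral (Np := 0) (Nm := 4) rfl (s := false) (by decide) ω
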